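/- All algorithms are deterministic random access machines with addition, subtraction and indirect addressing, charged by the logarithmic cost measure. A CNF formula $\phi$ is a list of clauses over a given finite set of variables, and $|\phi|$ is $1$ plus the number of variables, the number of clauses and the number of literal occurrences. A set $B$ of variables is a \emph{strong 2-SAT backdoor} of $\phi$ if for every assignment to $B$ the simplified formula (delete the clauses that contain a true literal over $B$, and delete the false literals over $B$ from the other clauses) has at most two distinct literals in every clause. The \emph{primal graph} of $\phi$ has the variables as vertices, two distinct variables being adjacent if some clause contains both. For a set $M$ of variables (the \emph{modulator}), $\phi-M$ denotes the graph obtained from the primal graph of $\phi$ by removing the vertices of $M$. The following are equivalent: 1. (2SatB-SETH is false) There is an $\varepsilon\in(0,1)$ and an algorithm that takes as input a CNF formula $\phi$ and a strong 2-SAT backdoor of $\phi$ of size $b$, and decides whether $\phi$ is satisfiable in time $(2-\varepsilon)^b|\phi|^{O(1)}$. 2. (logpwM-SETH is false) There is an $\varepsilon\in(0,1)$ such that for every constant $c\in\mathbb N$ there is an algorithm that takes as input a CNF formula $\phi$, a set $M$ of $m$ variables, and a path decomposition of $\phi-M$ of width at most $c\log_2|\phi|$ with $r$ bags, and decides whether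 $\phi$ is satisfiable in time $(2-\varepsilon)^m(|\phi|+r)^{O(1)}$, where the constant in the exponent may depend on $c$. (Here $r$ accounts for the length of the given decomposition; it is at most $|\phi|$ if no bag is contained in a neighbouring one, and then the bound reads $(2-\varepsilon)^m|\phi|^{O(1)}$.) In both items a time bound $T^{O(1)}$ is understood as $K\,T^{K}$ for some constant $K\in\mathbb N$ that does not depend on the input. -/

import Mathlib

namespace SatHyp

/-! ## CNF formulas -/

/-- A literal over the variables `0, …, n - 1`: a variable and its sign (`true` = positive). -/
abbrev Literal (n : ℕ) : Type := Fin n × Bool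

/-- A clause is a disjunction of literals. -/
abbrev Clause (n : ℕ) : Type := List (Literal n)

/-- A CNF formula on `n` variables is a conjunction of clauses. -/
abbrev CNF (n : ℕ) : Type := List (Clause n)

/-- The literal `l` is true under the assignment `τ`. -/
def Literal.Holds {n : ℕ} (τ : Fin n → Bool) (l : Literal n) : Prop := τ l.1 = l.2

/-- The formula `φ` is satisfied by the assignment `τ`. -/
def CNF.SatisfiedBy {n : ℕ} (φ : CNF n) (τ : Fin n → Bool) : Prop :=
  ∀ C ∈ φ, ∃ l ∈ C, Literal.Holds τ l

/-- The formula `φ` is satisfiable. -/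
def CNF.Satisfiable {n : ℕ} (φ : CNF n) : Prop := ∃ τ : Fin n → Bool, φ.SatisfiedBy τ

/-- The size `|φ|`: one, plus the number of variables, the number of clauses and the number of
occurrences of literals. It is always positive. -/
def CNF.size {n : ℕ} (φ : CNF n) : ℕ :=
  1 + n + φ.length + (φ.map List.length).sum

/-! ## Strong 2-SAT backdoors -/

/-- Every clause has at most two (distinct) literals. -/
def CNF.Is2CNF {n : ℕ} (φ : CNF n) : Prop := ∀ C ∈ φ, C.toFinset.card ≤ 2

/-- The formula obtained from `φ` by giving the variables of `B` their values under `τ`: the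
clauses that contain a true literal over `B` are removed, and the (false) literals over `B` are
deleted from the others. Only the values of `τ` on `B` matter. -/
def CNF.restrict {n : ℕ} (φ : CNF n) (B : Finset (Fin n)) (τ : Fin n → Bool) : CNF n :=
  (φ.filter fun C => decide (∀ l ∈ C, ¬ (l.1 ∈ B ∧ τ l.1 = l.2))).map
    fun C => C.filter fun l => decide (l.1 ∉ B)

/-- `B` is a strong 2-SAT backdoor of `φ`: each assignment to `B` leaves a 2-CNF formula. -/
def IsStrong2SatBackdoor {n : ℕ} (φ : CNF n) (B : Finset (Fin n)) : Prop :=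
  ∀ τ : Fin n → Bool, (φ.restrict B τ).Is2CNF

/-! ## Primal graphs, modulators and path decompositions -/

/-- The variable `v` occurs (positively or negatively) in the clause `C`. -/
def Clause.HasVar {n : ℕ} (C : Clause n) (v : Fin n) : Prop := ∃ l ∈ C, l.1 = v

/-- The primal graph of `φ`: distinct variables are adjacent when some clause contains both. -/
def CNF.primalGraph {n : ℕ} (φ : CNF n) : SimpleGraph (Fin n) where
  Adj u v := u ≠ v ∧ ∃ C ∈ φ, Clause.HasVar C u ∧ Clause.HasVar C v
  symm := ⟨fun _ _ h => ⟨h.1.symm, h.2.imp fun _ hC => ⟨hC.1, hC.2.2, hC.2.1⟩⟩⟩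
  loopless := ⟨fun _ h => h.1 rfl⟩

/-- The primal graph of `φ` with the vertices of the modulator `M` removed. -/
def CNF.primalGraphMinus {n : ℕ} (φ : CNF n) (M : Finset (Fin n)) :
    SimpleGraph {v : Fin n // v ∉ M} :=
  φ.primalGraph.comap Subtype.val

/-- The sequence `D` of bags is a path decomposition of `G`. -/
structure IsPathDecomposition {V : Type*} (G : SimpleGraph V) (D : List (Finset V)) : Prop where
  vertex_mem : ∀ v : V, ∃ X ∈ D, v ∈ X
  edge_mem : ∀ u v : V, G.Adj u v → ∃ X ∈ D, u ∈ X ∧ v ∈ X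
  contiguous : ∀ (v : V) (i j k : Fin D.length), i ≤ j → j ≤ k →
    v ∈ D.get i → v ∈ D.get k → v ∈ D.get j

/-- The width of `D` (the largest size of a bag, minus one) is at most `w`. -/
def WidthAtMost {V : Type*} (D : List (Finset V)) (w : ℝ) : Prop :=
  ∀ X ∈ D, (X.card : ℝ) - 1 ≤ w

/-! ## Random access machines with logarithmic cost

A machine has registers `R 0, R 1, …` and memory arrays `A 0, A 1, …`, all holding natural
numbers and all indexed by natural numbers; a program mentions finitely many registers and arrays.
Memory is reached only by indirect addressing. Each executed instruction costs one plus the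
bit lengths of the numbers that it handles. -/

/-- Programs of the random access machine. -/
inductive Prog : Type
  /-- `R r := k` -/
  | const (r k : ℕ)
  /-- `R r := R s + R t` -/
  | add (r s t : ℕ)
  /-- `R r := max (R s - R t) 0` -/
  | sub (r s t : ℕ)
  /-- `R r := A a [R s]` -/
  | load (r a s : ℕ)
  /-- `A a [R s] := R t` -/
  | store (a s t : ℕ)
  /-- `p`, then `q` -/
  | seq (p q : Prog)
  /-- if `R r ≠ 0` then `p` else `q` -/
  | ite (r : ℕ) (p q : Prog)
  /-- while `R r ≠ 0` do `p` -/
  | loop (r : ℕ) (p : Prog)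

/-- The contents of the registers and of the memory arrays. -/
structure State : Type where
  reg : ℕ → ℕ
  arr : ℕ → ℕ → ℕ

/-- Write `x` into the register `r`. -/
def State.setReg (σ : State) (r x : ℕ) : State :=
  { σ with reg := Function.update σ.reg r x }

/-- Write `x` into cell `i` of the array `a`. -/
def State.setArr (σ : State) (a i x : ℕ) : State :=
  { σ with arr := Function.update σ.arr a (Function.update (σ.arr a) i x) }

/-- `Run p σ t σ'`: the program `p`, started in the state `σ`, halts in the state `σ'`, and the
total cost of the executed instructions is `t`. (`Nat.size` is the length in binary.) -/
inductive Run : Prog → State → ℕ → State → Prop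
  | const (r k : ℕ) (σ : State) :
      Run (.const r k) σ (1 + k.size) (σ.setReg r k)
  | add (r s t : ℕ) (σ : State) :
      Run (.add r s t) σ (1 + (σ.reg s).size + (σ.reg t).size) (σ.setReg r (σ.reg s + σ.reg t))
  | sub (r s t : ℕ) (σ : State) :
      Run (.sub r s t) σ (1 + (σ.reg s).size + (σ.reg t).size) (σ.setReg r (σ.reg s - σ.reg t))
  | load (r a s : ℕ) (σ : State) :
      Run (.load r a s) σ (1 + (σ.reg s).size + (σ.arr a (σ.reg s)).size)
        (σ.setReg r (σ.arr a (σ.reg s)))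
  | store (a s t : ℕ) (σ : State) :
      Run (.store a s t) σ (1 + (σ.reg s).size + (σ.reg t).size)
        (σ.setArr a (σ.reg s) (σ.reg t))
  | seq {p q : Prog} {σ σ' σ'' : State} {t t' : ℕ} :
      Run p σ t σ' → Run q σ' t' σ'' → Run (.seq p q) σ (t + t') σ''
  | ite_true {r : ℕ} {p q : Prog} {σ σ' : State} {t : ℕ} :
      σ.reg r ≠ 0 → Run p σ t σ' → Run (.ite r p q) σ (1 + (σ.reg r).size + t) σ'
  | ite_false {r : ℕ} {p q : Prog} {σ σ' : State} {t : ℕ} :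
      σ.reg r = 0 → Run q σ t σ' → Run (.ite r p q) σ (1 + (σ.reg r).size + t) σ'
  | loop_done {r : ℕ} {p : Prog} {σ : State} :
      σ.reg r = 0 → Run (.loop r p) σ (1 + (σ.reg r).size) σ
  | loop_step {r : ℕ} {p : Prog} {σ σ' σ'' : State} {t t' : ℕ} :
      σ.reg r ≠ 0 → Run p σ t σ' → Run (.loop r p) σ' t' σ'' →
      Run (.loop r p) σ (1 + (σ.reg r).size + t + t') σ''

/-- The initial state on an input word: the word stands in the array `A 0` and its length in the
register `R 0`; everything else is zero. -/
def State.init (w : List ℕ) : State where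
  reg := fun r => if r = 0 then w.length else 0
  arr := fun a i => if a = 0 then w.getD i 0 else 0

/-- The program `P` decides the (promise) problem whose instances are the elements of `ι`, encoded
by `enc`, and whose yes-instances are given by `yes`: on every instance `x` it halts at cost at
most `T x`, with a nonzero number in `R 0` exactly when `x` is a yes-instance. -/
def DecidesInTime {ι : Type} (P : Prog) (enc : ι → List ℕ) (yes : ι → Prop) (T : ι → ℝ) : Prop :=
  ∀ x : ι, ∃ (t : ℕ) (σ : State),
    Run P (State.init (enc x)) t σ ∧ (σ.reg 0 ≠ 0 ↔ yes x) ∧ (t : ℝ) ≤ T x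

/-! ## Encodings of the inputs -/

/-- A list is encoded by its length followed by the codes of its elements. -/
def encodeList {α : Type*} (f : α → List ℕ) (l : List α) : List ℕ := l.length :: l.flatMap f

/-- The literals `x_v` and `¬ x_v` are encoded by `2 v + 1` and `2 v`. -/
def encodeLiteral {n : ℕ} (l : Literal n) : List ℕ := [2 * l.1.val + l.2.toNat]

/-- A formula is encoded by its number of variables and the list of its clauses. -/
def CNF.encode {n : ℕ} (φ : CNF n) : List ℕ := n :: encodeList (encodeList encodeLiteral) φ

/-- A set of variables is encoded by the increasing list of its elements. -/
def encodeVarSet {n : ℕ} (S : Finset (Fin n)) : List ℕ :=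
  encodeList (fun v => [v.val]) (S.sort (· ≤ ·))

/-- A CNF formula with a strong 2-SAT backdoor. -/
structure BackdoorInstance : Type where
  n : ℕ
  φ : CNF n
  B : Finset (Fin n)
  isBackdoor : IsStrong2SatBackdoor φ B

def BackdoorInstance.encode (I : BackdoorInstance) : List ℕ :=
  I.φ.encode ++ encodeVarSet I.B

/-- A CNF formula with a modulator `M` and a path decomposition, of width at most
`c * log₂ |φ|`, of what remains of the primal graph after removing `M`. -/
structure LogPwInstance (c : ℕ) : Type where
  n : ℕ
  φ : CNF n
  M : Finset (Fin n)
  D : List (Finset {v : Fin n // v ∉ M})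
  isDecomposition : IsPathDecomposition (φ.primalGraphMinus M) D
  width_le : WidthAtMost D (c * Real.logb 2 φ.size)

def LogPwInstance.encode {c : ℕ} (I : LogPwInstance c) : List ℕ :=
  I.φ.encode ++ encodeVarSet I.M ++
    encodeList (fun X => encodeVarSet (X.map (Function.Embedding.subtype _))) I.D

end SatHyp

/-! Both problems ask the same thing about a nondeterministic search in logarithmic space: is there
an assignment `τ` to the distinguished set of variables (backdoor or modulator) such that a target
is reachable in a directed graph of polynomial size, whose edges are labelled by constants or by
literals over that set? Such a graph, computed uniformly from the input word, is a `PGraph`. Two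
translations lead into this form and two lead out of it.

In, from a backdoor: once `τ` is fixed, a 2-SAT instance is left, and it is unsatisfiable exactly if
some literal `x` has implication chains from `x` to `¬x` and back. `cycleGraph` searches for such a
cycle and looks at `τ` only through edge labels, so satisfiability means that for some `τ` the
target is NOT reachable (`satisfiable_iff_not_cycle`). In, from a modulator: `walkGraph` moves along
the bags and remembers an assignment to the current bag. The width is logarithmic, so there are
polynomially many assignments, and satisfiability means that for some `τ` the target IS reachable
(`LogPwInstance.satisfiable_iff`).

Out, to a backdoor: with one new variable per vertex, the clauses `¬x ∨ y ∨ ¬label` describe a set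
of vertices closed under the available edges. They have at most two distinct literals outside the
old set, and they express NON-reachability (`exists_model_edgeClauses_iff`,
`isBackdoor_edgeClauses`). Out, to a modulator: a walk is written down layer by layer, the vertex of
each layer in binary. Two consecutive layers fit into a bag of logarithmic size, and the formula
expresses REACHABILITY (`exists_model_layerClauses_iff`, `widthAtMost_layers`).

The polarities do not match: a search that yields reachability has to be fed into the formula for
non-reachability, and conversely. The bridge is the inductive counting of Immerman and Szelepcsényi,
carried out on labelled graphs uniformly in `τ`: `PGraph.compl` has its target reachable under `τ`
exactly if the original graph does not (`count_reach_iff`), and its labels are still literals over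
the same set. Thus each reduction preserves the size of the distinguished set exactly, and the same
`ε` serves on both sides.

The rest is machine work. Functions are built from sums and capped iterations (`PTN`, `PT`), lists
from nested bounded loops (`PTL`). Everything is polynomial in the values of the input numbers, not
only in their lengths, which is enough because all entries of an encoded instance are linear in its
size. Structural induction gives polynomial bounds and programs (`PTN.compiles`, `PTL.emits`), and
`DecidesInTime.reduce` composes a reduction with a decision program. -/

namespace SatHyp

/-! ## Polynomial time functions -/

/-- A context: finitely described data that a program can read, namely some numbers and some
arrays of numbers, all of them bounded by a magnitude. -/
class Ctx (α : Type) where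
  V : Type
  var : V → α → ℕ
  A : Type
  arr : A → α → ℕ → ℕ
  mag : α → ℕ
  var_le : ∀ v a, var v a ≤ mag a
  arr_le : ∀ r a i, arr r a i ≤ mag a

instance : Ctx ℕ where
  V := Unit
  var _ n := n
  A := Empty
  arr r _ _ := r.elim
  mag n := n
  var_le _ _ := le_rfl
  arr_le r := r.elim

instance : Ctx Bool where
  V := Unit
  var _ b := b.toNat
  A := Empty
  arr r _ _ := r.elim
  mag b := b.toNat
  var_le _ _ := le_rfl
  arr_le r := r.elim

/-- Entry `i` of the list `w`, zero if there is none. -/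
def cell (w : List ℕ) (i : ℕ) : ℕ := w.getD i 0

theorem cell_le_sum (w : List ℕ) (i : ℕ) : cell w i ≤ w.sum := by
  unfold cell
  induction w generalizing i with
  | nil => simp
  | cons a l ih =>
    cases i with
    | zero => simp
    | succ i => have := ih i; simp only [List.getD_cons_succ, List.sum_cons]; omega

instance : Ctx (List ℕ) where
  V := Unit
  var _ w := w.length
  A := Unit
  arr _ w i := cell w i
  mag w := w.length + w.sum
  var_le _ _ := by omega
  arr_le _ w i := by have := cell_le_sum w i; omega

instance {α β : Type} [Ctx α] [Ctx β] : Ctx (α × β) where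
  V := Ctx.V α ⊕ Ctx.V β
  var v p := v.elim (fun v => Ctx.var v p.1) (fun v => Ctx.var v p.2)
  A := Ctx.A α ⊕ Ctx.A β
  arr r p i := r.elim (fun r => Ctx.arr r p.1 i) (fun r => Ctx.arr r p.2 i)
  mag p := Ctx.mag p.1 + Ctx.mag p.2
  var_le v p := by
    rcases v with v | v
    · exact (Ctx.var_le v p.1).trans (Nat.le_add_right _ _)
    · exact (Ctx.var_le v p.2).trans (Nat.le_add_left _ _)
  arr_le v p i := by
    rcases v with v | v
    · exact (Ctx.arr_le v p.1 i).trans (Nat.le_add_right _ _)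
    · exact (Ctx.arr_le v p.2 i).trans (Nat.le_add_left _ _)

/-- The numerical functions obtained from the data by addition, subtraction, bounded sums and
iteration of functions capped by a bound. -/
inductive PTN : {α : Type} → [Ctx α] → (α → ℕ) → Prop
  | var {α : Type} [Ctx α] (v : Ctx.V α) : PTN (fun a : α => Ctx.var v a)
  | arr {α : Type} [Ctx α] (r : Ctx.A α) {f : α → ℕ} : PTN f → PTN (fun a : α => Ctx.arr r a (f a))
  | const {α : Type} [Ctx α] (k : ℕ) : PTN (fun _ : α => k)
  | add {α : Type} [Ctx α] {f g : α → ℕ} : PTN f → PTN g → PTN (fun a => f a + g a)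
  | sub {α : Type} [Ctx α] {f g : α → ℕ} : PTN f → PTN g → PTN (fun a => f a - g a)
  | sum {α : Type} [Ctx α] {n : α → ℕ} {g : α × ℕ → ℕ} : PTN n → PTN g →
      PTN (fun a => ∑ i ∈ Finset.range (n a), g (a, i))
  | iter {α : Type} [Ctx α] {n b x : α → ℕ} {g : α × ℕ → ℕ} : PTN n → PTN b → PTN x → PTN g →
      PTN (fun a => (fun y => min (b a) (g (a, y)))^[n a] (x a))

/-- The functions between contexts whose numbers are in `PTN` and whose arrays are arrays of the
argument. -/
@[fun_prop]
def PT {α β : Type} [Ctx α] [Ctx β] (f : α → β) : Prop :=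
  (∀ v : Ctx.V β, PTN fun a => Ctx.var v (f a)) ∧
    ∀ r : Ctx.A β, ∃ r' : Ctx.A α, ∀ a, Ctx.arr r (f a) = Ctx.arr r' a

/-- Weakening, which has to precede general substitution: to go under the bound number of a `sum` or
an `iter`, the substituted terms must be read in a context extended by one number, and that is a
renaming along the first projection. -/
theorem PTN.rename {α γ : Type} [Ctx α] [Ctx γ] {f : α → ℕ} (hf : PTN f) (h : γ → α)
    (hv : ∀ v : Ctx.V α, ∃ v' : Ctx.V γ, ∀ c, Ctx.var v (h c) = Ctx.var v' c)
    (ha : ∀ r : Ctx.A α, ∃ r' : Ctx.A γ, ∀ c, Ctx.arr r (h c) = Ctx.arr r' c) :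
    PTN (fun c => f (h c)) := by
  have lift : ∀ {α γ : Type} [Ctx α] [Ctx γ] (h : γ → α)
      (_ : ∀ v : Ctx.V α, ∃ v' : Ctx.V γ, ∀ c, Ctx.var v (h c) = Ctx.var v' c)
      (_ : ∀ r : Ctx.A α, ∃ r' : Ctx.A γ, ∀ c, Ctx.arr r (h c) = Ctx.arr r' c),
      (∀ v : Ctx.V (α × ℕ), ∃ v' : Ctx.V (γ × ℕ), ∀ c : γ × ℕ,
        Ctx.var v (h c.1, c.2) = Ctx.var v' c) ∧
      ∀ r : Ctx.A (α × ℕ), ∃ r' : Ctx.A (γ × ℕ), ∀ c : γ × ℕ,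
        Ctx.arr r (h c.1, c.2) = Ctx.arr r' c := by
    intro α γ _ _ h hv ha
    constructor
    · rintro (v | v)
      · obtain ⟨v', hv'⟩ := hv v
        exact ⟨Sum.inl v', fun c => hv' c.1⟩
      · exact ⟨Sum.inr v, fun c => rfl⟩
    · rintro (r | r)
      · obtain ⟨r', hr'⟩ := ha r
        exact ⟨Sum.inl r', fun c => hr' c.1⟩
      · exact r.elim
  induction hf generalizing γ with
  | var v =>
    obtain ⟨v', hv'⟩ := hv v
    simpa only [hv'] using PTN.var v'
  | arr r _ ih =>
    obtain ⟨r', hr'⟩ := ha r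
    simpa only [hr'] using PTN.arr r' (ih h hv ha)
  | const k => exact PTN.const k
  | add _ _ ih₁ ih₂ => exact PTN.add (ih₁ h hv ha) (ih₂ h hv ha)
  | sub _ _ ih₁ ih₂ => exact PTN.sub (ih₁ h hv ha) (ih₂ h hv ha)
  | sum _ _ ih₁ ih₂ =>
    exact PTN.sum (ih₁ h hv ha) (ih₂ (fun c => (h c.1, c.2)) (lift h hv ha).1 (lift h hv ha).2)
  | iter _ _ _ _ ih₁ ih₂ ih₃ ih₄ =>
    exact PTN.iter (ih₁ h hv ha) (ih₂ h hv ha) (ih₃ h hv ha)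
      (ih₄ (fun c => (h c.1, c.2)) (lift h hv ha).1 (lift h hv ha).2)

/-- Substitution. It works for array accesses because a `PT` map never creates arrays: each array of
its value is literally an array of its argument. -/
theorem PTN.comp {α γ : Type} [Ctx α] [Ctx γ] {f : α → ℕ} (hf : PTN f) {h : γ → α} (hh : PT h) :
    PTN (fun c => f (h c)) := by
  have lift : ∀ {α γ : Type} [Ctx α] [Ctx γ] {h : γ → α}, PT h →
      PT (fun c : γ × ℕ => (h c.1, c.2)) := by
    intro α γ _ _ h hh
    constructor
    · rintro (v | v)
      · exact (hh.1 v).rename (fun c : γ × ℕ => c.1) (fun v => ⟨Sum.inl v, fun _ => rfl⟩)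
          (fun r => ⟨Sum.inl r, fun _ => rfl⟩)
      · exact PTN.var (α := γ × ℕ) (Sum.inr v)
    · rintro (r | r)
      · obtain ⟨r', hr'⟩ := hh.2 r
        exact ⟨Sum.inl r', fun c => hr' c.1⟩
      · exact r.elim
  induction hf generalizing γ with
  | var v => exact hh.1 v
  | arr r _ ih =>
    obtain ⟨r', hr'⟩ := hh.2 r
    simpa only [hr'] using PTN.arr r' (ih hh)
  | const k => exact PTN.const k
  | add _ _ ih₁ ih₂ => exact PTN.add (ih₁ hh) (ih₂ hh)
  | sub _ _ ih₁ ih₂ => exact PTN.sub (ih₁ hh) (ih₂ hh)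
  | sum _ _ ih₁ ih₂ => exact PTN.sum (ih₁ hh) (ih₂ (lift hh))
  | iter _ _ _ _ ih₁ ih₂ ih₃ ih₄ => exact PTN.iter (ih₁ hh) (ih₂ hh) (ih₃ hh) (ih₄ (lift hh))

/-! ### Closure of `PT` under arithmetic, Boolean operations and bounded quantifiers -/

section Closure

variable {α β γ : Type} [Ctx α] [Ctx β] [Ctx γ]

theorem PT.of_ptn {f : α → ℕ} (hf : PTN f) : PT f := ⟨fun _ => hf, fun r => r.elim⟩

theorem PT.ptn {f : α → ℕ} (hf : PT f) : PTN f := hf.1 ()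

theorem PT.of_toNat {f : α → Bool} (hf : PT fun a => (f a).toNat) : PT f :=
  ⟨fun _ => hf.ptn, fun r => r.elim⟩

@[fun_prop] theorem PT.id : PT (fun a : α => a) := ⟨fun v => PTN.var v, fun r => ⟨r, fun _ => rfl⟩⟩

@[fun_prop] theorem PT.comp {f : β → γ} {g : α → β} (hf : PT f) (hg : PT g) :
    PT (fun a => f (g a)) := by
  refine ⟨fun v => (hf.1 v).comp hg, fun r => ?_⟩
  obtain ⟨r₁, h₁⟩ := hf.2 r
  obtain ⟨r₂, h₂⟩ := hg.2 r₁
  exact ⟨r₂, fun a => (h₁ _).trans (h₂ a)⟩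

@[fun_prop] theorem PT.mk {f : α → β} {g : α → γ} (hf : PT f) (hg : PT g) :
    PT (fun a => (f a, g a)) := by
  constructor
  · rintro (v | v)
    exacts [hf.1 v, hg.1 v]
  · rintro (r | r)
    exacts [hf.2 r, hg.2 r]

@[fun_prop] theorem PT.fst {f : α → β × γ} (hf : PT f) : PT (fun a => (f a).1) :=
  ⟨fun v => hf.1 (Sum.inl v), fun r => hf.2 (Sum.inl r)⟩

@[fun_prop] theorem PT.snd {f : α → β × γ} (hf : PT f) : PT (fun a => (f a).2) :=
  ⟨fun v => hf.1 (Sum.inr v), fun r => hf.2 (Sum.inr r)⟩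

@[fun_prop] theorem PT.const (b : ℕ) : PT (fun _ : α => b) := .of_ptn (.const b)

@[fun_prop] theorem PT.add {f g : α → ℕ} (hf : PT f) (hg : PT g) : PT (fun a => f a + g a) :=
  .of_ptn (hf.ptn.add hg.ptn)

@[fun_prop] theorem PT.sub {f g : α → ℕ} (hf : PT f) (hg : PT g) : PT (fun a => f a - g a) :=
  .of_ptn (hf.ptn.sub hg.ptn)

@[fun_prop] theorem PT.toNat {f : α → Bool} (hf : PT f) : PT (fun a => (f a).toNat) :=
  .of_ptn (hf.1 ())

@[fun_prop] theorem PT.length {f : α → List ℕ} (hf : PT f) : PT (fun a => (f a).length) :=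
  .of_ptn (hf.1 ())

@[fun_prop] theorem PT.cell {f : α → List ℕ} {g : α → ℕ} (hf : PT f) (hg : PT g) :
    PT (fun a => cell (f a) (g a)) :=
  .of_ptn ((PTN.arr (α := List ℕ × ℕ) (Sum.inl ()) (f := fun p => p.2)
    (PTN.var (α := List ℕ × ℕ) (Sum.inr ()))).comp (hf.mk hg))

/-- The sum of `f i` over `i < n`. -/
def sumLt (n : ℕ) (f : ℕ → ℕ) : ℕ := ∑ i ∈ Finset.range n, f i

@[fun_prop] theorem PT.sumLt {f : α → ℕ} {g : α → ℕ → ℕ} (hf : PT f)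
    (hg : PT (fun p : α × ℕ => g p.1 p.2)) : PT (fun a => sumLt (f a) (g a)) :=
  .of_ptn (hf.ptn.sum hg.ptn)

/-- The iteration of `min b ∘ f`, starting from `x`. -/
def iterLt (n b : ℕ) (f : ℕ → ℕ) (x : ℕ) : ℕ := (fun y => min b (f y))^[n] x

@[fun_prop] theorem PT.iterLt {n b x : α → ℕ} {g : α → ℕ → ℕ} (hn : PT n) (hb : PT b)
    (hg : PT (fun p : α × ℕ => g p.1 p.2)) (hx : PT x) :
    PT (fun a => iterLt (n a) (b a) (g a) (x a)) :=
  .of_ptn (hn.ptn.iter hb.ptn hx.ptn hg.ptn)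

@[fun_prop] theorem PT.mul {f g : α → ℕ} (hf : PT f) (hg : PT g) : PT (fun a => f a * g a) := by
  have : PT (fun a => SatHyp.sumLt (f a) fun _ => g a) := by fun_prop
  simpa [SatHyp.sumLt] using this

/-- Equality of numbers. -/
def eqb (x y : ℕ) : Bool := decide (x = y)

/-- Strict order of numbers. -/
def ltb (x y : ℕ) : Bool := decide (x < y)

@[simp] theorem eqb_iff {x y : ℕ} : eqb x y = true ↔ x = y := by simp [eqb]
@[simp] theorem ltb_iff {x y : ℕ} : ltb x y = true ↔ x < y := by simp [ltb]
@[simp] theorem eqb_false_iff {x y : ℕ} : eqb x y = false ↔ x ≠ y := by simp [eqb]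
@[simp] theorem ltb_false_iff {x y : ℕ} : ltb x y = false ↔ y ≤ x := by simp [ltb]

@[fun_prop] theorem PT.eqb {f g : α → ℕ} (hf : PT f) (hg : PT g) :
    PT (fun a => eqb (f a) (g a)) := by
  refine .of_toNat ?_
  have : ∀ x y : ℕ, (SatHyp.eqb x y).toNat = 1 - ((x - y) + (y - x)) := by
    intro x y
    rcases h : SatHyp.eqb x y <;> simp at h <;> simp <;> omega
  simp only [this]
  fun_prop

@[fun_prop] theorem PT.ltb {f g : α → ℕ} (hf : PT f) (hg : PT g) :
    PT (fun a => ltb (f a) (g a)) := by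
  refine .of_toNat ?_
  have : ∀ x y : ℕ, (SatHyp.ltb x y).toNat = 1 - (x + 1 - y) := by
    intro x y
    rcases h : SatHyp.ltb x y <;> simp at h <;> simp <;> omega
  simp only [this]
  fun_prop

@[fun_prop] theorem PT.not {f : α → Bool} (hf : PT f) : PT (fun a => !(f a)) := by
  refine .of_toNat ?_
  have : ∀ x : Bool, (!x).toNat = 1 - x.toNat := by decide
  simp only [this]
  fun_prop

@[fun_prop] theorem PT.and {f g : α → Bool} (hf : PT f) (hg : PT g) :
    PT (fun a => f a && g a) := by
  refine .of_toNat ?_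
  have : ∀ x y : Bool, (x && y).toNat = x.toNat * y.toNat := by decide
  simp only [this]
  fun_prop

@[fun_prop] theorem PT.or {f g : α → Bool} (hf : PT f) (hg : PT g) :
    PT (fun a => f a || g a) := by
  refine .of_toNat ?_
  have : ∀ x y : Bool, (x || y).toNat = 1 - (1 - x.toNat) * (1 - y.toNat) := by decide
  simp only [this]
  fun_prop

@[fun_prop] theorem PT.cond {c : α → Bool} {f g : α → ℕ} (hc : PT c) (hf : PT f) (hg : PT g) :
    PT (fun a => bif c a then f a else g a) := by
  have : ∀ (c : Bool) (x y : ℕ), (bif c then x else y) = c.toNat * x + (1 - c.toNat) * y := by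
    intro c x y; cases c <;> simp
  simp only [this]
  fun_prop

/-- Bounded universal quantification. -/
def allLt (n : ℕ) (p : ℕ → Bool) : Bool := eqb (sumLt n fun i => (!(p i)).toNat) 0

/-- Bounded existential quantification. -/
def exLt (n : ℕ) (p : ℕ → Bool) : Bool := ltb 0 (sumLt n fun i => (p i).toNat)

@[simp] theorem allLt_iff {n : ℕ} {p : ℕ → Bool} : allLt n p = true ↔ ∀ i < n, p i = true := by
  simp [allLt, sumLt, Finset.sum_eq_zero_iff]

@[simp] theorem exLt_iff {n : ℕ} {p : ℕ → Bool} : exLt n p = true ↔ ∃ i < n, p i = true := by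
  simp [exLt, sumLt, Nat.pos_iff_ne_zero, Finset.sum_eq_zero_iff]

@[fun_prop] theorem PT.allLt {n : α → ℕ} {p : α → ℕ → Bool} (hn : PT n)
    (hp : PT (fun q : α × ℕ => p q.1 q.2)) : PT (fun a => allLt (n a) (p a)) := by
  unfold SatHyp.allLt
  fun_prop

@[fun_prop] theorem PT.exLt {n : α → ℕ} {p : α → ℕ → Bool} (hn : PT n)
    (hp : PT (fun q : α × ℕ => p q.1 q.2)) : PT (fun a => exLt (n a) (p a)) := by
  unfold SatHyp.exLt
  fun_prop

/-- Division as counting: the quotient is the number of `q` with `(q + 1) * y ≤ x`, and all of these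
lie below `x`. This expresses `/` through bounded sums. -/
theorem card_range_filter_mul_le (x y : ℕ) (hy : 0 < y) :
    (sumLt x fun q => bif ltb x ((q + 1) * y) then 0 else 1) = x / y := by
  have h : ∀ q, (bif ltb x ((q + 1) * y) then 0 else 1) = if q < x / y then 1 else 0 := by
    intro q
    rcases h : ltb x ((q + 1) * y)
    · rw [ltb_false_iff] at h
      rw [if_pos]
      · rfl
      · exact (Nat.le_div_iff_mul_le hy).2 h
    · rw [ltb_iff] at h
      rw [if_neg]
      · rfl
      · intro h'
        have : (q + 1) * y ≤ x := (Nat.le_div_iff_mul_le hy).1 h'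
        omega
  simp only [sumLt, h, Finset.sum_boole]
  have : (Finset.range x).filter (fun q => q < x / y) = Finset.range (x / y) := by
    ext q
    have := Nat.div_le_self x y
    simp
    omega
  simp [this]

@[fun_prop] theorem PT.div {f g : α → ℕ} (hf : PT f) (hg : PT g) : PT (fun a => f a / g a) := by
  have : ∀ x y : ℕ, x / y = bif SatHyp.ltb 0 y then
      (SatHyp.sumLt x fun q => bif SatHyp.ltb x ((q + 1) * y) then 0 else 1) else 0 := by
    intro x y
    rcases h : SatHyp.ltb 0 y
    · rw [ltb_false_iff] at h
      obtain rfl : y = 0 := by omega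
      simp
    · rw [ltb_iff] at h
      exact (card_range_filter_mul_le x y h).symm
  simp only [this]
  fun_prop

@[fun_prop] theorem PT.mod {f g : α → ℕ} (hf : PT f) (hg : PT g) : PT (fun a => f a % g a) := by
  have : ∀ x y : ℕ, x % y = x - y * (x / y) := by
    intro x y
    have := Nat.div_add_mod x y
    omega
  simp only [this]
  fun_prop

@[fun_prop] theorem PT.min {f g : α → ℕ} (hf : PT f) (hg : PT g) :
    PT (fun a => min (f a) (g a)) := by
  have : ∀ x y : ℕ, Min.min x y = x - (x - y) := by
    intro x y
    omega
  simp only [this]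
  fun_prop

@[fun_prop] theorem PT.pow {f : α → ℕ} (hf : PT f) (k : ℕ) : PT (fun a => f a ^ k) := by
  induction k with
  | zero => simpa using PT.const 1
  | succ k ih => simp only [pow_succ]; fun_prop

end Closure

/-! ### Polynomial bounds -/

section PolyBound

variable {α β : Type} [Ctx α] [Ctx β]

/-- `f` is bounded by a power of the magnitude. -/
def PolyBounded (f : α → ℕ) : Prop := ∃ K : ℕ, ∀ a, f a ≤ (Ctx.mag a + 2) ^ K

theorem PolyBounded.mono {f g : α → ℕ} (hg : PolyBounded g) (h : ∀ a, f a ≤ g a) :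
    PolyBounded f :=
  hg.imp fun _ hK a => (h a).trans (hK a)

theorem PolyBounded.mag : PolyBounded (fun a : α => Ctx.mag a) := ⟨1, fun a => by simp⟩

theorem PolyBounded.const (k : ℕ) : PolyBounded (fun _ : α => k) :=
  ⟨k, fun a => (Nat.lt_two_pow_self (n := k)).le.trans (Nat.pow_le_pow_left (by omega) k)⟩

theorem PolyBounded.mul {f g : α → ℕ} (hf : PolyBounded f) (hg : PolyBounded g) :
    PolyBounded (fun a => f a * g a) := by
  obtain ⟨K, hK⟩ := hf
  obtain ⟨L, hL⟩ := hg
  exact ⟨K + L, fun a => by rw [pow_add]; exact Nat.mul_le_mul (hK a) (hL a)⟩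

theorem PolyBounded.add {f g : α → ℕ} (hf : PolyBounded f) (hg : PolyBounded g) :
    PolyBounded (fun a => f a + g a) := by
  obtain ⟨K, hK⟩ := hf
  obtain ⟨L, hL⟩ := hg
  refine ⟨K + L + 1, fun a => ?_⟩
  have h1 : (Ctx.mag a + 2) ^ K ≤ (Ctx.mag a + 2) ^ (K + L) :=
    Nat.pow_le_pow_right (by omega) (by omega)
  have h2 : (Ctx.mag a + 2) ^ L ≤ (Ctx.mag a + 2) ^ (K + L) :=
    Nat.pow_le_pow_right (by omega) (by omega)
  have h3 : (Ctx.mag a + 2) ^ (K + L) * 2 ≤ (Ctx.mag a + 2) ^ (K + L + 1) := by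
    rw [pow_succ]; exact Nat.mul_le_mul_left _ (by omega)
  exact (Nat.add_le_add ((hK a).trans h1) ((hL a).trans h2)).trans (by omega)

theorem PolyBounded.pow {f : α → ℕ} (hf : PolyBounded f) (k : ℕ) :
    PolyBounded (fun a => f a ^ k) := by
  obtain ⟨K, hK⟩ := hf
  exact ⟨K * k, fun a => by rw [pow_mul]; exact Nat.pow_le_pow_left (hK a) k⟩

/-- Polynomial bounds are stable under substitution of arguments of polynomial magnitude. -/
theorem PolyBounded.subst {f : β → ℕ} (hf : PolyBounded f) {X : α → ℕ} (hX : PolyBounded X) :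
    ∃ g : α → ℕ, PolyBounded g ∧ ∀ a b, Ctx.mag b ≤ X a → f b ≤ g a := by
  obtain ⟨K, hK⟩ := hf
  exact ⟨fun a => (X a + 2) ^ K, (hX.add (.const 2)).pow K, fun a b h =>
    (hK b).trans (Nat.pow_le_pow_left (by omega) K)⟩

/-- The cap in `iter` is decisive: without it, repeated doubling would give exponential values. With
it, every iterate is at most the cap or is the starting value. -/
theorem PTN.polyBounded {f : α → ℕ} (hf : PTN f) : PolyBounded f := by
  induction hf with
  | var v => exact PolyBounded.mag.mono (Ctx.var_le v)
  | arr r _ _ => exact PolyBounded.mag.mono fun a => Ctx.arr_le r a _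
  | const k => exact .const k
  | add _ _ ih₁ ih₂ => exact ih₁.add ih₂
  | sub _ _ ih₁ ih₂ => exact ih₁.mono fun a => Nat.sub_le _ _
  | @sum α _ n g _ _ ih₁ ih₂ =>
    obtain ⟨G, hG, hG'⟩ := ih₂.subst (PolyBounded.mag.add ih₁)
    refine (ih₁.mul hG).mono fun a => ?_
    refine (Finset.sum_le_card_nsmul _ _ (G a) fun i hi => hG' a (a, i) ?_).trans (by simp)
    have := Finset.mem_range.1 hi
    exact Nat.add_le_add_left (show i ≤ n a by omega) _
  | @iter α _ n b x g _ _ _ _ _ ihb ihx _ =>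
    refine (ihb.add ihx).mono fun a => ?_
    cases hn : n a with
    | zero => simp
    | succ k =>
      rw [Function.iterate_succ_apply']
      exact (min_le_left _ _).trans (by omega)

theorem PT.polyBounded {f : α → ℕ} (hf : PT f) : PolyBounded f := hf.ptn.polyBounded

end PolyBound

/-! ### Compilation -/

theorem size_le_self (n : ℕ) : n.size ≤ n := Nat.size_le.2 Nat.lt_two_pow_self

/-- A loop that counts down. -/
theorem Run.countdown {p : Prog} {c N B : ℕ} (I : ℕ → State → Prop)
    (hbody : ∀ i < N, ∀ σ, I i σ → σ.reg c = N - i →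
      ∃ t σ', Run p σ t σ' ∧ I (i + 1) σ' ∧ σ'.reg c = N - (i + 1) ∧ t ≤ B)
    {σ : State} (h0 : I 0 σ) (hc : σ.reg c = N) :
    ∃ t σ', Run (.loop c p) σ t σ' ∧ I N σ' ∧ t ≤ (N + 1) * (B + N + 1) := by
  have key : ∀ k i, i + k = N → ∀ σ, I i σ → σ.reg c = N - i →
      ∃ t σ', Run (.loop c p) σ t σ' ∧ I N σ' ∧ t ≤ (k + 1) * (B + N + 1) := by
    intro k
    induction k with
    | zero =>
      intro i hi σ hI hσ
      obtain rfl : i = N := by omega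
      refine ⟨_, σ, .loop_done (by omega), hI, ?_⟩
      rw [hσ]
      simp
    | succ k ih =>
      intro i hi σ hI hσ
      obtain ⟨t, σ', hr, hI', hσ', ht⟩ := hbody i (by omega) σ hI hσ
      obtain ⟨t', σ'', hr', hI'', ht'⟩ := ih (i + 1) (by omega) σ' hI' hσ'
      refine ⟨_, σ'', .loop_step (by omega) hr hr', hI'', ?_⟩
      -- A round costs at most `B` for the body and `N + 1` for the test of the counter; the final
      -- test accounts for the extra factor unit.
      have := size_le_self (σ.reg c)
      have h : (k + 1 + 1) * (B + N + 1) = (k + 1) * (B + N + 1) + (B + N + 1) := by ring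
      rw [h]
      omega
  obtain ⟨t, σ', h⟩ := key N 0 (by omega) σ h0 (by simpa using hc)
  exact ⟨t, σ', h⟩

section Compile

variable {α : Type} [Ctx α]

/-- The registers `lv` and the arrays `la` hold the context `a`. -/
def Holds (lv : Ctx.V α → ℕ) (la : Ctx.A α → ℕ) (a : α) (σ : State) : Prop :=
  (∀ v, σ.reg (lv v) = Ctx.var v a) ∧ ∀ r i, σ.arr (la r) i = Ctx.arr r a i

theorem Holds.congr {lv : Ctx.V α → ℕ} {la : Ctx.A α → ℕ} {a : α} {σ σ' : State} {m : ℕ}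
    (h : Holds lv la a σ) (hm : ∀ v, lv v < m) (hr : ∀ r < m, σ'.reg r = σ.reg r)
    (ha : σ'.arr = σ.arr) : Holds lv la a σ' :=
  ⟨fun v => (hr _ (hm v)).trans (h.1 v), fun r i => by rw [ha]; exact h.2 r i⟩

/-- The location of the variables of an extended context. -/
def extLoc (lv : Ctx.V α → ℕ) (x : ℕ) : Ctx.V (α × ℕ) → ℕ := Sum.elim lv fun _ => x

/-- The location of the arrays of an extended context. -/
def extArr (la : Ctx.A α → ℕ) : Ctx.A (α × ℕ) → ℕ := Sum.elim la Empty.elim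

theorem extLoc_lt {lv : Ctx.V α → ℕ} {x m : ℕ} (h : ∀ v, lv v < m) (hx : x < m) (v) :
    extLoc lv x v < m := by
  rcases v with v | v
  exacts [h v, hx]

theorem Holds.ext {lv : Ctx.V α → ℕ} {la : Ctx.A α → ℕ} {a : α} {σ : State} {x i : ℕ}
    (h : Holds lv la a σ) (hx : σ.reg x = i) : Holds (extLoc lv x) (extArr la) (a, i) σ := by
  constructor
  · rintro (v | v)
    exacts [h.1 v, hx]
  · rintro (r | r) j
    exacts [h.2 r j, r.elim]

/-- `f` is computed by a program in polynomial time, wherever its data and result are placed. -/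
def Compiles (f : α → ℕ) : Prop :=
  ∀ (lv : Ctx.V α → ℕ) (la : Ctx.A α → ℕ) (m : ℕ), (∀ v, lv v < m) →
    ∃ (P : Prog) (T : α → ℕ), PolyBounded T ∧ ∀ a σ, Holds lv la a σ →
      ∃ t σ', Run P σ t σ' ∧ σ'.reg m = f a ∧ (∀ r < m, σ'.reg r = σ.reg r) ∧
        σ'.arr = σ.arr ∧ t ≤ T a

theorem State.reg_setReg_of_ne {σ : State} {r s x : ℕ} (h : s ≠ r) :
    (σ.setReg r x).reg s = σ.reg s := by simp [State.setReg, h]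

@[simp] theorem State.reg_setReg_self {σ : State} {r x : ℕ} :
    (σ.setReg r x).reg r = x := by simp [State.setReg]

@[simp] theorem State.arr_setReg {σ : State} {r x : ℕ} : (σ.setReg r x).arr = σ.arr := rfl

@[simp] theorem State.reg_setArr {σ : State} {r i x : ℕ} : (σ.setArr r i x).reg = σ.reg := rfl

theorem State.reg_setReg {σ : State} {r s x : ℕ} :
    (σ.setReg r x).reg s = if s = r then x else σ.reg s := by
  simp [State.setReg, Function.update_apply]

end Compile
section Compile

variable {α : Type} [Ctx α]

theorem Compiles.var (v : Ctx.V α) : Compiles (fun a : α => Ctx.var v a) := by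
  intro lv la m hm
  -- The machine has no copy instruction; a register is copied by adding it to a zero.
  refine ⟨.seq (.const m 0) (.add m m (lv v)), fun a => 2 + Ctx.mag a,
    (PolyBounded.const 2).add .mag, fun a σ hσ => ?_⟩
  have hv := hm v
  refine ⟨_, _, .seq (.const _ _ _) (.add _ _ _ _), ?_, fun r hr => ?_, rfl, ?_⟩
  · simp (disch := omega) [State.reg_setReg_of_ne, hσ.1 v]
  · simp (disch := omega) [State.reg_setReg_of_ne]
  · have h1 := size_le_self (Ctx.var v a)
    have h2 := Ctx.var_le v a
    simp (disch := omega) [State.reg_setReg_of_ne, hσ.1 v]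
    omega

theorem Compiles.const (k : ℕ) : Compiles (fun _ : α => k) := by
  intro lv la m hm
  refine ⟨.const m k, fun a => 1 + k, PolyBounded.const _, fun a σ hσ => ?_⟩
  refine ⟨_, _, .const _ _ _, by simp, fun r hr => ?_, rfl, ?_⟩
  · simp (disch := omega) [State.reg_setReg_of_ne]
  · have := size_le_self k
    dsimp only
    omega

theorem Compiles.arr (r : Ctx.A α) {f : α → ℕ} (hb : PolyBounded f) (hf : Compiles f) :
    Compiles (fun a : α => Ctx.arr r a (f a)) := by
  intro lv la m hm
  obtain ⟨P, T, hT, hP⟩ := hf lv la m hm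
  refine ⟨.seq P (.load m (la r) m), fun a => T a + (1 + f a + Ctx.mag a),
    hT.add (((PolyBounded.const 1).add hb).add .mag), fun a σ hσ => ?_⟩
  obtain ⟨t, σ', hr, hm', hlt, harr, ht⟩ := hP a σ hσ
  have hv := (hσ.congr hm hlt harr).2 r (f a)
  refine ⟨_, _, .seq hr (.load _ _ _ _), ?_, fun s hs => ?_, harr, ?_⟩
  · simp [hm', hv]
  · simp (disch := omega) [State.reg_setReg_of_ne, hlt s hs]
  · have h1 := size_le_self (f a)
    have h2 := (size_le_self (Ctx.arr r a (f a))).trans (Ctx.arr_le r a (f a))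
    simp only [hm', hv]
    omega

/-- The registers are used as a stack: the first operand stays in `m` while the second is computed
with base `m + 1`, which leaves everything below untouched. -/
theorem Compiles.binary {f g h : α → ℕ} (hbf : PolyBounded f) (hbg : PolyBounded g)
    (hf : Compiles f) (hg : Compiles g) (op : ℕ → ℕ → ℕ → Prog)
    (hop : ∀ m a σ, σ.reg m = f a → σ.reg (m + 1) = g a → Run (op m m (m + 1)) σ
      (1 + (f a).size + (g a).size) (σ.setReg m (h a))) :
    Compiles h := by
  intro lv la m hm
  obtain ⟨P, T, hT, hP⟩ := hf lv la m hm
  have hm' : ∀ v, lv v < m + 1 := fun v => (hm v).trans (Nat.lt_succ_self m)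
  obtain ⟨Q, U, hU, hQ⟩ := hg lv la (m + 1) hm'
  refine ⟨.seq P (.seq Q (op m m (m + 1))), fun a => T a + (U a + (1 + f a + g a)),
    hT.add (hU.add (((PolyBounded.const 1).add hbf).add hbg)), fun a σ hσ => ?_⟩
  obtain ⟨t, σ₁, hr₁, hv₁, hlt₁, harr₁, ht₁⟩ := hP a σ hσ
  obtain ⟨u, σ₂, hr₂, hv₂, hlt₂, harr₂, ht₂⟩ := hQ a σ₁ (hσ.congr hm hlt₁ harr₁)
  refine ⟨_, _, .seq hr₁ (.seq hr₂ (hop m a σ₂ ?_ hv₂)), by simp, fun s hs => ?_, ?_, ?_⟩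
  · rw [hlt₂ m (by omega), hv₁]
  · rw [State.reg_setReg_of_ne (by omega), hlt₂ s (by omega), hlt₁ s hs]
  · rw [State.arr_setReg, harr₂, harr₁]
  · have h1 := size_le_self (f a)
    have h2 := size_le_self (g a)
    dsimp only
    omega

theorem Compiles.add {f g : α → ℕ} (hbf : PolyBounded f) (hbg : PolyBounded g)
    (hf : Compiles f) (hg : Compiles g) : Compiles (fun a => f a + g a) :=
  hf.binary hbf hbg hg .add fun m a σ h₁ h₂ => by
    rw [← h₁, ← h₂]; exact .add _ _ _ _

theorem Compiles.sub {f g : α → ℕ} (hbf : PolyBounded f) (hbg : PolyBounded g)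
    (hf : Compiles f) (hg : Compiles g) : Compiles (fun a => f a - g a) :=
  hf.binary hbf hbg hg .sub fun m a σ h₁ h₂ => by
    rw [← h₁, ← h₂]; exact .sub _ _ _ _

theorem Compiles.sum {n : α → ℕ} {g : α × ℕ → ℕ} (hbn : PolyBounded n) (hbg : PolyBounded g)
    (hn : Compiles n) (hg : Compiles g) :
    Compiles (fun a => ∑ i ∈ Finset.range (n a), g (a, i)) := by
  intro lv la m hm
  obtain ⟨P, T, hT, hP⟩ := hn lv la m hm
  have hm4 : ∀ v, extLoc lv (m + 2) v < m + 4 :=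
    extLoc_lt (fun v => (hm v).trans (by omega)) (by omega)
  obtain ⟨Q, U, hU, hQ⟩ := hg (extLoc lv (m + 2)) (extArr la) (m + 4) hm4
  obtain ⟨G, hG, hG'⟩ := hbg.subst (PolyBounded.mag.add hbn)
  obtain ⟨W, hW, hW'⟩ := hU.subst (PolyBounded.mag.add hbn)
  let B : α → ℕ := fun a => W a + (10 + 3 * n a + n a * G a + G a)
  have hB : PolyBounded B := hW.add ((((PolyBounded.const 10).add ((PolyBounded.const 3).mul hbn)).add
    (hbn.mul hG)).add hG)
  -- Layout: `m` counts down, `m + 1` accumulates the sum, `m + 2` holds the index, `m + 3` holds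
  -- the constant `1`, and the summand arrives in `m + 4`. At the end `m + 4` is cleared in order to
  -- copy the accumulator to `m`.
  refine ⟨.seq P (.seq (.const (m + 1) 0) (.seq (.const (m + 2) 0) (.seq (.const (m + 3) 1)
    (.seq (.loop m (.seq Q (.seq (.add (m + 1) (m + 1) (m + 4)) (.seq
      (.add (m + 2) (m + 2) (m + 3)) (.sub m m (m + 3)))))) (.seq (.const (m + 4) 0)
      (.add m (m + 1) (m + 4))))))), fun a => T a + ((n a + 1) * (B a + n a + 1) + (20 + n a * G a)),
    hT.add (((hbn.add (.const 1)).mul ((hB.add hbn).add (.const 1))).add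
      ((PolyBounded.const 20).add (hbn.mul hG))), fun a σ hσ => ?_⟩
  have hle : ∀ i ≤ n a, ∑ j ∈ Finset.range i, g (a, j) ≤ n a * G a := by
    intro i hi
    refine (Finset.sum_le_card_nsmul _ _ (G a) fun j hj => hG' a (a, j) ?_).trans ?_
    · have := Finset.mem_range.1 hj
      exact Nat.add_le_add_left (show j ≤ n a by omega) _
    · simpa using Nat.mul_le_mul_right _ hi
  obtain ⟨t, σ₁, hr₁, hv₁, hlt₁, harr₁, ht₁⟩ := hP a σ hσ
  have hσ₁ := hσ.congr hm hlt₁ harr₁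
  set σ₂ := ((σ₁.setReg (m + 1) 0).setReg (m + 2) 0).setReg (m + 3) 1 with hσ₂
  obtain ⟨t', σ₃, hr₃, ⟨h31, h32, h33, h34, h35⟩, ht'⟩ := Run.countdown (c := m) (N := n a) (B := B a)
    (p := .seq Q (.seq (.add (m + 1) (m + 1) (m + 4)) (.seq
      (.add (m + 2) (m + 2) (m + 3)) (.sub m m (m + 3)))))
    (σ := σ₂)
    (fun i σ' => σ'.reg (m + 1) = ∑ j ∈ Finset.range i, g (a, j) ∧ σ'.reg (m + 2) = i ∧
      σ'.reg (m + 3) = 1 ∧ (∀ r < m, σ'.reg r = σ₁.reg r) ∧ σ'.arr = σ₁.arr) (by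
      rintro i hi σ' ⟨h1, h2, h3, h4, h5⟩ hc
      obtain ⟨u, σ₄, hr₄, hv₄, hlt₄, harr₄, ht₄⟩ := hQ (a, i) σ' ((hσ₁.congr hm h4 h5).ext h2)
      have e1 := hlt₄ (m + 1) (by omega)
      have e2 := hlt₄ (m + 2) (by omega)
      have e3 := hlt₄ (m + 3) (by omega)
      have e0 := hlt₄ m (by omega)
      refine ⟨_, _, .seq hr₄ (.seq (.add _ _ _ _) (.seq (.add _ _ _ _) (.sub _ _ _ _))),
        ⟨?_, ?_, ?_, fun r hr => ?_, ?_⟩, ?_, ?_⟩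
      · simp (disch := omega) [State.reg_setReg_of_ne, e1, h1, hv₄, Finset.sum_range_succ]
      · simp (disch := omega) [State.reg_setReg_of_ne, e2, h2, e3, h3]
      · simp (disch := omega) [State.reg_setReg_of_ne, e3, h3]
      · simp (disch := omega) only [State.reg_setReg_of_ne]
        rw [hlt₄ r (by omega), h4 r hr]
      · simp [harr₄, h5]
      · simp (disch := omega) [State.reg_setReg_of_ne, e3, h3, e0, hc]
        omega
      · have b1 := hle i hi.le
        have hmag : Ctx.mag (a, i) ≤ Ctx.mag a + n a :=
          Nat.add_le_add_left (show i ≤ n a by omega) _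
        have b2 := hG' a (a, i) hmag
        have b3 := hW' a (a, i) hmag
        have c1 := size_le_self (∑ j ∈ Finset.range i, g (a, j))
        have c2 := size_le_self (g (a, i))
        have c3 := size_le_self i
        have c4 := size_le_self (n a - i)
        simp (disch := omega) only [State.reg_setReg_of_ne, e1, h1, hv₄, e2, h2, e3, h3, e0, hc,
          Nat.size_one]
        simp only [B]
        omega)
    ⟨by simp (disch := omega) [hσ₂, State.reg_setReg_of_ne],
      by simp (disch := omega) [hσ₂, State.reg_setReg_of_ne],
      by simp [hσ₂], fun r hr => by simp (disch := omega) [hσ₂, State.reg_setReg_of_ne],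
      by simp [hσ₂]⟩
    (by simp (disch := omega) [hσ₂, State.reg_setReg_of_ne, hv₁])
  refine ⟨_, _, .seq hr₁ (.seq (.const _ _ _) (.seq (.const _ _ _) (.seq (.const _ _ _)
    (.seq hr₃ (.seq (.const _ _ _) (.add _ _ _ _)))))), ?_, fun r hr => ?_, ?_, ?_⟩
  · simp (disch := omega) [State.reg_setReg_of_ne, h31]
  · simp (disch := omega) only [State.reg_setReg_of_ne]
    rw [h34 r hr, hlt₁ r hr]
  · simp [h35, harr₁]
  · have b1 := hle (n a) le_rfl
    have c1 := size_le_self (∑ j ∈ Finset.range (n a), g (a, j))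
    simp (disch := omega) only [State.reg_setReg_of_ne, State.reg_setReg_self, h31, Nat.size_zero,
      Nat.size_one]
    omega

theorem Compiles.iter {n b x : α → ℕ} {g : α × ℕ → ℕ} (hbn : PolyBounded n) (hbb : PolyBounded b)
    (hbx : PolyBounded x) (hbg : PolyBounded g)
    (hn : Compiles n) (hb : Compiles b) (hx : Compiles x) (hg : Compiles g) :
    Compiles (fun a => (fun y => min (b a) (g (a, y)))^[n a] (x a)) := by
  intro lv la m hm
  obtain ⟨P, T, hT, hP⟩ := hn lv la m hm
  obtain ⟨P', T', hT', hP'⟩ := hx lv la (m + 1) fun v => (hm v).trans (by omega)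
  obtain ⟨P'', T'', hT'', hP''⟩ := hb lv la (m + 2) fun v => (hm v).trans (by omega)
  have hm4 : ∀ v, extLoc lv (m + 1) v < m + 4 :=
    extLoc_lt (fun v => (hm v).trans (by omega)) (by omega)
  obtain ⟨Q, U, hU, hQ⟩ := hg (extLoc lv (m + 1)) (extArr la) (m + 4) hm4
  obtain ⟨G, hG, hG'⟩ := hbg.subst (PolyBounded.mag.add (hbb.add hbx))
  obtain ⟨W, hW, hW'⟩ := hU.subst (PolyBounded.mag.add (hbb.add hbx))
  let B : α → ℕ := fun a => W a + (10 + n a + 3 * b a + G a)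
  have hB : PolyBounded B := hW.add ((((PolyBounded.const 10).add hbn).add
    ((PolyBounded.const 3).mul hbb)).add hG)
  -- Layout: `m` counts down, `m + 1` holds the current iterate, `m + 2` the cap, `m + 3` the
  -- constant `1`, and the new value `z` arrives in `m + 4`. The two subtractions compute `min b z`
  -- as `b - (b - z)`.
  refine ⟨.seq P (.seq P' (.seq P'' (.seq (.const (m + 3) 1)
    (.seq (.loop m (.seq Q (.seq (.sub (m + 5) (m + 2) (m + 4)) (.seq
      (.sub (m + 1) (m + 2) (m + 5)) (.sub m m (m + 3)))))) (.seq (.const (m + 4) 0)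
      (.add m (m + 1) (m + 4))))))),
    fun a => T a + (T' a + (T'' a + ((n a + 1) * (B a + n a + 1) + (20 + b a + x a)))),
    hT.add (hT'.add (hT''.add (((hbn.add (.const 1)).mul ((hB.add hbn).add (.const 1))).add
      (((PolyBounded.const 20).add hbb).add hbx)))), fun a σ hσ => ?_⟩
  have hle : ∀ i, (fun y => min (b a) (g (a, y)))^[i] (x a) ≤ b a + x a := by
    intro i
    cases i with
    | zero => simp
    | succ i =>
      rw [Function.iterate_succ_apply']
      exact (min_le_left _ _).trans (by omega)
  obtain ⟨t, σ₁, hr₁, hv₁, hlt₁, harr₁, ht₁⟩ := hP a σ hσ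
  have hσ₁ := hσ.congr hm hlt₁ harr₁
  obtain ⟨u₁, σ₅, hr₅, hv₅, hlt₅, harr₅, ht₅⟩ := hP' a σ₁ hσ₁
  have hσ₅ := hσ₁.congr hm (fun r hr => hlt₅ r (by omega)) harr₅
  obtain ⟨u₂, σ₆, hr₆, hv₆, hlt₆, harr₆, ht₆⟩ := hP'' a σ₅ hσ₅
  have hσ₆ := hσ₅.congr hm (fun r hr => hlt₆ r (by omega)) harr₆
  have k0 : σ₆.reg m = n a := by rw [hlt₆ m (by omega), hlt₅ m (by omega), hv₁]
  have k1 : σ₆.reg (m + 1) = x a := by rw [hlt₆ (m + 1) (by omega), hv₅]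
  set σ₂ := σ₆.setReg (m + 3) 1 with hσ₂
  obtain ⟨t', σ₃, hr₃, ⟨h31, h32, h33, h34, h35⟩, ht'⟩ := Run.countdown (c := m) (N := n a) (B := B a)
    (p := .seq Q (.seq (.sub (m + 5) (m + 2) (m + 4)) (.seq
      (.sub (m + 1) (m + 2) (m + 5)) (.sub m m (m + 3)))))
    (σ := σ₂)
    (fun i σ' => σ'.reg (m + 1) = (fun y => min (b a) (g (a, y)))^[i] (x a) ∧
      σ'.reg (m + 2) = b a ∧
      σ'.reg (m + 3) = 1 ∧ (∀ r < m, σ'.reg r = σ₆.reg r) ∧ σ'.arr = σ₆.arr) (by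
      rintro i hi σ' ⟨h1, h2, h3, h4, h5⟩ hc
      obtain ⟨u, σ₄, hr₄, hv₄, hlt₄, harr₄, ht₄⟩ := hQ (a, _) σ' ((hσ₆.congr hm h4 h5).ext h1)
      have e1 := hlt₄ (m + 1) (by omega)
      have e2 := hlt₄ (m + 2) (by omega)
      have e3 := hlt₄ (m + 3) (by omega)
      have e0 := hlt₄ m (by omega)
      refine ⟨_, _, .seq hr₄ (.seq (.sub _ _ _ _) (.seq (.sub _ _ _ _) (.sub _ _ _ _))),
        ⟨?_, ?_, ?_, fun r hr => ?_, ?_⟩, ?_, ?_⟩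
      · simp (disch := omega) only [State.reg_setReg_of_ne, State.reg_setReg_self, e2, h2, hv₄,
          Function.iterate_succ_apply']
        omega
      · simp (disch := omega) [State.reg_setReg_of_ne, e2, h2]
      · simp (disch := omega) [State.reg_setReg_of_ne, e3, h3]
      · simp (disch := omega) only [State.reg_setReg_of_ne]
        rw [hlt₄ r (by omega), h4 r hr]
      · simp [harr₄, h5]
      · simp (disch := omega) [State.reg_setReg_of_ne, e3, h3, e0, hc]
        omega
      · have b1 := hle i
        have hmag : Ctx.mag (a, (fun y => min (b a) (g (a, y)))^[i] (x a)) ≤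
          Ctx.mag a + (b a + x a) := Nat.add_le_add_left b1 _
        have b2 := hG' a _ hmag
        have b3 := hW' a _ hmag
        have c2 := size_le_self (g (a, (fun y => min (b a) (g (a, y)))^[i] (x a)))
        have c3 := size_le_self (b a)
        have c4 := size_le_self (n a - i)
        have c5 := size_le_self (b a - g (a, (fun y => min (b a) (g (a, y)))^[i] (x a)))
        simp (disch := omega) only [State.reg_setReg_of_ne, State.reg_setReg_self, hv₄, e2,
          h2, e3, h3, e0, hc, Nat.size_one]
        simp only [B]
        omega)
    ⟨by simp (disch := omega) [hσ₂, State.reg_setReg_of_ne, k1],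
      by simp (disch := omega) [hσ₂, State.reg_setReg_of_ne, hv₆],
      by simp [hσ₂], fun r hr => by simp (disch := omega) [hσ₂, State.reg_setReg_of_ne],
      by simp [hσ₂]⟩
    (by simp (disch := omega) [hσ₂, State.reg_setReg_of_ne, k0])
  refine ⟨_, _, .seq hr₁ (.seq hr₅ (.seq hr₆ (.seq (.const _ _ _)
    (.seq hr₃ (.seq (.const _ _ _) (.add _ _ _ _)))))), ?_, fun r hr => ?_, ?_, ?_⟩
  · simp (disch := omega) [State.reg_setReg_of_ne, h31]
  · simp (disch := omega) only [State.reg_setReg_of_ne]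
    rw [h34 r hr, hlt₆ r (by omega), hlt₅ r (by omega), hlt₁ r hr]
  · simp [h35, harr₁, harr₅, harr₆]
  · have b1 := hle (n a)
    have c1 := size_le_self ((fun y => min (b a) (g (a, y)))^[n a] (x a))
    simp (disch := omega) only [State.reg_setReg_of_ne, State.reg_setReg_self, h31, Nat.size_zero,
      Nat.size_one]
    omega

theorem PTN.compiles {f : α → ℕ} (hf : PTN f) : Compiles f := by
  induction hf with
  | var v => exact .var v
  | arr r h ih => exact .arr r h.polyBounded ih
  | const k => exact .const k
  | add h₁ h₂ ih₁ ih₂ => exact .add h₁.polyBounded h₂.polyBounded ih₁ ih₂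
  | sub h₁ h₂ ih₁ ih₂ => exact .sub h₁.polyBounded h₂.polyBounded ih₁ ih₂
  | sum h₁ h₂ ih₁ ih₂ => exact .sum h₁.polyBounded h₂.polyBounded ih₁ ih₂
  | iter h₁ h₂ h₃ h₄ ih₁ ih₂ ih₃ ih₄ =>
    exact .iter h₁.polyBounded h₂.polyBounded h₃.polyBounded h₄.polyBounded ih₁ ih₂ ih₃ ih₄

end Compile
/-! ### Lists computed in polynomial time -/

/-- The lists that are emitted by nested bounded loops. -/
inductive PTL : {α : Type} → [Ctx α] → (α → List ℕ) → Prop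
  | nil {α : Type} [Ctx α] : PTL (fun _ : α => [])
  | cons {α : Type} [Ctx α] {f : α → ℕ} {l : α → List ℕ} : PT f → PTL l → PTL (fun a => f a :: l a)
  | append {α : Type} [Ctx α] {k l : α → List ℕ} : PTL k → PTL l → PTL (fun a => k a ++ l a)
  | flat {α : Type} [Ctx α] {n : α → ℕ} {g : α × ℕ → List ℕ} : PT n → PTL g →
      PTL (fun a => (List.range (n a)).flatMap fun i => g (a, i))

theorem PolyBounded.fst {α β : Type} [Ctx α] [Ctx β] {f : α → ℕ} (hf : PolyBounded f) :
    PolyBounded (fun p : α × β => f p.1) := by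
  obtain ⟨K, hK⟩ := hf
  exact ⟨K, fun p => (hK p.1).trans (Nat.pow_le_pow_left
    (Nat.add_le_add_right (Nat.le_add_right _ _) 2) K)⟩

theorem PolyBounded.snd {α β : Type} [Ctx α] [Ctx β] {f : β → ℕ} (hf : PolyBounded f) :
    PolyBounded (fun p : α × β => f p.2) := by
  obtain ⟨K, hK⟩ := hf
  exact ⟨K, fun p => (hK p.2).trans (Nat.pow_le_pow_left
    (Nat.add_le_add_right (Nat.le_add_left _ _) 2) K)⟩

theorem mag_list_def (l : List ℕ) : Ctx.mag l = l.length + l.sum := rfl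

theorem mag_list_append (k l : List ℕ) : Ctx.mag (k ++ l) = Ctx.mag k + Ctx.mag l := by
  simp only [mag_list_def, List.length_append, List.sum_append]
  omega

theorem mag_list_cons (x : ℕ) (l : List ℕ) : Ctx.mag (x :: l) = (x + 1) + Ctx.mag l := by
  simp only [mag_list_def, List.length_cons, List.sum_cons]
  omega

theorem mag_list_flatMap {δ : Type*} (l : List δ) (f : δ → List ℕ) :
    Ctx.mag (l.flatMap f) = (l.map fun i => Ctx.mag (f i)).sum := by
  induction l with
  | nil => rfl
  | cons x l ih => simp only [List.flatMap_cons, mag_list_append, ih, List.map_cons, List.sum_cons]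

theorem mag_flatMap_range_le {g : ℕ → List ℕ} {B n m : ℕ} (hm : m ≤ n)
    (h : ∀ i < n, Ctx.mag (g i) ≤ B) : Ctx.mag ((List.range m).flatMap g) ≤ n * B := by
  rw [mag_list_flatMap]
  refine (List.sum_le_card_nsmul _ B fun x hx => ?_).trans ?_
  · obtain ⟨i, hi, rfl⟩ := List.mem_map.1 hx
    exact h i ((List.mem_range.1 hi).trans_le hm)
  · simpa using Nat.mul_le_mul_right _ hm

theorem PTL.polyBounded {α : Type} [Ctx α] {l : α → List ℕ} (hl : PTL l) :
    PolyBounded (fun a => Ctx.mag (l a)) := by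
  induction hl with
  | nil => exact PolyBounded.const 0
  | cons hf _ ih =>
    simp only [mag_list_cons]
    exact (hf.polyBounded.add (.const 1)).add ih
  | append _ _ ih₁ ih₂ =>
    simp only [mag_list_append]
    exact ih₁.add ih₂
  | @flat α _ n g hn _ ih =>
    obtain ⟨G, hG, hG'⟩ := ih.subst (PolyBounded.mag.add hn.polyBounded)
    exact (hn.polyBounded.mul hG).mono fun a => mag_flatMap_range_le le_rfl fun i hi =>
      hG' a (a, i) (Nat.add_le_add_left hi.le _)

/-- The array `A` after the list has been written to it from position `p` on. -/
def writeList (A : ℕ → ℕ) (p : ℕ) : List ℕ → ℕ → ℕ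
  | [] => A
  | x :: l => writeList (Function.update A p x) (p + 1) l

theorem writeList_append (A : ℕ → ℕ) (p : ℕ) (k l : List ℕ) :
    writeList A p (k ++ l) = writeList (writeList A p k) (p + k.length) l := by
  induction k generalizing A p with
  | nil => rfl
  | cons x k ih =>
    simp only [List.cons_append, writeList, ih, List.length_cons]
    congr 1
    omega

theorem writeList_apply (A : ℕ → ℕ) (p : ℕ) (l : List ℕ) (i : ℕ) :
    writeList A p l i = if i < p then A i else l.getD (i - p) (A i) := by
  induction l generalizing A p with
  | nil => simp [writeList]
  | cons x l ih =>
    rw [writeList, ih]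
    rcases lt_trichotomy i p with h | rfl | h
    · simp [h, h.ne, show i < p + 1 by omega]
    · simp
    · obtain ⟨j, rfl⟩ : ∃ j, i = p + 1 + j := ⟨i - (p + 1), by omega⟩
      have h2 : p + 1 + j - p = j + 1 := by omega
      rw [if_neg (by omega), if_neg (by omega), h2, Nat.add_sub_cancel_left,
        Function.update_of_ne (by omega)]
      simp

section Emit

variable {α : Type} [Ctx α]

/-- A program can append `l` to the array `1`, with the register `0` as the write position. -/
def Emits (l : α → List ℕ) : Prop :=
  ∀ (lv : Ctx.V α → ℕ) (la : Ctx.A α → ℕ) (m : ℕ), (∀ v, 0 < lv v) → (∀ v, lv v < m) → 0 < m →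
    (∀ r, la r ≠ 1) →
    ∃ (P : Prog) (T : α × ℕ → ℕ), PolyBounded T ∧ ∀ a p σ, Holds lv la a σ → σ.reg 0 = p →
      ∃ t σ', Run P σ t σ' ∧ σ'.reg 0 = p + (l a).length ∧ (∀ r < m, 0 < r → σ'.reg r = σ.reg r) ∧
        (∀ k ≠ 1, σ'.arr k = σ.arr k) ∧ σ'.arr 1 = writeList (σ.arr 1) p (l a) ∧ t ≤ T (a, p)

theorem Holds.congr_pos {lv : Ctx.V α → ℕ} {la : Ctx.A α → ℕ} {a : α} {σ σ' : State} {m : ℕ}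
    (h : Holds lv la a σ) (h0 : ∀ v, 0 < lv v) (hm : ∀ v, lv v < m)
    (hr : ∀ r < m, 0 < r → σ'.reg r = σ.reg r) (hla : ∀ r, la r ≠ 1)
    (ha : ∀ k ≠ 1, σ'.arr k = σ.arr k) : Holds lv la a σ' :=
  ⟨fun v => (hr _ (hm v) (h0 v)).trans (h.1 v), fun r i => by rw [ha _ (hla r)]; exact h.2 r i⟩

theorem Emits.nil : Emits (fun _ : α => []) := by
  intro lv la m h0 hm hm0 hla
  refine ⟨.const m 0, fun _ => 1, PolyBounded.const 1, fun a p σ hσ hp => ?_⟩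
  refine ⟨_, _, .const _ _ _, ?_, fun r hr _ => ?_, fun _ _ => rfl, rfl, by simp⟩
  · simp (disch := omega) [State.reg_setReg_of_ne, hp]
  · simp (disch := omega) [State.reg_setReg_of_ne]

theorem Emits.append {k l : α → List ℕ} (hbk : PolyBounded fun a => Ctx.mag (k a))
    (hk : Emits k) (hl : Emits l) : Emits (fun a => k a ++ l a) := by
  intro lv la m h0 hm hm0 hla
  obtain ⟨P, T, hT, hP⟩ := hk lv la m h0 hm hm0 hla
  obtain ⟨Q, U, hU, hQ⟩ := hl lv la m h0 hm hm0 hla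
  obtain ⟨W, hW, hW'⟩ := hU.subst (PolyBounded.mag.add (hbk.fst (β := ℕ)))
  refine ⟨.seq P Q, fun x => T x + W x, hT.add hW, fun a p σ hσ hp => ?_⟩
  obtain ⟨t, σ₁, hr, hp₁, hlt, harr, hout, ht⟩ := hP a p σ hσ hp
  obtain ⟨t', σ₂, hr', hp₂, hlt', harr', hout', ht'⟩ := hQ a (p + (k a).length) σ₁
    (hσ.congr_pos h0 hm hlt hla harr) hp₁
  refine ⟨_, _, .seq hr hr', ?_, fun r h h' => ?_, fun j hj => ?_, ?_, ?_⟩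
  · rw [hp₂, List.length_append, add_assoc]
  · rw [hlt' r h h', hlt r h h']
  · rw [harr' j hj, harr j hj]
  · rw [hout', hout, writeList_append]
  · have := hW' (a, p) (a, p + (k a).length) (by
      change Ctx.mag a + (p + (k a).length) ≤ (Ctx.mag a + p) + Ctx.mag (k a)
      rw [mag_list_def]
      omega)
    dsimp only
    omega

theorem Emits.single {f : α → ℕ} (hf : PT f) : Emits (fun a => [f a]) := by
  intro lv la m h0 hm hm0 hla
  obtain ⟨P, T, hT, hP⟩ := hf.ptn.compiles lv la m hm
  refine ⟨.seq P (.seq (.store 1 0 m) (.seq (.const (m + 1) 1) (.add 0 0 (m + 1)))),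
    fun x => T x.1 + (10 + 3 * x.2 + f x.1),
    hT.fst.add (((PolyBounded.const 10).add ((PolyBounded.const 3).mul PolyBounded.mag.snd)).add
      hf.polyBounded.fst), fun a p σ hσ hp => ?_⟩
  obtain ⟨t, σ₁, hr, hv, hlt, harr, ht⟩ := hP a σ hσ
  have hp₁ : σ₁.reg 0 = p := by rw [hlt 0 hm0, hp]
  refine ⟨_, _, .seq hr (.seq (.store _ _ _ _) (.seq (.const _ _ _) (.add _ _ _ _))), ?_,
    fun r h h' => ?_, fun j hj => ?_, ?_, ?_⟩
  · simp (disch := omega) [State.reg_setReg_of_ne, hp₁]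
  · simp (disch := omega) [State.reg_setReg_of_ne, hlt]
  · simp [State.setArr, hj, harr]
  · simp [State.setArr, harr, hv, hp₁, writeList]
  · have c1 := size_le_self p
    have c2 := size_le_self (f a)
    simp (disch := omega) only [State.reg_setReg_of_ne, State.reg_setReg_self, hp₁, hv,
      State.reg_setArr, Nat.size_one]
    omega

theorem Emits.flat {n : α → ℕ} {g : α × ℕ → List ℕ} (hn : PT n)
    (hbg : PolyBounded fun x => Ctx.mag (g x)) (hg : Emits g) :
    Emits (fun a => (List.range (n a)).flatMap fun i => g (a, i)) := by
  intro lv la m h0 hm hm0 hla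
  obtain ⟨P, T, hT, hP⟩ := hn.ptn.compiles lv la m hm
  have hm4 : ∀ v, extLoc lv (m + 1) v < m + 3 :=
    extLoc_lt (fun v => (hm v).trans (by omega)) (by omega)
  have h04 : ∀ v, 0 < extLoc lv (m + 1) v := by
    rintro (v | v)
    exacts [h0 v, Nat.succ_pos m]
  have hla4 : ∀ r, extArr la r ≠ 1 := by
    rintro (r | r)
    exacts [hla r, r.elim]
  obtain ⟨Q, U, hU, hQ⟩ := hg (extLoc lv (m + 1)) (extArr la) (m + 3) h04 hm4 (by omega) hla4
  have hbn := hn.polyBounded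
  obtain ⟨G, hG, hG'⟩ := hbg.subst (PolyBounded.mag.add hbn)
  -- The cost of the body depends on the write position, which earlier rounds have advanced by at
  -- most `n * G`; hence the extra summand in the bound for the argument.
  obtain ⟨W, hW, hW'⟩ := hU.subst ((PolyBounded.mag.add (hbn.fst (β := ℕ))).add
    ((hbn.mul hG).fst (β := ℕ)))
  let B : α × ℕ → ℕ := fun x => W x + (10 + 2 * n x.1)
  have hB : PolyBounded B := hW.add ((PolyBounded.const 10).add ((PolyBounded.const 2).mul hbn.fst))
  refine ⟨.seq P (.seq (.const (m + 1) 0) (.seq (.const (m + 2) 1)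
    (.loop m (.seq Q (.seq (.add (m + 1) (m + 1) (m + 2)) (.sub m m (m + 2))))))),
    fun x => T x.1 + ((n x.1 + 1) * (B x + n x.1 + 1) + 20),
    hT.fst.add (((hbn.fst.add (.const 1)).mul ((hB.add hbn.fst).add (.const 1))).add (.const 20)),
    fun a p σ hσ hp => ?_⟩
  have hmag : ∀ i ≤ n a, Ctx.mag (a, i) ≤ Ctx.mag a + n a := fun i hi => Nat.add_le_add_left hi _
  have hle : ∀ i ≤ n a, ((List.range i).flatMap fun i => g (a, i)).length ≤ n a * G a := by
    intro i hi
    refine le_trans ?_ (mag_flatMap_range_le hi fun i hi' => hG' a (a, i) (hmag i hi'.le))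
    rw [mag_list_def]
    omega
  obtain ⟨t, σ₁, hr₁, hv₁, hlt₁, harr₁, ht₁⟩ := hP a σ hσ
  have hσ₁ := hσ.congr hm hlt₁ harr₁
  have hp₁ : σ₁.reg 0 = p := by rw [hlt₁ 0 hm0, hp]
  set σ₂ := (σ₁.setReg (m + 1) 0).setReg (m + 2) 1 with hσ₂
  obtain ⟨t', σ₃, hr₃, ⟨h30, h31, h32, h33, h34, h35⟩, ht'⟩ := Run.countdown (c := m) (N := n a)
    (B := B (a, p))
    (p := .seq Q (.seq (.add (m + 1) (m + 1) (m + 2)) (.sub m m (m + 2))))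
    (σ := σ₂)
    (fun i σ' => σ'.reg 0 = p + ((List.range i).flatMap fun i => g (a, i)).length ∧
      σ'.reg (m + 1) = i ∧
      σ'.reg (m + 2) = 1 ∧ (∀ r < m, 0 < r → σ'.reg r = σ₁.reg r) ∧
      (∀ k ≠ 1, σ'.arr k = σ₁.arr k) ∧
      σ'.arr 1 = writeList (σ₁.arr 1) p ((List.range i).flatMap fun i => g (a, i))) (by
      rintro i hi σ' ⟨h1, h2, h3, h4, h5, h6⟩ hc
      obtain ⟨u, σ₄, hr₄, hv₄, hlt₄, harr₄, hout₄, ht₄⟩ := hQ (a, i) _ σ'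
        ((hσ₁.congr_pos h0 hm h4 hla h5).ext h2) h1
      have e1 := hlt₄ (m + 1) (by omega) (by omega)
      have e2 := hlt₄ (m + 2) (by omega) (by omega)
      have e0 := hlt₄ m (by omega) (by omega)
      refine ⟨_, _, .seq hr₄ (.seq (.add _ _ _ _) (.sub _ _ _ _)),
        ⟨?_, ?_, ?_, fun r hr hr' => ?_, fun k hk => ?_, ?_⟩, ?_, ?_⟩
      · simp (disch := omega) only [State.reg_setReg_of_ne]
        rw [hv₄, List.range_succ, List.flatMap_append, List.length_append]
        simp [add_assoc]
      · simp (disch := omega) [State.reg_setReg_of_ne, e1, h2, e2, h3]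
      · simp (disch := omega) [State.reg_setReg_of_ne, e2, h3]
      · simp (disch := omega) only [State.reg_setReg_of_ne]
        rw [hlt₄ r (by omega) hr', h4 r hr hr']
      · simp only [State.arr_setReg]
        rw [harr₄ k hk, h5 k hk]
      · simp only [State.arr_setReg]
        rw [hout₄, h6, List.range_succ, List.flatMap_append, writeList_append]
        simp
      · simp (disch := omega) [State.reg_setReg_of_ne, e2, h3, e0, hc]
        omega
      · have b1 := hle i hi.le
        have b3 := hW' (a, p) ((a, i), p + ((List.range i).flatMap fun i => g (a, i)).length) (by
          have := hmag i hi.le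
          change Ctx.mag (a, i) + (p + _) ≤ (Ctx.mag a + p) + n a + (n a * G a)
          omega)
        have c3 := size_le_self i
        have c4 := size_le_self (n a - i)
        simp (disch := omega) only [State.reg_setReg_of_ne, e1, e2, h2, h3, e0, hc,
          Nat.size_one]
        simp only [B]
        omega)
    ⟨by simp (disch := omega) [hσ₂, State.reg_setReg_of_ne, hp₁],
      by simp (disch := omega) [hσ₂, State.reg_setReg_of_ne],
      by simp [hσ₂], fun r hr _ => by simp (disch := omega) [hσ₂, State.reg_setReg_of_ne],
      fun k _ => by simp [hσ₂], by simp [hσ₂, writeList]⟩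
    (by simp (disch := omega) [hσ₂, State.reg_setReg_of_ne, hv₁])
  refine ⟨_, _, .seq hr₁ (.seq (.const _ _ _) (.seq (.const _ _ _) hr₃)), h30,
    fun r h h' => ?_, fun k hk => ?_, ?_, ?_⟩
  · rw [h33 r h h', hlt₁ r h]
  · rw [h34 k hk, harr₁]
  · rw [h35, harr₁]
  · simp only [Nat.size_zero, Nat.size_one]
    omega

theorem PTL.emits {l : α → List ℕ} (hl : PTL l) : Emits l := by
  induction hl with
  | nil => exact .nil
  | cons hf _ ih =>
    refine Emits.append (k := fun a => [_]) ?_ (.single hf) ih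
    simp only [mag_list_cons]
    exact (hf.polyBounded.add (.const 1)).add (.const 0)
  | append h₁ _ ih₁ ih₂ => exact .append h₁.polyBounded ih₁ ih₂
  | flat hn h ih => exact .flat hn h.polyBounded ih

end Emit

/-! ### Composition with a decision procedure -/

/-- The registers from this one on are not written by the program. -/
def Prog.bound : Prog → ℕ
  | const r _ => r + 1
  | add r _ _ => r + 1
  | sub r _ _ => r + 1
  | load r _ _ => r + 1
  | store _ _ _ => 0
  | seq p q => max p.bound q.bound
  | ite _ p q => max p.bound q.bound
  | loop _ p => p.bound

/-- After a program has run, the registers beyond its bound are still as they were; in a composition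
they serve as fresh zero registers for the second program. -/
theorem Run.reg_eq_of_bound_le {P : Prog} {σ σ' : State} {t : ℕ} (h : Run P σ t σ') {r : ℕ}
    (hr : P.bound ≤ r) : σ'.reg r = σ.reg r := by
  induction h with
  | const | add | sub | load => exact State.reg_setReg_of_ne (by simp only [Prog.bound] at hr; omega)
  | store => rfl
  | seq _ _ ih₁ ih₂ =>
    simp only [Prog.bound, max_le_iff] at hr
    rw [ih₂ hr.2, ih₁ hr.1]
  | ite_true _ _ ih => simp only [Prog.bound, max_le_iff] at hr; exact ih hr.1
  | ite_false _ _ ih => simp only [Prog.bound, max_le_iff] at hr; exact ih hr.2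
  | loop_done => rfl
  | loop_step _ _ _ ih₁ ih₂ => rw [ih₂ hr, ih₁ hr]

/-- Renaming of the registers and the arrays. -/
def Prog.rename (f g : ℕ → ℕ) : Prog → Prog
  | const r k => .const (f r) k
  | add r s t => .add (f r) (f s) (f t)
  | sub r s t => .sub (f r) (f s) (f t)
  | load r a s => .load (f r) (g a) (f s)
  | store a s t => .store (g a) (f s) (f t)
  | seq p q => .seq (p.rename f g) (q.rename f g)
  | ite r p q => .ite (f r) (p.rename f g) (q.rename f g)
  | loop r p => .loop (f r) (p.rename f g)

/-- `τ` simulates `σ` after renaming. -/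
def Simulates (f g : ℕ → ℕ) (σ τ : State) : Prop :=
  (∀ r, τ.reg (f r) = σ.reg r) ∧ ∀ a, τ.arr (g a) = σ.arr a

theorem Simulates.setReg {f g : ℕ → ℕ} (hf : f.Injective) {σ τ : State} (h : Simulates f g σ τ)
    (r x : ℕ) : Simulates f g (σ.setReg r x) (τ.setReg (f r) x) := by
  refine ⟨fun s => ?_, h.2⟩
  simp only [State.reg_setReg, hf.eq_iff, h.1]

theorem Simulates.setArr {f g : ℕ → ℕ} (hg : g.Injective) {σ τ : State} (h : Simulates f g σ τ)
    (a i x : ℕ) : Simulates f g (σ.setArr a i x) (τ.setArr (g a) i x) := by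
  refine ⟨h.1, fun s => ?_⟩
  simp only [State.setArr, Function.update_apply, hg.eq_iff, h.2]

/-- Instructions are charged for the numbers they handle and not for the names of registers and
arrays, so the cost is unchanged. Injectivity ensures that a write does not disturb another
simulated cell. -/
theorem Run.rename {f g : ℕ → ℕ} (hf : f.Injective) (hg : g.Injective) {P : Prog} {σ σ' : State}
    {t : ℕ} (h : Run P σ t σ') {τ : State} (hs : Simulates f g σ τ) :
    ∃ τ', Run (P.rename f g) τ t τ' ∧ Simulates f g σ' τ' := by
  induction h generalizing τ with
  | const r k σ => exact ⟨_, .const _ _ _, hs.setReg hf _ _⟩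
  | add r s t σ =>
    refine ⟨_, ?_, hs.setReg hf r _⟩
    rw [← hs.1 s, ← hs.1 t]
    exact .add _ _ _ _
  | sub r s t σ =>
    refine ⟨_, ?_, hs.setReg hf r _⟩
    rw [← hs.1 s, ← hs.1 t]
    exact .sub _ _ _ _
  | load r a s σ =>
    refine ⟨_, ?_, hs.setReg hf r _⟩
    rw [← hs.1 s, ← hs.2 a]
    exact .load _ _ _ _
  | store a s t σ =>
    refine ⟨_, ?_, hs.setArr hg a _ _⟩
    rw [← hs.1 s, ← hs.1 t]
    exact .store _ _ _ _
  | seq _ _ ih₁ ih₂ =>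
    obtain ⟨τ₁, h₁, hs₁⟩ := ih₁ hs
    obtain ⟨τ₂, h₂, hs₂⟩ := ih₂ hs₁
    exact ⟨τ₂, .seq h₁ h₂, hs₂⟩
  | ite_true h0 _ ih =>
    obtain ⟨τ₁, h₁, hs₁⟩ := ih hs
    rw [← hs.1] at h0 ⊢
    exact ⟨τ₁, .ite_true h0 h₁, hs₁⟩
  | ite_false h0 _ ih =>
    obtain ⟨τ₁, h₁, hs₁⟩ := ih hs
    rw [← hs.1] at h0 ⊢
    exact ⟨τ₁, .ite_false h0 h₁, hs₁⟩
  | loop_done h0 =>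
    rw [← hs.1] at h0 ⊢
    exact ⟨τ, .loop_done h0, hs⟩
  | loop_step h0 _ _ ih₁ ih₂ =>
    obtain ⟨τ₁, h₁, hs₁⟩ := ih₁ hs
    obtain ⟨τ₂, h₂, hs₂⟩ := ih₂ hs₁
    rw [← hs.1] at h0 ⊢
    exact ⟨τ₂, .loop_step h0 h₁ h₂, hs₂⟩

/-- A polynomial time many-one reduction turns a decision procedure for one problem into a decision
procedure for another. -/
theorem DecidesInTime.reduce {ι κ : Type} {encι : ι → List ℕ} {encκ : κ → List ℕ}
    {yesι : ι → Prop} {yesκ : κ → Prop} {P : Prog} {T : κ → ℝ} (hP : DecidesInTime P encκ yesκ T)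
    {L : List ℕ → List ℕ} (hL : PTL L) (f : ι → κ) (henc : ∀ x, encκ (f x) = L (encι x))
    (hyes : ∀ x, yesκ (f x) ↔ yesι x) :
    ∃ (Q : Prog) (K : ℕ), DecidesInTime Q encι yesι fun x =>
      (((Ctx.mag (encι x) + 2) ^ K : ℕ) : ℝ) + T (f x) := by
  obtain ⟨E, U, hU, hE⟩ := hL.emits (fun _ => 1) (fun _ => 0) 2 (by simp) (by simp) (by simp)
    (by simp)
  obtain ⟨K, hK⟩ := hU.add ((PolyBounded.mag (α := List ℕ)).fst.add (PolyBounded.const 10) :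
    PolyBounded fun x : List ℕ × ℕ => Ctx.mag x.1 + 10)
  -- Register `0` keeps its name, since the emitter leaves the length of its output there, as the
  -- second program expects. All others are moved beyond the registers that have been written.
  -- Arrays are shifted by one, so that the output array `1` plays the role of the input array `0`
  -- and the old input is out of sight.
  let b := E.bound + 2
  let fr : ℕ → ℕ := fun r => if r = 0 then 0 else r + b
  have hfr : fr.Injective := by
    intro r s h
    simp only [fr] at h
    split_ifs at h <;> omega
  -- Register `2` is still zero, so the first instruction saves the input length in register `1`;
  -- register `0` is then cleared to become the write position.
  refine ⟨.seq (.add 1 0 2) (.seq (.const 0 0) (.seq E (P.rename fr Nat.succ))), K, fun x => ?_⟩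
  set σ₁ := ((State.init (encι x)).setReg 1 (encι x).length).setReg 0 0 with hσ₁
  have hH : Holds (α := List ℕ) (fun _ => 1) (fun _ => 0) (encι x) σ₁ := by
    constructor
    · intro v
      change σ₁.reg 1 = (encι x).length
      simp (disch := omega) [hσ₁, State.reg_setReg_of_ne]
    · intro r i
      simp [hσ₁, State.init]
      rfl
  obtain ⟨t, σ₂, hr₂, h0, hlt, harr, hout, ht⟩ := hE (encι x) 0 σ₁ hH (by simp [hσ₁])
  obtain ⟨u, σ₃, hr₃, hyes₃, hu⟩ := hP (f x)
  have hsim : Simulates fr Nat.succ (State.init (encκ (f x))) σ₂ := by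
    constructor
    · intro r
      by_cases hr : r = 0
      · simp [fr, hr, h0, State.init, henc]
      · simp only [fr, hr, if_false, State.init]
        rw [hr₂.reg_eq_of_bound_le (by simp only [b]; omega)]
        simp (disch := omega) only [hσ₁, State.reg_setReg_of_ne, State.init]
        simp only [b]
        rw [if_neg (by omega)]
    · intro a
      by_cases ha : a = 0
      · subst ha
        rw [show Nat.succ 0 = 1 from rfl, hout]
        funext i
        rw [writeList_apply]
        simp [State.init, henc, hσ₁]
      · rw [harr (Nat.succ a) (by simpa using ha)]
        simp [hσ₁, State.init, ha]
  obtain ⟨σ₄, hr₄, hs₄⟩ := hr₃.rename hfr Nat.succ_injective hsim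
  have hadd : Run (.add 1 0 2) (State.init (encι x)) (1 + ((State.init (encι x)).reg 0).size +
      ((State.init (encι x)).reg 2).size) ((State.init (encι x)).setReg 1 (encι x).length) := by
    simpa [State.init] using Run.add 1 0 2 (State.init (encι x))
  refine ⟨_, _, .seq hadd (.seq (.const _ _ _) (.seq hr₂ hr₄)), ?_, ?_⟩
  · have := hs₄.1 0
    simp only [fr, if_true] at this
    rw [this, hyes₃, hyes]
  · have h1 := hK (encι x, 0)
    have h2 : Ctx.mag (encι x, 0) = Ctx.mag (encι x) := rfl
    have h3 := size_le_self (encι x).length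
    have h4 : (encι x).length ≤ Ctx.mag (encι x) := by rw [mag_list_def]; omega
    rw [h2] at h1
    have h5 : 1 + ((State.init (encι x)).reg 0).size + ((State.init (encι x)).reg 2).size +
      (1 + (0 : ℕ).size + t) ≤ (Ctx.mag (encι x) + 2) ^ K := by
      simp only [State.init, if_true, Nat.size_zero, OfNat.ofNat_ne_zero, if_false]
      dsimp only at h1
      omega
    have h6 : (((1 + ((State.init (encι x)).reg 0).size + ((State.init (encι x)).reg 2).size +
      (1 + (0 : ℕ).size + t) : ℕ) : ℝ)) ≤ (((Ctx.mag (encι x) + 2) ^ K : ℕ) : ℝ) := by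
      exact_mod_cast h5
    push_cast at h6 hu ⊢
    linarith

/-! ## Reading the input -/

/-- The concatenation of the lists, each preceded by its length. -/
def blocks (ls : List (List ℕ)) : List ℕ := ls.flatMap fun l => l.length :: l

/-- The position of block `j`, when block `0` begins at position `p`. -/
def blockPos (w : List ℕ) (p j : ℕ) : ℕ := iterLt j w.length (fun y => y + 1 + cell w y) p

/-- The number of variables of the encoded formula. -/
def numVars (w : List ℕ) : ℕ := cell w 0
/-- The number of clauses of the encoded formula. -/
def numClauses (w : List ℕ) : ℕ := cell w 1
/-- The length of clause `j`. -/
def clauseLen (w : List ℕ) (j : ℕ) : ℕ := cell w (blockPos w 2 j)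
/-- Literal `q` of clause `j`. -/
def clauseLit (w : List ℕ) (j q : ℕ) : ℕ := cell w (blockPos w 2 j + 1 + q)
/-- The position of the encoded set of variables. -/
def setPos (w : List ℕ) : ℕ := blockPos w 2 (numClauses w)
/-- The size of the encoded set of variables. -/
def setSize (w : List ℕ) : ℕ := cell w (setPos w)
/-- Element `q` of the encoded set of variables. -/
def setElem (w : List ℕ) (q : ℕ) : ℕ := cell w (setPos w + 1 + q)
/-- Membership in the encoded set of variables. -/
def inSet (w : List ℕ) (v : ℕ) : Bool := exLt (setSize w) fun q => eqb (setElem w q) v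
/-- The number of bags. -/
def numBags (w : List ℕ) : ℕ := cell w (setPos w + 1 + setSize w)
/-- The size of bag `i`. -/
def bagLen (w : List ℕ) (i : ℕ) : ℕ :=
  bif ltb i (numBags w) then cell w (blockPos w (setPos w + 2 + setSize w) i) else 0
/-- Element `q` of bag `i`. -/
def bagElem (w : List ℕ) (i q : ℕ) : ℕ :=
  cell w (blockPos w (setPos w + 2 + setSize w) i + 1 + q)
/-- The sum of all entries. -/
def total (w : List ℕ) : ℕ := sumLt w.length (cell w)

section

variable {α : Type} [Ctx α]

@[fun_prop] theorem PT.blockPos {w : α → List ℕ} {p j : α → ℕ} (hw : PT w) (hp : PT p)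
    (hj : PT j) : PT (fun a => blockPos (w a) (p a) (j a)) := by
  unfold SatHyp.blockPos; fun_prop

@[fun_prop] theorem PT.numVars {w : α → List ℕ} (hw : PT w) : PT (fun a => numVars (w a)) := by
  unfold SatHyp.numVars; fun_prop

@[fun_prop] theorem PT.numClauses {w : α → List ℕ} (hw : PT w) :
    PT (fun a => numClauses (w a)) := by
  unfold SatHyp.numClauses; fun_prop

@[fun_prop] theorem PT.clauseLen {w : α → List ℕ} {j : α → ℕ} (hw : PT w) (hj : PT j) :
    PT (fun a => clauseLen (w a) (j a)) := by
  unfold SatHyp.clauseLen; fun_prop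

@[fun_prop] theorem PT.clauseLit {w : α → List ℕ} {j q : α → ℕ} (hw : PT w) (hj : PT j)
    (hq : PT q) : PT (fun a => clauseLit (w a) (j a) (q a)) := by
  unfold SatHyp.clauseLit; fun_prop

@[fun_prop] theorem PT.setPos {w : α → List ℕ} (hw : PT w) : PT (fun a => setPos (w a)) := by
  unfold SatHyp.setPos; fun_prop

@[fun_prop] theorem PT.setSize {w : α → List ℕ} (hw : PT w) : PT (fun a => setSize (w a)) := by
  unfold SatHyp.setSize; fun_prop

@[fun_prop] theorem PT.setElem {w : α → List ℕ} {q : α → ℕ} (hw : PT w) (hq : PT q) :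
    PT (fun a => setElem (w a) (q a)) := by
  unfold SatHyp.setElem; fun_prop

@[fun_prop] theorem PT.inSet {w : α → List ℕ} {v : α → ℕ} (hw : PT w) (hv : PT v) :
    PT (fun a => inSet (w a) (v a)) := by
  unfold SatHyp.inSet; fun_prop

@[fun_prop] theorem PT.numBags {w : α → List ℕ} (hw : PT w) : PT (fun a => numBags (w a)) := by
  unfold SatHyp.numBags; fun_prop

@[fun_prop] theorem PT.bagLen {w : α → List ℕ} {i : α → ℕ} (hw : PT w) (hi : PT i) :
    PT (fun a => bagLen (w a) (i a)) := by
  unfold SatHyp.bagLen; fun_prop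

@[fun_prop] theorem PT.bagElem {w : α → List ℕ} {i q : α → ℕ} (hw : PT w) (hi : PT i)
    (hq : PT q) : PT (fun a => bagElem (w a) (i a) (q a)) := by
  unfold SatHyp.bagElem; fun_prop

@[fun_prop] theorem PT.total {w : α → List ℕ} (hw : PT w) : PT (fun a => total (w a)) := by
  unfold SatHyp.total; fun_prop

end

theorem total_eq (w : List ℕ) : total w = w.sum := by
  unfold total sumLt
  induction w with
  | nil => rfl
  | cons x l ih =>
    rw [List.length_cons, Finset.sum_range_succ', List.sum_cons, ← ih]
    simp [cell, add_comm]

theorem cell_le_total (w : List ℕ) (i : ℕ) : cell w i ≤ total w :=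
  (cell_le_sum w i).trans (total_eq w).ge

theorem cell_append_add (p r : List ℕ) (i : ℕ) : cell (p ++ r) (p.length + i) = cell r i := by
  simp only [cell]
  rw [List.getD_append_right _ _ _ _ (by omega), Nat.add_sub_cancel_left]

theorem cell_append_length (p r : List ℕ) : cell (p ++ r) p.length = cell r 0 :=
  cell_append_add p r 0

theorem cell_append_of_lt (p r : List ℕ) {i : ℕ} (hi : i < p.length) :
    cell (p ++ r) i = p.getD i 0 := by
  simp only [cell]
  rw [List.getD_append _ _ _ _ hi]

theorem blocks_append (k l : List (List ℕ)) : blocks (k ++ l) = blocks k ++ blocks l :=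
  List.flatMap_append

theorem blocks_cons (x : List ℕ) (l : List (List ℕ)) :
    blocks (x :: l) = x.length :: x ++ blocks l := List.flatMap_cons

theorem blocks_eq_append_getElem (ls : List (List ℕ)) {j : ℕ} (hj : j < ls.length) :
    blocks ls = blocks (ls.take j) ++ ((ls[j].length :: ls[j]) ++ blocks (ls.drop (j + 1))) := by
  conv_lhs => rw [← List.take_append_drop j ls, List.drop_eq_getElem_cons hj]
  rw [blocks_append, blocks_cons]

theorem blocks_take_succ (ls : List (List ℕ)) {j : ℕ} (hj : j < ls.length) :
    (blocks (ls.take (j + 1))).length = (blocks (ls.take j)).length + 1 + ls[j].length := by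
  rw [List.take_add_one, List.getElem?_eq_getElem hj, blocks_append, List.length_append]
  simp [blocks]
  omega

/-- The cap by the length of the word, present only to make the iteration a `PTN` function, never
takes effect here: the blocks passed so far fit into the word. -/
theorem blockPos_eq (pre post : List ℕ) (ls : List (List ℕ)) {j : ℕ} (hj : j ≤ ls.length) :
    blockPos (pre ++ (blocks ls ++ post)) pre.length j =
      pre.length + (blocks (ls.take j)).length := by
  induction j with
  | zero => simp [blockPos, iterLt, blocks]
  | succ j ih =>
    have hj' : j < ls.length := hj
    have ih' := ih hj'.le
    unfold blockPos iterLt at ih' ⊢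
    rw [Function.iterate_succ_apply', ih']
    dsimp only
    rw [cell_append_add]
    have h := blocks_eq_append_getElem ls hj'
    have h2 : cell (blocks ls ++ post) (blocks (ls.take j)).length = ls[j].length := by
      rw [h, List.append_assoc, cell_append_length]
      rfl
    rw [h2, blocks_take_succ ls hj', min_eq_right]
    · omega
    · have h3 := congrArg List.length h
      simp only [List.length_append, List.length_cons] at h3 ⊢
      omega

theorem cell_blockPos (pre post : List ℕ) (ls : List (List ℕ)) {j : ℕ} (hj : j < ls.length) :
    cell (pre ++ (blocks ls ++ post)) (blockPos (pre ++ (blocks ls ++ post)) pre.length j) =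
      ls[j].length := by
  rw [blockPos_eq _ _ _ hj.le, cell_append_add, blocks_eq_append_getElem ls hj, List.append_assoc,
    cell_append_length]
  rfl

theorem cell_blockPos_add (pre post : List ℕ) (ls : List (List ℕ)) {j : ℕ} (hj : j < ls.length)
    {q : ℕ} (hq : q < ls[j].length) :
    cell (pre ++ (blocks ls ++ post)) (blockPos (pre ++ (blocks ls ++ post)) pre.length j + 1 + q) =
      ls[j][q] := by
  rw [blockPos_eq _ _ _ hj.le, add_assoc, add_assoc, cell_append_add, blocks_eq_append_getElem ls hj,
    List.append_assoc, cell_append_add, add_comm 1 q, List.append_assoc, List.cons_append]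
  have h := cell_append_of_lt ls[j] (blocks (ls.drop (j + 1)) ++ post) hq
  simp only [cell, List.getD_cons_succ] at h ⊢
  rw [h, List.getD_eq_getElem _ _ hq]

/-- The number that encodes a literal. -/
def litCode {n : ℕ} (l : Literal n) : ℕ := 2 * l.1.val + l.2.toNat

theorem litCode_lt {n : ℕ} (l : Literal n) : litCode l < 2 * n := by
  have := l.1.isLt
  have := l.2.toNat_le
  unfold litCode
  omega

theorem litCode_div {n : ℕ} (l : Literal n) : litCode l / 2 = l.1.val := by
  have := l.2.toNat_le
  unfold litCode
  omega

theorem litCode_mod {n : ℕ} (l : Literal n) : litCode l % 2 = l.2.toNat := by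
  have := l.2.toNat_le
  unfold litCode
  omega

theorem encodeList_singletons {δ : Type*} (f : δ → ℕ) (l : List δ) :
    encodeList (fun x => [f x]) l = (l.map f).length :: l.map f := by
  simp only [encodeList, List.length_map, List.cons.injEq, true_and]
  induction l with
  | nil => rfl
  | cons x l ih => simp [ih]

theorem encodeList_blocks {δ : Type*} (f : δ → List ℕ) (l : List δ) (g : δ → List ℕ)
    (hg : ∀ x, g x = (f x).length :: f x) :
    encodeList g l = l.length :: blocks (l.map f) := by
  obtain rfl : g = fun x => (f x).length :: f x := funext hg
  simp [encodeList, blocks, List.flatMap_map]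

theorem CNF.encode_eq {n : ℕ} (φ : CNF n) :
    φ.encode = n :: φ.length :: blocks (φ.map fun C => C.map litCode) := by
  rw [CNF.encode, encodeList_blocks]
  intro C
  exact encodeList_singletons litCode C

theorem encodeVarSet_eq {n : ℕ} (S : Finset (Fin n)) :
    encodeVarSet S = blocks [(S.sort (· ≤ ·)).map Fin.val] := by
  rw [encodeVarSet, encodeList_singletons]
  simp [blocks]

/-- The list `w` begins with the encodings of `φ` and `B`. -/
structure Encodes (w : List ℕ) {n : ℕ} (φ : CNF n) (B : Finset (Fin n)) : Prop where
  nv : numVars w = n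
  nc : numClauses w = φ.length
  len : ∀ j (hj : j < φ.length), clauseLen w j = φ[j].length
  lit : ∀ j (hj : j < φ.length) q (hq : q < φ[j].length), clauseLit w j q = litCode φ[j][q]
  size : setSize w = B.card
  elem : ∀ q (hq : q < B.card), setElem w q = ((B.sort (· ≤ ·)).map Fin.val)[q]'(by simpa using hq)

/-- The tail `post` is arbitrary so that both kinds of instances are covered: it is empty for a
backdoor and lists the bags for a path decomposition. -/
theorem encodes_append {n : ℕ} (φ : CNF n) (B : Finset (Fin n)) (post : List ℕ) :
    Encodes (φ.encode ++ encodeVarSet B ++ post) φ B := by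
  have hw : φ.encode ++ encodeVarSet B ++ post = [n, φ.length] ++
      (blocks (φ.map fun C => C.map litCode) ++ (encodeVarSet B ++ post)) := by
    rw [CNF.encode_eq]
    simp
  rw [hw]
  have hm : numClauses ([n, φ.length] ++
      (blocks (φ.map fun C => C.map litCode) ++ (encodeVarSet B ++ post))) = φ.length := rfl
  have hpos : setPos ([n, φ.length] ++
      (blocks (φ.map fun C => C.map litCode) ++ (encodeVarSet B ++ post))) =
      ([n, φ.length] ++ blocks (φ.map fun C => C.map litCode)).length := by
    rw [setPos, hm]
    refine (blockPos_eq [n, φ.length] _ _ (by simp)).trans ?_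
    rw [List.take_of_length_le (by simp), List.length_append]
  have hset : ∀ q, cell ([n, φ.length] ++
      (blocks (φ.map fun C => C.map litCode) ++ (encodeVarSet B ++ post)))
      (([n, φ.length] ++ blocks (φ.map fun C => C.map litCode)).length + q) =
      cell (encodeVarSet B ++ post) q := by
    intro q
    rw [← List.append_assoc, cell_append_add]
  have hB : encodeVarSet B ++ post = B.card :: ((B.sort (· ≤ ·)).map Fin.val ++ post) := by
    rw [encodeVarSet_eq]
    simp [blocks]
  refine ⟨rfl, rfl, fun j hj => ?_, fun j hj q hq => ?_, ?_, fun q hq => ?_⟩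
  · have := cell_blockPos [n, φ.length] (encodeVarSet B ++ post)
      (φ.map fun C => C.map litCode) (j := j) (by simpa using hj)
    rw [SatHyp.clauseLen]
    refine this.trans (by simp)
  · have := cell_blockPos_add [n, φ.length] (encodeVarSet B ++ post)
      (φ.map fun C => C.map litCode) (j := j) (by simpa using hj) (q := q) (by simpa using hq)
    rw [SatHyp.clauseLit]
    refine this.trans (by simp)
  · rw [SatHyp.setSize, hpos]
    refine (hset 0).trans ?_
    rw [hB]
    rfl
  · rw [SatHyp.setElem, hpos, add_assoc, hset, hB, add_comm 1 q]
    have h := cell_append_of_lt ((B.sort (· ≤ ·)).map Fin.val) post (i := q) (by simpa using hq)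
    simp only [cell, List.getD_cons_succ] at h ⊢
    rw [h, List.getD_eq_getElem]

theorem Encodes.inSet_iff {w : List ℕ} {n : ℕ} {φ : CNF n} {B : Finset (Fin n)}
    (h : Encodes w φ B) {v : ℕ} : inSet w v = true ↔ ∃ x ∈ B, x.val = v := by
  simp only [inSet, exLt_iff, eqb_iff, h.size]
  have : (∃ x ∈ B, x.val = v) ↔ v ∈ (B.sort (· ≤ ·)).map Fin.val := by simp
  rw [this, List.mem_iff_getElem]
  simp only [List.length_map, Finset.length_sort]
  constructor
  · rintro ⟨q, hq, rfl⟩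
    exact ⟨q, hq, (h.elem q hq).symm⟩
  · rintro ⟨q, hq, rfl⟩
    exact ⟨q, hq, h.elem q hq⟩

theorem Encodes.inSet_val_iff {w : List ℕ} {n : ℕ} {φ : CNF n} {B : Finset (Fin n)}
    (h : Encodes w φ B) {x : Fin n} : inSet w x.val = true ↔ x ∈ B := by
  rw [h.inSet_iff]
  constructor
  · rintro ⟨y, hy, hxy⟩
    rwa [← Fin.ext hxy]
  · exact fun hx => ⟨x, hx, rfl⟩

theorem Encodes.exists_mem_iff {w : List ℕ} {n : ℕ} {φ : CNF n} {B : Finset (Fin n)}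
    (h : Encodes w φ B) {j : ℕ} (hj : j < φ.length) {p : ℕ → Prop} :
    (∃ l ∈ φ[j], p (litCode l)) ↔ ∃ q < clauseLen w j, p (clauseLit w j q) := by
  rw [h.len j hj]
  constructor
  · rintro ⟨l, hl, hp⟩
    obtain ⟨q, hq, rfl⟩ := List.mem_iff_getElem.1 hl
    exact ⟨q, hq, by rwa [h.lit j hj q hq]⟩
  · rintro ⟨q, hq, hp⟩
    exact ⟨_, List.getElem_mem hq, by rwa [h.lit j hj q hq] at hp⟩

theorem Encodes.forall_mem_iff {w : List ℕ} {n : ℕ} {φ : CNF n} {B : Finset (Fin n)}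
    (h : Encodes w φ B) {j : ℕ} (hj : j < φ.length) {p : ℕ → Prop} :
    (∀ l ∈ φ[j], p (litCode l)) ↔ ∀ q < clauseLen w j, p (clauseLit w j q) := by
  have := h.exists_mem_iff hj (p := fun a => ¬ p a)
  constructor
  · intro h1 q hq
    by_contra h2
    obtain ⟨l, hl, h3⟩ := this.2 ⟨q, hq, h2⟩
    exact h3 (h1 l hl)
  · intro h1 l hl
    by_contra h2
    obtain ⟨q, hq, h3⟩ := this.1 ⟨l, hl, h2⟩
    exact h3 (h1 q hq)

/-! ### Literals as numbers -/

/-- The literal with the code `a` is true. -/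
def LitTrue (τ : ℕ → Bool) (a : ℕ) : Prop := τ (a / 2) = decide (a % 2 = 1)

/-- The complementary literal. -/
def flipLit (a : ℕ) : ℕ := bif eqb (a % 2) 0 then a + 1 else a - 1

@[fun_prop] theorem PT.flipLit {α : Type} [Ctx α] {f : α → ℕ} (hf : PT f) :
    PT (fun a => flipLit (f a)) := by
  unfold SatHyp.flipLit; fun_prop

theorem flipLit_eq (a : ℕ) : flipLit a = if a % 2 = 0 then a + 1 else a - 1 := by
  unfold flipLit
  split_ifs with h
  · rw [eqb_iff.2 h]; rfl
  · have : eqb (a % 2) 0 = false := by simpa using h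
    simp [this]

@[simp] theorem flipLit_flipLit (a : ℕ) : flipLit (flipLit a) = a := by
  simp only [flipLit_eq]
  split_ifs <;> omega

theorem flipLit_div (a : ℕ) : flipLit a / 2 = a / 2 := by
  rw [flipLit_eq]
  split_ifs <;> omega

theorem flipLit_add_two (a : ℕ) : flipLit (a + 2) = flipLit a + 2 := by
  simp only [flipLit_eq]
  split_ifs <;> omega

theorem flipLit_lt {a n : ℕ} (h : a < 2 * n) : flipLit a < 2 * n := by
  rw [flipLit_eq]
  split_ifs <;> omega

theorem litTrue_flipLit {τ : ℕ → Bool} {a : ℕ} : LitTrue τ (flipLit a) ↔ ¬ LitTrue τ a := by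
  have h1 : flipLit a % 2 = 1 ↔ ¬ a % 2 = 1 := by
    rw [flipLit_eq]
    split_ifs <;> omega
  unfold LitTrue
  rw [flipLit_div]
  by_cases h : a % 2 = 1
  · have h2 : ¬ flipLit a % 2 = 1 := by rw [h1]; simpa using h
    cases τ (a / 2) <;> simp [h, h2]
  · have h2 : flipLit a % 2 = 1 := by rw [h1]; exact h
    cases τ (a / 2) <;> simp [h, h2]

/-- The extension of an assignment to all natural numbers. -/
def extAssign {n : ℕ} (τ : Fin n → Bool) (v : ℕ) : Bool := if h : v < n then τ ⟨v, h⟩ else false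

theorem litTrue_litCode {n : ℕ} {τ : ℕ → Bool} {l : Literal n} :
    LitTrue τ (litCode l) ↔ Literal.Holds (fun x => τ x.val) l := by
  unfold LitTrue Literal.Holds
  rw [litCode_div, litCode_mod]
  cases l.2 <;> simp

theorem extAssign_val {n : ℕ} (τ : Fin n → Bool) (x : Fin n) : extAssign τ x.val = τ x := by
  simp [extAssign]

theorem litTrue_extAssign {n : ℕ} {τ : Fin n → Bool} {l : Literal n} :
    LitTrue (extAssign τ) (litCode l) ↔ Literal.Holds τ l := by
  rw [litTrue_litCode]
  simp only [extAssign_val]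

/-- Assignments to all natural numbers can be shared by formulas with different numbers of
variables, as the reductions require. -/
theorem CNF.satisfiable_iff_nat {n : ℕ} {φ : CNF n} :
    φ.Satisfiable ↔ ∃ τ : ℕ → Bool, ∀ C ∈ φ, ∃ l ∈ C, LitTrue τ (litCode l) := by
  constructor
  · rintro ⟨τ, hτ⟩
    refine ⟨extAssign τ, fun C hC => ?_⟩
    simpa only [litTrue_extAssign] using hτ C hC
  · rintro ⟨τ, hτ⟩
    refine ⟨fun x => τ x.val, fun C hC => ?_⟩
    simpa only [litTrue_litCode] using hτ C hC

/-! ### Formulas given by numbers -/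

/-- The literal with the code `a`. -/
def ofCode (n : ℕ) [NeZero n] (a : ℕ) : Literal n := (Fin.ofNat n (a / 2), decide (a % 2 = 1))

theorem litCode_ofCode {n : ℕ} [NeZero n] {a : ℕ} (h : a < 2 * n) : litCode (ofCode n a) = a := by
  have h1 : a / 2 % n = a / 2 := Nat.mod_eq_of_lt (by omega)
  simp only [litCode, ofCode, Fin.val_ofNat, h1]
  by_cases h2 : a % 2 = 1
  · simp [h2]; omega
  · simp [h2]; omega

/-- The formula whose clauses have the codes `cs`. -/
def ofCodes (n : ℕ) [NeZero n] (cs : List (List ℕ)) : CNF n := cs.map fun C => C.map (ofCode n)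

theorem map_litCode_ofCodes {n : ℕ} [NeZero n] {C : List ℕ} (h : ∀ a ∈ C, a < 2 * n) :
    (C.map (ofCode n)).map litCode = C := by
  rw [List.map_map]
  conv_rhs => rw [← List.map_id C]
  exact List.map_congr_left fun a ha => litCode_ofCode (h a ha)

theorem encode_ofCodes {n : ℕ} [NeZero n] {cs : List (List ℕ)} (h : ∀ C ∈ cs, ∀ a ∈ C, a < 2 * n) :
    (ofCodes n cs).encode = n :: cs.length :: blocks cs := by
  rw [CNF.encode_eq]
  have : (ofCodes n cs).map (fun C => C.map litCode) = cs := by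
    rw [ofCodes, List.map_map]
    conv_rhs => rw [← List.map_id cs]
    exact List.map_congr_left fun C hC => map_litCode_ofCodes (h C hC)
  rw [this]
  simp [ofCodes]

theorem satisfiable_ofCodes {n : ℕ} [NeZero n] {cs : List (List ℕ)}
    (h : ∀ C ∈ cs, ∀ a ∈ C, a < 2 * n) :
    (ofCodes n cs).Satisfiable ↔ ∃ τ : ℕ → Bool, ∀ C ∈ cs, ∃ a ∈ C, LitTrue τ a := by
  rw [CNF.satisfiable_iff_nat]
  simp only [ofCodes, List.mem_map, forall_exists_index, and_imp, forall_apply_eq_imp_iff₂,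
    exists_exists_and_eq_and]
  refine exists_congr fun τ => forall₂_congr fun C hC => exists_congr fun a => ?_
  refine and_congr_right fun ha => ?_
  rw [litCode_ofCode (h C hC a ha)]

/-! ## Branching programs -/

/-- The label of an edge is satisfied: `0` marks an absent edge, `1` an edge that is always present,
and `a + 2` an edge that is present when the literal with the code `a` is true. -/
def LabTrue (τ : ℕ → Bool) (l : ℕ) : Prop := l = 1 ∨ 2 ≤ l ∧ LitTrue τ (l - 2)

theorem not_labTrue_zero {τ : ℕ → Bool} : ¬ LabTrue τ 0 := by simp [LabTrue]

theorem labTrue_one {τ : ℕ → Bool} : LabTrue τ 1 := Or.inl rfl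

theorem labTrue_add_two {τ : ℕ → Bool} {a : ℕ} : LabTrue τ (a + 2) ↔ LitTrue τ a := by
  simp [LabTrue]

theorem labTrue_toNat {τ : ℕ → Bool} {b : Bool} : LabTrue τ b.toNat ↔ b = true := by
  cases b
  · simp [not_labTrue_zero]
  · simp [labTrue_one]

/-- Labels are literal codes shifted by two, an even number, so the constants `0` and `1` form a
complementary pair as well and one operation negates every label. -/
theorem labTrue_flipLit {τ : ℕ → Bool} {l : ℕ} : LabTrue τ (flipLit l) ↔ ¬ LabTrue τ l := by
  match l with
  | 0 => simp [flipLit_eq, not_labTrue_zero, labTrue_one]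
  | 1 => simp [flipLit_eq, not_labTrue_zero, labTrue_one]
  | a + 2 => rw [flipLit_add_two, labTrue_add_two, labTrue_add_two, litTrue_flipLit]

/-- A family of directed graphs with labelled edges, computed in polynomial time from the input. -/
structure PGraph where
  N : List ℕ → ℕ
  s : List ℕ → ℕ
  t : List ℕ → ℕ
  lab : List ℕ → ℕ → ℕ → ℕ
  ptN : PT N
  pts : PT s
  ptt : PT t
  ptlab : PT fun p : List ℕ × ℕ × ℕ => lab p.1 p.2.1 p.2.2
  s_lt : ∀ w, s w < N w
  t_lt : ∀ w, t w < N w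
  lab_mem : ∀ w x y, 2 ≤ lab w x y → inSet w ((lab w x y - 2) / 2) = true

section

variable {α : Type} [Ctx α] (G : PGraph)

@[fun_prop] theorem PT.graphN {f : α → List ℕ} (hf : PT f) : PT (fun a => G.N (f a)) :=
  PT.comp G.ptN hf

@[fun_prop] theorem PT.graphs {f : α → List ℕ} (hf : PT f) : PT (fun a => G.s (f a)) :=
  PT.comp G.pts hf

@[fun_prop] theorem PT.grapht {f : α → List ℕ} (hf : PT f) : PT (fun a => G.t (f a)) :=
  PT.comp G.ptt hf

@[fun_prop] theorem PT.graphLab {f : α → List ℕ} {g h : α → ℕ} (hf : PT f) (hg : PT g)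
    (hh : PT h) : PT (fun a => G.lab (f a) (g a) (h a)) :=
  PT.comp (g := fun a => (f a, g a, h a)) G.ptlab (by fun_prop)

end

/-- The edges whose label is satisfied, in a graph on the vertices below `N`. -/
def LabEdge (N : ℕ) (lab : ℕ → ℕ → ℕ) (τ : ℕ → Bool) (x y : ℕ) : Prop :=
  x < N ∧ y < N ∧ LabTrue τ (lab x y)

/-- The target can be reached from the source. -/
def PGraph.Reach (G : PGraph) (w : List ℕ) (τ : ℕ → Bool) : Prop :=
  Relation.ReflTransGen (LabEdge (G.N w) (G.lab w) τ) (G.s w) (G.t w)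

/-! ### Reachability within a bounded number of steps -/

/-- `v` can be reached from `s` in at most `k` steps. -/
def ReachIn (E : ℕ → ℕ → Prop) (s : ℕ) : ℕ → ℕ → Prop
  | 0, v => v = s
  | k + 1, v => ∃ u, ReachIn E s k u ∧ (u = v ∨ E u v)

section ReachIn

variable {E : ℕ → ℕ → Prop} {s N : ℕ}

theorem ReachIn.succ {k v : ℕ} (h : ReachIn E s k v) : ReachIn E s (k + 1) v := ⟨v, h, Or.inl rfl⟩

theorem ReachIn.mono {k l v : ℕ} (h : ReachIn E s k v) (hkl : k ≤ l) : ReachIn E s l v := by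
  induction hkl with
  | refl => exact h
  | step _ ih => exact ih.succ

theorem ReachIn.lt (hs : s < N) (hE : ∀ u v, E u v → v < N) {k v : ℕ} (h : ReachIn E s k v) :
    v < N := by
  induction k generalizing v with
  | zero => rwa [show v = s from h]
  | succ k ih =>
    obtain ⟨u, hu, rfl | huv⟩ := h
    exacts [ih hu, hE u v huv]

theorem ReachIn.reflTransGen {k v : ℕ} (h : ReachIn E s k v) : Relation.ReflTransGen E s v := by
  induction k generalizing v with
  | zero => rw [show v = s from h]
  | succ k ih =>
    obtain ⟨u, hu, rfl | huv⟩ := h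
    exacts [ih hu, (ih hu).tail huv]

-- The sets of vertices reachable within `k` steps increase inside a set of `N` elements, so two
-- consecutive ones agree for some `k ≤ N`. From there on the set is closed under edges.
open Classical in
theorem reflTransGen_iff_reachIn (hs : s < N) (hE : ∀ u v, E u v → v < N) {v : ℕ} :
    Relation.ReflTransGen E s v ↔ ReachIn E s N v := by
  refine ⟨fun h => ?_, ReachIn.reflTransGen⟩
  let F : ℕ → Finset ℕ := fun k => (Finset.range N).filter (ReachIn E s k)
  have hF : ∀ k u, u ∈ F k ↔ ReachIn E s k u := fun k u => by
    simp only [F, Finset.mem_filter, Finset.mem_range, and_iff_right_iff_imp]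
    exact ReachIn.lt hs hE
  have hsub : ∀ k, F k ⊆ F (k + 1) := fun k u hu => (hF _ _).2 ((hF _ _).1 hu).succ
  have hstable : ∃ k ≤ N, F (k + 1) = F k := by
    by_contra! hne
    have hcard : ∀ k ≤ N + 1, k ≤ (F k).card := by
      intro k
      induction k with
      | zero => simp
      | succ k ih =>
        intro hk
        have := Finset.card_lt_card (lt_of_le_of_ne (hsub k) (hne k (by omega)).symm)
        have := ih (by omega)
        omega
    have h1 := hcard (N + 1) le_rfl
    have h2 := Finset.card_le_card (Finset.filter_subset (ReachIn E s (N + 1)) (Finset.range N))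
    rw [Finset.card_range] at h2
    exact absurd (h1.trans h2) (by omega)
  obtain ⟨k, hk, hkF⟩ := hstable
  suffices h' : ReachIn E s k v from h'.mono hk
  induction h with
  | refl => exact ReachIn.mono (k := 0) rfl (Nat.zero_le _)
  | tail _ hab ih => rw [← hF, ← hkF, hF]; exact ⟨_, ih, Or.inr hab⟩

end ReachIn

/-! ### Numbers as tuples -/

/-- Digit `j` of `x` in base `b`. -/
def digit (b j x : ℕ) : ℕ := x / b ^ j % b

theorem PT.digit {α : Type} [Ctx α] {b x : α → ℕ} (hb : PT b) (j : ℕ) (hx : PT x) :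
    PT (fun a => digit (b a) j (x a)) := by
  unfold SatHyp.digit; fun_prop

attribute [fun_prop] PT.digit

theorem exists_digits {b : ℕ} (k : ℕ) (f : ℕ → ℕ) (hf : ∀ j < k, f j < b) :
    ∃ x < b ^ k, ∀ j < k, digit b j x = f j := by
  induction k generalizing f with
  | zero => exact ⟨0, by simp, by simp⟩
  | succ k ih =>
    obtain ⟨x, hx, hd⟩ := ih (fun j => f (j + 1)) fun j hj => hf (j + 1) (by omega)
    have h0 := hf 0 (by omega)
    have hb : 0 < b := by omega
    refine ⟨f 0 + b * x, ?_, fun j hj => ?_⟩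
    · rw [pow_succ]
      calc f 0 + b * x < b + b * x := by omega
        _ = b * (x + 1) := by ring
        _ ≤ b * b ^ k := Nat.mul_le_mul_left _ hx
        _ = b ^ k * b := by ring
    · cases j with
      | zero => simp [digit, Nat.mod_eq_of_lt h0]
      | succ j =>
        rw [← hd j (by omega), digit, digit, pow_succ', ← Nat.div_div_eq_div_mul,
          Nat.add_mul_div_left _ _ hb, Nat.div_eq_of_lt h0, Nat.zero_add]

/-! ### The complement of reachability -/

/-- A configuration of the inductive counting procedure: in round `k`, `r` vertices are known to be
reachable in at most `k` steps, `c` vertices below `v` are known to be reachable in at most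
`k + 1` steps, `e` of the `r` vertices have been found below `u`, `f` of them lead to `v`, and
the vertex `w` has been reached in `d` steps (`w = N` if no path is being searched). -/
structure Count where
  k : ℕ
  r : ℕ
  w : ℕ
  v : ℕ
  c : ℕ
  u : ℕ
  e : ℕ
  f : ℕ
  d : ℕ

/-- The configuration with the number `x`. -/
def toCount (b x : ℕ) : Count :=
  ⟨digit b 0 x, digit b 1 x, digit b 2 x, digit b 3 x, digit b 4 x, digit b 5 x, digit b 6 x,
    digit b 7 x, digit b 8 x⟩

/-- The label of the transition from `x` to `y` in the inductive counting procedure. -/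
def countLab (N s t : ℕ) (lab : ℕ → ℕ → ℕ) (x y : Count) : ℕ :=
  bif ltb x.k N then
    bif eqb x.w N then
      bif eqb x.v N then
        (eqb y.k (x.k + 1) && eqb y.r x.c && eqb y.w N && eqb y.v 0 && eqb y.c 0 && eqb y.u 0 &&
          eqb y.e 0 && eqb y.f 0 && eqb y.d 0).toNat
      else bif eqb x.u N then
        (eqb x.e x.r && !(eqb x.v t && ltb 0 x.f) && eqb y.k x.k && eqb y.r x.r && eqb y.w N &&
          eqb y.v (x.v + 1) && eqb y.c (x.c + min x.f 1) && eqb y.u 0 && eqb y.e 0 && eqb y.f 0 &&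
          eqb y.d 0).toNat
      else
        (eqb y.k x.k && eqb y.r x.r && eqb y.v x.v && eqb y.c x.c && eqb y.e x.e && eqb y.f x.f &&
          eqb y.d 0 && ((eqb y.u (x.u + 1) && eqb y.w N) || (eqb y.u x.u && eqb y.w s))).toNat
    else bif ltb x.w N && ltb y.w N then
      bif ltb x.d x.k && eqb y.k x.k && eqb y.r x.r && eqb y.v x.v && eqb y.c x.c && eqb y.u x.u &&
        eqb y.e x.e && eqb y.f x.f && eqb y.d (x.d + 1) then lab x.w y.w else 0
    else bif eqb y.w N && eqb x.w x.u && ltb x.u N && ltb x.v N && eqb y.k x.k && eqb y.r x.r && eqb y.v x.v &&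
        eqb y.c x.c && eqb y.u (x.u + 1) && eqb y.e (x.e + 1) && eqb y.d 0 then
      bif eqb y.f (x.f + 1) then bif eqb x.u x.v then 1 else lab x.u x.v
      else bif eqb y.f x.f && !(eqb x.u x.v) then flipLit (lab x.u x.v) else 0
    else 0
  else bif eqb x.k N then (eqb y.k (N + 1)).toNat else 0

section Counting

variable {N s t : ℕ} {lab : ℕ → ℕ → ℕ} {τ : ℕ → Bool}

open Classical in
/-- The number of vertices below `n` that can be reached in at most `k` steps. -/
noncomputable def countReach (E : ℕ → ℕ → Prop) (s k n : ℕ) : ℕ := Nat.count (ReachIn E s k) n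

theorem countReach_le {E : ℕ → ℕ → Prop} {s k n : ℕ} : countReach E s k n ≤ n := by
  classical
  exact Nat.count_le _

theorem countReach_succ_of {E : ℕ → ℕ → Prop} {s k n : ℕ} (h : ReachIn E s k n) :
    countReach E s k (n + 1) = countReach E s k n + 1 := by
  classical
  simp [countReach, Nat.count_succ, h]

theorem countReach_succ_of_not {E : ℕ → ℕ → Prop} {s k n : ℕ} (h : ¬ ReachIn E s k n) :
    countReach E s k (n + 1) = countReach E s k n := by
  classical
  simp [countReach, Nat.count_succ, h]

theorem countReach_zero {E : ℕ → ℕ → Prop} {s k : ℕ} : countReach E s k 0 = 0 := by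
  classical
  simp [countReach]

theorem countReach_zero_left {E : ℕ → ℕ → Prop} (hs : s < N) : countReach E s 0 N = 1 := by
  classical
  rw [countReach, Nat.count_eq_card_filter_range, Finset.card_eq_one]
  refine ⟨s, ?_⟩
  ext v
  rw [Finset.mem_filter, Finset.mem_range, Finset.mem_singleton]
  exact ⟨fun h => h.2, fun h => ⟨h ▸ hs, h⟩⟩

/-- Some vertex below `u`, reached in at most `k` steps, leads to `v`. -/
def LeadsTo (E : ℕ → ℕ → Prop) (s k u v : ℕ) : Prop :=
  ∃ u' < u, ReachIn E s k u' ∧ (u' = v ∨ E u' v)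

/-- The invariant of the counting procedure. -/
structure CountInv (N s t : ℕ) (E : ℕ → ℕ → Prop) (x : Count) : Prop where
  final : x.k = N + 1 → ¬ ReachIn E s N t
  target : x.k ≤ N → 0 < x.k → ¬ ReachIn E s x.k t
  r : x.k ≤ N → x.r = countReach E s x.k N
  v : x.k ≤ N → x.v ≤ N
  u : x.k ≤ N → x.u ≤ N
  c : x.k ≤ N → x.c = countReach E s (x.k + 1) x.v
  next : x.k ≤ N → t < x.v → ¬ ReachIn E s (x.k + 1) t
  e : x.k ≤ N → x.e ≤ countReach E s x.k x.u
  f : x.k ≤ N → x.e = countReach E s x.k x.u → (0 < x.f ↔ LeadsTo E s x.k x.u x.v)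
  path : x.k ≤ N → x.w < N → x.d ≤ x.k ∧ ReachIn E s x.d x.w

theorem leadsTo_zero {E : ℕ → ℕ → Prop} {s k v : ℕ} : ¬ LeadsTo E s k 0 v := by
  rintro ⟨_, h, _⟩
  omega

theorem leadsTo_succ {E : ℕ → ℕ → Prop} {s k u v : ℕ} : LeadsTo E s k (u + 1) v ↔
    LeadsTo E s k u v ∨ ReachIn E s k u ∧ (u = v ∨ E u v) := by
  constructor
  · rintro ⟨x, hx, h⟩
    rcases Nat.lt_succ_iff_lt_or_eq.1 hx with hx | rfl
    exacts [Or.inl ⟨x, hx, h⟩, Or.inr h]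
  · rintro (⟨x, hx, h⟩ | h)
    exacts [⟨x, by omega, h⟩, ⟨u, by omega, h⟩]

theorem leadsTo_iff_reachIn {E : ℕ → ℕ → Prop} {k v : ℕ} (hs : s < N) (hE : ∀ u v, E u v → v < N) :
    LeadsTo E s k N v ↔ ReachIn E s (k + 1) v := by
  constructor
  · rintro ⟨u, _, h⟩
    exact ⟨u, h⟩
  · rintro ⟨u, h⟩
    exact ⟨u, h.1.lt hs hE, h⟩

/-- Soundness of inductive counting. A vertex is counted in `e` only after a path to it has been
exhibited, so wrong guesses can only undercount. When all `u` have been passed, the test `e = r`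
therefore forces that every reachable vertex was found, and `f` then tells whether `v` is reachable
in `k + 1` steps. The absence of an edge is tested directly, by the negated label. -/
theorem CountInv.step (hs : s < N) (ht : t < N) {x y : Count}
    (hx : CountInv N s t (LabEdge N lab τ) x) (h : LabTrue τ (countLab N s t lab x y)) :
    CountInv N s t (LabEdge N lab τ) y := by
  have hE : ∀ u v, LabEdge N lab τ u v → v < N := fun u v h => h.2.1
  obtain ⟨k, r, w, v, c, u, e, f, d⟩ := x
  obtain ⟨k', r', w', v', c', u', e', f', d'⟩ := y
  obtain ⟨-, x2, x3, x4, x5, x6, x7, x8, x9, x10⟩ := hx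
  simp only [countLab, Bool.cond_eq_ite] at h x2 x3 x4 x5 x6 x7 x8 x9 x10
  split_ifs at h with h1 h2 h3 h4 h5 h6 h7 h8 h9 h10 h11
  all_goals simp only [labTrue_toNat, not_labTrue_zero, Bool.and_eq_true, Bool.or_eq_true, eqb_iff,
    ltb_iff, Bool.not_eq_true', eqb_false_iff] at *
  · -- next round
    obtain ⟨⟨⟨⟨⟨⟨⟨⟨rfl, rfl⟩, hw⟩, rfl⟩, rfl⟩, rfl⟩, rfl⟩, rfl⟩, rfl⟩ := h
    refine ⟨fun h => ?_, fun _ _ => x7 h1.le (h3 ▸ ht), fun _ => h3 ▸ x6 h1.le,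
      fun _ => Nat.zero_le _,
      fun _ => Nat.zero_le _, fun _ => countReach_zero.symm, fun _ h => ?_, fun _ => Nat.zero_le _,
      fun _ _ => ?_, fun _ h => ?_⟩
    all_goals dsimp only at *
    · omega
    · omega
    · simpa using leadsTo_zero
    · omega
  · -- next vertex `v`
    obtain ⟨⟨⟨⟨⟨⟨⟨⟨⟨⟨he, hf⟩, rfl⟩, rfl⟩, hw⟩, rfl⟩, rfl⟩, rfl⟩, rfl⟩, rfl⟩, rfl⟩ := h
    have hv := x4 h1.le
    -- All of the `r` reachable vertices have been found, so `f` can be trusted in both directions.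
    have hlead := x9 h1.le (by rw [h4, he, x3 h1.le])
    rw [h4, leadsTo_iff_reachIn hs hE] at hlead
    refine ⟨fun h => ?_, fun h => x2 h1.le, fun _ => x3 h1.le, fun _ => ?_,
      fun _ => Nat.zero_le _, fun _ => ?_, fun _ h => ?_, fun _ => Nat.zero_le _,
      fun _ _ => ?_, fun _ h => ?_⟩
    all_goals dsimp only at *
    · omega
    · omega
    · by_cases hf0 : 0 < f
      · rw [countReach_succ_of (hlead.1 hf0), x6 h1.le]
        omega
      · rw [countReach_succ_of_not (fun h => hf0 (hlead.2 h)), x6 h1.le]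
        omega
    · rcases Nat.lt_succ_iff_lt_or_eq.1 h with h | rfl
      · exact x7 h1.le h
      · intro h'
        have := hlead.2 h'
        simp at hf
        omega
    · simpa using leadsTo_zero
    · omega
  · -- skip `u` or begin a path
    obtain ⟨⟨⟨⟨⟨⟨⟨rfl, rfl⟩, rfl⟩, rfl⟩, rfl⟩, rfl⟩, rfl⟩, ⟨rfl, hw⟩ | ⟨rfl, hw⟩⟩ := h
    · have hu := x5 h1.le
      have he := x8 h1.le
      refine ⟨fun h => ?_, fun h => x2 h1.le, fun _ => x3 h1.le, x4, fun _ => ?_, x6, x7, fun _ => ?_,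
        fun _ h => ?_, fun _ h => ?_⟩
      all_goals dsimp only at *
      · omega
      · omega
      · by_cases hk : ReachIn (LabEdge N lab τ) s k' u
        · rw [countReach_succ_of hk]; omega
        · rw [countReach_succ_of_not hk]; omega
      · by_cases hk : ReachIn (LabEdge N lab τ) s k' u
        · rw [countReach_succ_of hk] at h; omega
        · rw [countReach_succ_of_not hk] at h
          rw [x9 h1.le h, leadsTo_succ]
          simp [hk]
      · omega
    · refine ⟨fun h => ?_, fun h => x2 h1.le, fun _ => x3 h1.le, x4, x5, x6, x7, x8, x9,
        fun _ h => ⟨Nat.zero_le _, hw⟩⟩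
      dsimp only at *
      omega
  · -- extend the path
    obtain ⟨⟨⟨⟨⟨⟨⟨⟨hd, rfl⟩, rfl⟩, rfl⟩, rfl⟩, rfl⟩, rfl⟩, rfl⟩, rfl⟩ := h6
    refine ⟨fun h => ?_, fun h => x2 h1.le, fun _ => x3 h1.le, x4, x5, x6, x7, x8, x9,
        fun _ _ => ⟨hd, w, (x10 h1.le h5.1).2, Or.inr ⟨h5.1, h5.2, h⟩⟩⟩
    dsimp only at *
    omega
  iterate 3
    obtain ⟨⟨⟨⟨⟨⟨⟨⟨⟨⟨hw', rfl⟩, hu⟩, hv⟩, rfl⟩, rfl⟩, rfl⟩, rfl⟩, rfl⟩, rfl⟩, rfl⟩ := h7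
    have hw : ReachIn (LabEdge N lab τ) s k' w := (x10 h1.le hu).2.mono (x10 h1.le hu).1
    have hcnt := countReach_succ_of hw
    have he := x8 h1.le
    refine ⟨fun h => ?_, fun h => x2 h1.le, fun _ => x3 h1.le, x4, fun _ => hu, x6, x7, fun _ => ?_,
      fun _ h' => ?_, fun _ h' => ?_⟩
    · dsimp only at *
      omega
    · dsimp only at *
      omega
    · dsimp only at *
      rw [leadsTo_succ, ← x9 h1.le (by omega)]
      first
      | exact iff_of_true (by omega) (Or.inr ⟨hw, Or.inl h9⟩)
      | exact iff_of_true (by omega) (Or.inr ⟨hw, Or.inr ⟨hu, hv, h⟩⟩)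
      | have : ¬ LabEdge N lab τ w v' := fun h' => labTrue_flipLit.1 h h'.2.2
        simp [h10.1, h10.2, this]
    · dsimp only at *
      omega
  · refine ⟨fun _ => ?_, fun h => ?_, fun h => ?_, fun h => ?_, fun h => ?_, fun h => ?_, fun h => ?_,
      fun h => ?_, fun h => ?_, fun h => ?_⟩
    · have := x2 (by omega) (by omega)
      rwa [h11] at this
    all_goals
      dsimp only at *
      omega

end Counting
-- Completeness of the counting procedure: the honest run exists
theorem digit_zero_add_mul {b a x : ℕ} (ha : a < b) : digit b 0 (a + b * x) = a := by
  simp [digit, Nat.mod_eq_of_lt ha]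

theorem digit_succ_add_mul {b a x : ℕ} (ha : a < b) (j : ℕ) :
    digit b (j + 1) (a + b * x) = digit b j x := by
  rw [digit, digit, pow_succ', ← Nat.div_div_eq_div_mul, Nat.add_mul_div_left _ _ (by omega),
    Nat.div_eq_of_lt ha, Nat.zero_add]

theorem digit_zero_right {b j : ℕ} : digit b j 0 = 0 := by simp [digit]

theorem exists_toCount {b : ℕ} (y : Count) (hk : y.k < b) (hr : y.r < b) (hw : y.w < b)
    (hv : y.v < b) (hc : y.c < b) (hu : y.u < b) (he : y.e < b) (hf : y.f < b) (hd : y.d < b) :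
    ∃ z < b ^ 9, toCount b z = y := by
  obtain ⟨z, hz, h⟩ := exists_digits (b := b) 9
    (fun j => [y.k, y.r, y.w, y.v, y.c, y.u, y.e, y.f, y.d].getD j 0) (by
      intro j hj
      interval_cases j <;> assumption)
  refine ⟨z, hz, ?_⟩
  simp only [toCount, h 0 (by omega), h 1 (by omega), h 2 (by omega), h 3 (by omega),
    h 4 (by omega), h 5 (by omega), h 6 (by omega), h 7 (by omega), h 8 (by omega)]
  rfl

/-- The number of the initial configuration. -/
def countStart (N : ℕ) : ℕ := 0 + (N + 2) * (1 + (N + 2) * (N + (N + 2) * 0))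

theorem toCount_countStart (N : ℕ) :
    toCount (N + 2) (countStart N) = ⟨0, 1, N, 0, 0, 0, 0, 0, 0⟩ := by
  have h0 : 0 < N + 2 := by omega
  have h1 : 1 < N + 2 := by omega
  have hN : N < N + 2 := by omega
  simp only [toCount, countStart, digit_zero_add_mul h0, digit_succ_add_mul h0,
    digit_zero_add_mul h1, digit_succ_add_mul h1, digit_zero_add_mul hN, digit_succ_add_mul hN,
    digit_zero_right]

theorem countStart_lt (N : ℕ) : countStart N < (N + 2) ^ 9 := by
  have : countStart N < (N + 2) ^ 3 := by unfold countStart; nlinarith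
  exact this.trans_le (Nat.pow_le_pow_right (by omega) (by omega))

section Complete

variable (N s t : ℕ) (lab : ℕ → ℕ → ℕ) (τ : ℕ → Bool)

/-- The transitions between numbers of configurations. -/
def countLabNat (x y : ℕ) : ℕ := countLab N s t lab (toCount (N + 2) x) (toCount (N + 2) y)

/-- The configuration `y` is reached by the counting procedure. -/
def CountGot (y : Count) : Prop :=
  ∃ z, Relation.ReflTransGen (LabEdge ((N + 2) ^ 9) (countLabNat N s t lab) τ) (countStart N) z ∧
    z < (N + 2) ^ 9 ∧ toCount (N + 2) z = y

variable {N s t lab τ}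

theorem CountGot.start : CountGot N s t lab τ ⟨0, 1, N, 0, 0, 0, 0, 0, 0⟩ :=
  ⟨_, .refl, countStart_lt N, toCount_countStart N⟩

theorem CountGot.step {x : Count} (hx : CountGot N s t lab τ x) {k r w v c u e f d : ℕ}
    (hlab : LabTrue τ (countLab N s t lab x ⟨k, r, w, v, c, u, e, f, d⟩))
    (hk : k < N + 2) (hr : r < N + 2) (hw : w < N + 2)
    (hv : v < N + 2) (hc : c < N + 2) (hu : u < N + 2) (he : e < N + 2) (hf : f < N + 2)
    (hd : d < N + 2) : CountGot N s t lab τ ⟨k, r, w, v, c, u, e, f, d⟩ := by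
  obtain ⟨z, hz, hz', rfl⟩ := hx
  obtain ⟨z', hz₁, hz₂⟩ := exists_toCount ⟨k, r, w, v, c, u, e, f, d⟩ hk hr hw hv hc hu he hf hd
  refine ⟨z', hz.tail ⟨hz', hz₁, ?_⟩, hz₁, hz₂⟩
  rwa [countLabNat, hz₂]

variable (hs : s < N)
include hs

/-- `ReachIn` permits idle steps but the search does not make them, so the step counter reaches some
`d' ≤ d` rather than `d` itself. -/
theorem CountGot.path {k r v c u e f d₀ : ℕ} (hk : k < N) (hr : r ≤ N) (hv : v < N) (hc : c ≤ N)
    (hu : u < N) (he : e ≤ N) (hf : f ≤ N)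
    (h : CountGot N s t lab τ ⟨k, r, N, v, c, u, e, f, d₀⟩) {d w : ℕ} (hd : d ≤ k)
    (hw : ReachIn (LabEdge N lab τ) s d w) :
    ∃ d' ≤ d, CountGot N s t lab τ ⟨k, r, w, v, c, u, e, f, d'⟩ := by
  induction d generalizing w with
  | zero =>
    obtain rfl : w = s := hw
    refine ⟨0, le_rfl, h.step ?_ ?_ ?_ ?_ ?_ ?_ ?_ ?_ ?_ ?_⟩
    · simp [countLab, Bool.cond_eq_ite, hk, hv.ne, hu.ne, labTrue_toNat]
    all_goals omega
  | succ d ih =>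
    obtain ⟨w', hw', rfl | hE⟩ := hw
    · obtain ⟨d', hd', h'⟩ := ih (by omega) hw'
      exact ⟨d', by omega, h'⟩
    · obtain ⟨d', hd', h'⟩ := ih (by omega) hw'
      obtain ⟨h1, h2, h3⟩ := hE
      refine ⟨d' + 1, by omega, h'.step ?_ ?_ ?_ ?_ ?_ ?_ ?_ ?_ ?_ ?_⟩
      · simpa [countLab, Bool.cond_eq_ite, hk, h1.ne, h1, h2, show d' < k by omega] using h3
      all_goals omega

/-- The honest strategy for a fixed `v`: exhibit a path to each reachable `u` and record whether it
leads to `v`, skip every other `u`. The counter `e` then equals the true count, and `f` is positive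
exactly if a witness was met. -/
theorem CountGot.scan {k r v c d₀ : ℕ} (hk : k < N) (hr : r ≤ N) (hv : v < N) (hc : c ≤ N)
    (h : CountGot N s t lab τ ⟨k, r, N, v, c, 0, 0, 0, d₀⟩) {u : ℕ} (hu : u ≤ N) :
    ∃ f ≤ u, (0 < f ↔ LeadsTo (LabEdge N lab τ) s k u v) ∧ ∃ d, CountGot N s t lab τ
      ⟨k, r, N, v, c, u, countReach (LabEdge N lab τ) s k u, f, d⟩ := by
  induction u with
  | zero =>
    refine ⟨0, le_rfl, by simpa using leadsTo_zero, d₀, ?_⟩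
    rwa [countReach_zero]
  | succ u ih =>
    obtain ⟨f, hf, hf', d, h'⟩ := ih (by omega)
    have hcu := countReach_le (E := LabEdge N lab τ) (s := s) (k := k) (n := u)
    by_cases hR : ReachIn (LabEdge N lab τ) s k u
    · obtain ⟨d', hd', h''⟩ := h'.path hs hk hr hv hc hu (by omega) (by omega) le_rfl hR
      rw [countReach_succ_of hR]
      have huN : u ≠ N := by omega
      have hu' : u < N := hu
      by_cases hE : u = v ∨ LabEdge N lab τ u v
      · refine ⟨f + 1, by omega, ?_, 0, h''.step ?_ ?_ ?_ ?_ ?_ ?_ ?_ ?_ ?_ ?_⟩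
        · rw [leadsTo_succ]
          exact iff_of_true (by omega) (Or.inr ⟨hR, hE⟩)
        · by_cases huv : u = v
          · simp [countLab, Bool.cond_eq_ite, hk, huv, hv, hv.ne, labTrue_one]
          · simp [countLab, Bool.cond_eq_ite, hk, huN, huv, hv, hu']
            exact (hE.resolve_left huv).2.2
        all_goals omega
      · refine ⟨f, by omega, ?_, 0, h''.step ?_ ?_ ?_ ?_ ?_ ?_ ?_ ?_ ?_ ?_⟩
        · rw [leadsTo_succ, hf']
          exact (or_iff_left fun h => hE h.2).symm
        · push Not at hE
          simp [countLab, Bool.cond_eq_ite, hk, huN, hE.1, hv, hu']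
          rw [labTrue_flipLit]
          exact fun h => hE.2 ⟨hu', hv, h⟩
        all_goals omega
    · rw [countReach_succ_of_not hR]
      refine ⟨f, by omega, ?_, 0, h'.step ?_ ?_ ?_ ?_ ?_ ?_ ?_ ?_ ?_ ?_⟩
      · rw [leadsTo_succ, hf']
        exact (or_iff_left fun h => hR h.1).symm
      · have huN : u ≠ N := by omega
        simp [countLab, Bool.cond_eq_ite, hk, huN, hv.ne, labTrue_toNat]
      all_goals omega

/-- The procedure stops when it finds `t` reachable. The hypothesis `ht` rules this out, so the run
never blocks and all vertices `v` are treated in turn. -/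
theorem CountGot.round (ht : ∀ k, ¬ ReachIn (LabEdge N lab τ) s k t) {k : ℕ} (hk : k < N)
    (h : CountGot N s t lab τ ⟨k, countReach (LabEdge N lab τ) s k N, N, 0, 0, 0, 0, 0, 0⟩) {v : ℕ}
    (hv : v ≤ N) : CountGot N s t lab τ ⟨k, countReach (LabEdge N lab τ) s k N, N, v,
      countReach (LabEdge N lab τ) s (k + 1) v, 0, 0, 0, 0⟩ := by
  have hE : ∀ u v, LabEdge N lab τ u v → v < N := fun u v h => h.2.1
  have hr := countReach_le (E := LabEdge N lab τ) (s := s) (k := k) (n := N)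
  induction v with
  | zero => rwa [countReach_zero]
  | succ v ih =>
    have hcv := countReach_le (E := LabEdge N lab τ) (s := s) (k := k + 1) (n := v)
    obtain ⟨f, hf, hf', d, h'⟩ := (ih (by omega)).scan hs hk hr hv (by omega) le_rfl
    rw [leadsTo_iff_reachIn hs hE] at hf'
    have hc : countReach (LabEdge N lab τ) s (k + 1) (v + 1) =
        countReach (LabEdge N lab τ) s (k + 1) v + min f 1 := by
      by_cases hR : ReachIn (LabEdge N lab τ) s (k + 1) v
      · rw [countReach_succ_of hR, min_eq_right (hf'.2 hR)]
      · rw [countReach_succ_of_not hR, show f = 0 by by_contra h; exact hR (hf'.1 (by omega))]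
        simp
    rw [hc]
    refine h'.step ?_ ?_ ?_ ?_ ?_ ?_ ?_ ?_ ?_ ?_
    · have hvN : v ≠ N := by omega
      have htf : v = t → f = 0 := by
        rintro rfl
        by_contra h
        exact ht _ (hf'.1 (by omega))
      simpa [countLab, Bool.cond_eq_ite, hk, hvN, labTrue_toNat, or_iff_not_imp_left,
        eqb_false_iff, ltb_false_iff] using htf
    all_goals omega

theorem CountGot.rounds (ht : ∀ k, ¬ ReachIn (LabEdge N lab τ) s k t) {k : ℕ} (hk : k ≤ N) :
    CountGot N s t lab τ ⟨k, countReach (LabEdge N lab τ) s k N, N, 0, 0, 0, 0, 0, 0⟩ := by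
  induction k with
  | zero =>
    rw [countReach_zero_left hs]
    exact .start
  | succ k ih =>
    have h := (ih (by omega)).round hs ht hk le_rfl
    have hr := countReach_le (E := LabEdge N lab τ) (s := s) (k := k + 1) (n := N)
    refine h.step ?_ ?_ ?_ ?_ ?_ ?_ ?_ ?_ ?_ ?_
    · simp [countLab, Bool.cond_eq_ite, show k < N from hk, labTrue_toNat]
    all_goals omega

omit hs in
theorem countInv_of_reach (hs : s < N) (ht : t < N) {z : ℕ}
    (h : Relation.ReflTransGen (LabEdge ((N + 2) ^ 9) (countLabNat N s t lab) τ) (countStart N) z) :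
    CountInv N s t (LabEdge N lab τ) (toCount (N + 2) z) := by
  induction h with
  | refl =>
    rw [toCount_countStart]
    refine ⟨fun h => ?_, fun _ h => ?_, fun _ => (countReach_zero_left hs).symm,
      fun _ => Nat.zero_le _, fun _ => Nat.zero_le _, fun _ => countReach_zero.symm, fun _ h => ?_,
      fun _ => Nat.zero_le _, fun _ _ => ?_, fun _ h => ?_⟩
    all_goals dsimp only at *
    · omega
    · omega
    · omega
    · simpa using leadsTo_zero
    · omega
  | tail _ h ih => exact ih.step hs ht h.2.2

omit hs in
/-- The counting procedure succeeds if and only if the target is not reachable. -/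
theorem count_reach_iff (hs : s < N) (ht : t < N) :
    Relation.ReflTransGen (LabEdge ((N + 2) ^ 9) (countLabNat N s t lab) τ) (countStart N) (N + 1) ↔
      ¬ Relation.ReflTransGen (LabEdge N lab τ) s t := by
  have hE : ∀ u v, LabEdge N lab τ u v → v < N := fun u v h => h.2.1
  -- The target is the number `N + 1`, a single digit in base `N + 2`; it stands for the
  -- configuration with `k = N + 1`, and the last transition puts no condition on the other
  -- components.
  have h0 : digit (N + 2) 0 (N + 1) = N + 1 := by simp [digit]
  constructor
  · intro h
    rw [reflTransGen_iff_reachIn hs hE]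
    exact (countInv_of_reach hs ht h).final h0
  · intro h
    obtain ⟨z, hz, hz', hz''⟩ := CountGot.rounds (lab := lab) (t := t) (τ := τ) hs
      (fun k hk => h hk.reflTransGen) le_rfl
    refine hz.tail ⟨hz', ?_, ?_⟩
    · exact lt_of_lt_of_le (show N + 1 < (N + 2) ^ 1 by simp)
        (Nat.pow_le_pow_right (by omega) (by omega))
    · rw [countLabNat, hz'']
      simp [countLab, Bool.cond_eq_ite, toCount, h0, labTrue_toNat]

end Complete

/-- The counting procedure consults `τ` only by asking whether an original edge is present or
absent. Hence the labels of the complement are literals over the same set, and the parameter does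
not grow. -/
theorem countLab_cases (N s t : ℕ) (lab : ℕ → ℕ → ℕ) (x y : Count) :
    countLab N s t lab x y ≤ 1 ∨ ∃ u v, countLab N s t lab x y = lab u v ∨
      countLab N s t lab x y = flipLit (lab u v) := by
  have hb : ∀ b : Bool, b.toNat ≤ 1 := Bool.toNat_le
  simp only [countLab, Bool.cond_eq_ite]
  split_ifs
  all_goals first
    | exact Or.inl (hb _)
    | exact Or.inl (by omega)
    | exact Or.inr ⟨_, _, Or.inl rfl⟩
    | exact Or.inr ⟨_, _, Or.inr rfl⟩

/-- The branching program for the complement of reachability. -/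
def PGraph.compl (G : PGraph) : PGraph where
  N w := (G.N w + 2) ^ 9
  s w := countStart (G.N w)
  t w := G.N w + 1
  lab w := countLabNat (G.N w) (G.s w) (G.t w) (G.lab w)
  ptN := by fun_prop
  pts := by unfold countStart; fun_prop
  ptt := by fun_prop
  ptlab := by
    unfold countLabNat toCount countLab
    dsimp only
    fun_prop
  s_lt w := countStart_lt _
  t_lt w := lt_of_lt_of_le (show G.N w + 1 < (G.N w + 2) ^ 1 by simp)
    (Nat.pow_le_pow_right (by omega) (by omega))
  lab_mem w x y h := by
    rcases countLab_cases (G.N w) (G.s w) (G.t w) (G.lab w) (toCount (G.N w + 2) x)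
      (toCount (G.N w + 2) y) with h1 | ⟨u, v, h1 | h1⟩
    · exact absurd h (by simp only [countLabNat]; omega)
    · simp only [countLabNat, h1] at h ⊢
      exact G.lab_mem w u v h
    · simp only [countLabNat, h1] at h ⊢
      obtain ⟨a, ha⟩ : ∃ a, G.lab w u v = a + 2 := by
        refine ⟨G.lab w u v - 2, ?_⟩
        by_contra h2
        have : G.lab w u v = 0 ∨ G.lab w u v = 1 := by omega
        rcases this with h3 | h3 <;> simp [h3, flipLit_eq] at h
      have h4 := G.lab_mem w u v (by omega)
      rw [ha] at h4 ⊢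
      rw [flipLit_add_two, Nat.add_sub_cancel, flipLit_div]
      simpa using h4

theorem PGraph.reach_compl (G : PGraph) (w : List ℕ) (τ : ℕ → Bool) :
    G.compl.Reach w τ ↔ ¬ G.Reach w τ :=
  count_reach_iff (G.s_lt w) (G.t_lt w)

/-! ## From 2-SAT backdoors to branching programs -/

open Relation in
/-- A system of implications between literals that is closed under contraposition and has no
contradictory cycle has a model. -/
theorem exists_model_of_no_cycle {free : ℕ → Prop} {K : ℕ} (hK : ∀ a, free a → a < K)
    (hflip : ∀ a, free a → free (flipLit a)) {I : ℕ → ℕ → Prop} (hI : ∀ a b, I a b → free b)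
    (hskew : ∀ a b, free a → I a b → I (flipLit b) (flipLit a))
    (hcycle : ∀ a, free a → ReflTransGen I a (flipLit a) → ¬ ReflTransGen I (flipLit a) a) :
    ∃ S : Set ℕ, (∀ a, free a → (a ∈ S ↔ flipLit a ∉ S)) ∧ ∀ a b, a ∈ S → I a b → b ∈ S := by
  classical
  have hfree : ∀ {a b}, free a → ReflTransGen I a b → free b := by
    intro a b ha h
    induction h with
    | refl => exact ha
    | tail _ h _ => exact hI _ _ h
  have hskew' : ∀ {a b}, free a → ReflTransGen I a b →
      ReflTransGen I (flipLit b) (flipLit a) := by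
    intro a b ha h
    induction h with
    | refl => exact .refl
    | tail h h' ih => exact .head (hskew _ _ (hfree ha h) h') ih
  let good : Set (Finset ℕ) := {S | (∀ a ∈ S, free a) ∧ (∀ a ∈ S, flipLit a ∉ S) ∧
    ∀ a b, a ∈ S → I a b → b ∈ S}
  have hfin : good.Finite := by
    refine ((Finset.range K).powerset.finite_toSet).subset fun S hS => ?_
    simp only [Finset.coe_powerset, Set.mem_preimage, Set.mem_powerset_iff, Finset.coe_subset]
    exact fun a ha => Finset.mem_range.2 (hK a (hS.1 a ha))
  obtain ⟨S, hS, hmax⟩ := hfin.exists_maximal ⟨∅, by simp [good]⟩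
  have hclosed : ∀ {a b}, a ∈ S → ReflTransGen I a b → b ∈ S := by
    intro a b ha h
    induction h with
    | refl => exact ha
    | tail _ h' ih => exact hS.2.2 _ _ ih h'
  -- If `x` does not imply `¬x`, then `S` together with all consequences of `x` is again closed and
  -- consistent, by contraposition, against maximality. If both `x` and `¬x` were undecided, this
  -- would apply to each and yield a contradictory cycle.
  have key : ∀ x, free x → x ∉ S → flipLit x ∉ S → ReflTransGen I x (flipLit x) := by
    intro x hx hxS hxS'
    by_contra hno
    let S' : Finset ℕ := S ∪ (Finset.range K).filter (ReflTransGen I x)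
    have hmem : ∀ a, a ∈ S' ↔ a ∈ S ∨ ReflTransGen I x a := by
      intro a
      simp only [S', Finset.mem_union, Finset.mem_filter, Finset.mem_range]
      exact or_congr_right ⟨fun h => h.2, fun h => ⟨hK a (hfree hx h), h⟩⟩
    have hS' : S' ∈ good := by
      refine ⟨fun a ha => ?_, fun a ha ha' => ?_, fun a b ha hab => ?_⟩
      · rcases (hmem a).1 ha with h | h
        exacts [hS.1 a h, hfree hx h]
      · rcases (hmem a).1 ha with h | h <;> rcases (hmem _).1 ha' with h' | h'
        · exact hS.2.1 a h h'
        · have := hskew' hx h'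
          rw [flipLit_flipLit] at this
          exact hxS' (hclosed h this)
        · exact hxS' (hclosed h' (hskew' hx h))
        · have := hskew' hx h'
          rw [flipLit_flipLit] at this
          exact hno (h.trans this)
      · rw [hmem] at ha ⊢
        exact ha.imp (fun h => hS.2.2 a b h hab) fun h => h.tail hab
    exact hxS (hmax hS' (fun a ha => (hmem a).2 (Or.inl ha)) ((hmem x).2 (Or.inr .refl)))
  refine ⟨S, fun a ha => ⟨fun h => hS.2.1 a h, fun h => ?_⟩, hS.2.2⟩
  by_contra h'
  have h1 := key a ha h' h
  have h2 := key (flipLit a) (hflip a ha) h (by rwa [flipLit_flipLit])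
  rw [flipLit_flipLit] at h2
  exact hcycle a ha h1 h2

/-- The literals over the variables outside the encoded set and one additional variable. -/
def freeLit (w : List ℕ) (a : ℕ) : Bool := ltb a (2 * (numVars w + 1)) && !(inSet w (a / 2))

@[fun_prop] theorem PT.freeLit {α : Type} [Ctx α] {w : α → List ℕ} {f : α → ℕ} (hw : PT w)
    (hf : PT f) : PT (fun a => freeLit (w a) (f a)) := by
  unfold SatHyp.freeLit; fun_prop

/-- Literal `q` of clause `j` is falsified by `τ` or is one of the literals `¬ y` and `b`. -/
def ClauseOk (w : List ℕ) (τ : ℕ → Bool) (y b j q : ℕ) : Prop :=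
  if inSet w (clauseLit w j q / 2) = true then ¬ LitTrue τ (clauseLit w j q)
  else clauseLit w j q = flipLit y ∨ clauseLit w j q = b

/-- Some clause says, under the assignment `τ` to the encoded set, that `y` implies `b`. -/
def Implies (w : List ℕ) (τ : ℕ → Bool) (y b : ℕ) : Prop :=
  freeLit w b = true ∧ ∃ j < numClauses w, ∀ q < clauseLen w j, ClauseOk w τ y b j q

/-- A configuration of the search for a contradictory cycle through the literal `x`: in the first
phase a path from `x` to `¬ x` is searched, in the second a path back. The path has reached the
literal `y`, and the first `q` literals of clause `j` have been checked for the implication from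
`y` to `b`. -/
structure Cycle where
  ph : ℕ
  x : ℕ
  y : ℕ
  j : ℕ
  q : ℕ
  b : ℕ

/-- The configuration with the number `z`. -/
def toCycle (b z : ℕ) : Cycle :=
  ⟨digit b 0 z, digit b 1 z, digit b 2 z, digit b 3 z, digit b 4 z, digit b 5 z⟩

/-- The label of a transition in the search for a contradictory cycle. -/
def cycleLab (w : List ℕ) (x y : Cycle) : ℕ :=
  bif eqb x.ph 0 then
    (eqb y.ph 1 && freeLit w y.x && eqb y.y y.x && eqb y.j (numClauses w)).toNat
  else bif ltb x.ph 3 then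
    bif eqb x.j (numClauses w) then
      bif eqb y.ph 3 then (eqb x.ph 2 && eqb x.y x.x).toNat
      else (eqb y.x x.x && eqb y.y x.y &&
        ((eqb y.ph x.ph && ltb y.j (numClauses w) && eqb y.q 0 && freeLit w y.b) ||
          (eqb x.ph 1 && eqb y.ph 2 && eqb y.j (numClauses w) && eqb x.y (flipLit x.x)))).toNat
    else bif ltb x.j (numClauses w) && eqb y.ph x.ph && eqb y.x x.x then
      bif ltb x.q (clauseLen w x.j) then
        bif eqb y.y x.y && eqb y.j x.j && eqb y.b x.b && eqb y.q (x.q + 1) then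
          bif inSet w (clauseLit w x.j x.q / 2) then flipLit (clauseLit w x.j x.q) + 2
          else (eqb (clauseLit w x.j x.q) (flipLit x.y) || eqb (clauseLit w x.j x.q) x.b).toNat
        else 0
      else (eqb y.y x.b && eqb y.j (numClauses w)).toNat
    else 0
  else 0

/-- The base of the numbering of configurations. -/
def cycleBase (w : List ℕ) : ℕ := 2 * total w + 5

theorem not_two_le_toNat (b : Bool) : ¬ 2 ≤ b.toNat := by
  have := b.toNat_le
  omega

/-- The branching program that searches for a contradictory cycle. -/
def cycleGraph : PGraph where
  N w := cycleBase w ^ 6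
  s _ := 0
  t _ := 3
  lab w x y := cycleLab w (toCycle (cycleBase w) x) (toCycle (cycleBase w) y)
  ptN := by unfold cycleBase; fun_prop
  pts := by fun_prop
  ptt := by fun_prop
  ptlab := by
    unfold cycleLab toCycle cycleBase
    dsimp only
    fun_prop
  s_lt w := Nat.pow_pos (by unfold cycleBase; omega)
  t_lt w := lt_of_lt_of_le (show 3 < cycleBase w ^ 1 by rw [pow_one]; unfold cycleBase; omega)
    (Nat.pow_le_pow_right (by unfold cycleBase; omega) (by omega))
  lab_mem w x y h := by
    generalize toCycle (cycleBase w) x = x at *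
    generalize toCycle (cycleBase w) y = y at *
    simp only [cycleLab, Bool.cond_eq_ite] at h ⊢
    split_ifs at h ⊢ with h1 h2 h3 h4 h5 h6 h7 h8
    all_goals first
      | exact absurd h (not_two_le_toNat _)
      | exact absurd h (by omega)
      | (rw [Nat.add_sub_cancel, flipLit_div]; exact h8)

/-! ### Correctness of the search for a contradictory cycle -/

section Cycle

open Relation

variable {w : List ℕ} {τ : ℕ → Bool}

theorem freeLit_flipLit {a : ℕ} (h : freeLit w a = true) : freeLit w (flipLit a) = true := by
  simp only [freeLit, Bool.and_eq_true, ltb_iff, Bool.not_eq_true'] at h ⊢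
  rw [flipLit_div]
  exact ⟨flipLit_lt h.1, h.2⟩

theorem freeLit_lt {a : ℕ} (h : freeLit w a = true) : a < cycleBase w := by
  simp only [freeLit, Bool.and_eq_true, ltb_iff] at h
  have : numVars w ≤ total w := cell_le_total w 0
  unfold cycleBase
  omega

/-- The clause `¬y ∨ b` is symmetric in its two literals: the clause that witnesses the implication
also witnesses its contrapositive. -/
theorem Implies.skew {y b : ℕ} (hy : freeLit w y = true) (h : Implies w τ y b) :
    Implies w τ (flipLit b) (flipLit y) := by
  obtain ⟨_, j, hj, h⟩ := h
  refine ⟨freeLit_flipLit hy, j, hj, fun q hq => ?_⟩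
  have := h q hq
  unfold ClauseOk at this ⊢
  rw [flipLit_flipLit]
  split_ifs at this ⊢
  exacts [this, this.symm]

/-- The invariant of the search for a contradictory cycle. -/
structure CycleInv (w : List ℕ) (τ : ℕ → Bool) (x : Cycle) : Prop where
  one : x.ph = 1 → freeLit w x.x = true ∧ freeLit w x.y = true ∧
    ReflTransGen (Implies w τ) x.x x.y
  two : x.ph = 2 → freeLit w x.x = true ∧ freeLit w x.y = true ∧
    ReflTransGen (Implies w τ) x.x (flipLit x.x) ∧ ReflTransGen (Implies w τ) (flipLit x.x) x.y
  three : x.ph = 3 → ∃ a, freeLit w a = true ∧ ReflTransGen (Implies w τ) a (flipLit a) ∧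
    ReflTransGen (Implies w τ) (flipLit a) a
  scan : 0 < x.ph → x.ph < 3 → x.j < numClauses w → freeLit w x.b = true ∧
    ∀ q < x.q, q < clauseLen w x.j → ClauseOk w τ x.y x.b x.j q

theorem CycleInv.step {x y : Cycle} (hx : CycleInv w τ x) (h : LabTrue τ (cycleLab w x y)) :
    CycleInv w τ y := by
  obtain ⟨ph, x, z, j, q, b⟩ := x
  obtain ⟨ph', x', z', j', q', b'⟩ := y
  obtain ⟨x1, x2, x3, x4⟩ := hx
  simp only [cycleLab, Bool.cond_eq_ite] at h x1 x2 x3 x4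
  split_ifs at h with h1 h2 h3 h4 h5 h6 h7 h8
  all_goals simp only [labTrue_toNat, not_labTrue_zero, Bool.and_eq_true, Bool.or_eq_true, eqb_iff,
    ltb_iff] at *
  · obtain ⟨⟨⟨rfl, hf⟩, rfl⟩, rfl⟩ := h
    refine ⟨fun _ => ⟨hf, hf, .refl⟩, fun h => ?_, fun h => ?_, fun _ _ h => ?_⟩
    all_goals
      dsimp only at h
      omega
  · obtain ⟨rfl, rfl⟩ := h
    subst h4
    have := x2 rfl
    refine ⟨fun h => ?_, fun h => ?_, fun _ => ⟨_, this.1, this.2.2⟩, fun _ h _ => ?_⟩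
    all_goals
      dsimp only at h
      omega
  · obtain ⟨⟨rfl, rfl⟩, ⟨⟨⟨rfl, hj⟩, rfl⟩, hb⟩ | ⟨⟨⟨rfl, rfl⟩, hj⟩, rfl⟩⟩ := h
    · refine ⟨x1, x2, x3, fun _ _ _ => ⟨hb, fun q hq => ?_⟩⟩
      dsimp only at hq
      omega
    · have := x1 rfl
      refine ⟨fun h => ?_, fun _ => ⟨this.1, this.2.1, this.2.2, .refl⟩, fun h => ?_,
        fun _ _ h => ?_⟩
      all_goals
        dsimp only at h
        omega
  · obtain ⟨⟨hj, rfl⟩, rfl⟩ := h5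
    obtain ⟨⟨⟨rfl, rfl⟩, rfl⟩, rfl⟩ := h7
    rw [labTrue_add_two, litTrue_flipLit] at h
    refine ⟨x1, x2, x3, fun hp hp' hj => ⟨(x4 hp hp' hj).1, fun q' hq hq' => ?_⟩⟩
    rcases Nat.lt_succ_iff_lt_or_eq.1 hq with hq | rfl
    · exact (x4 hp hp' hj).2 q' hq hq'
    · simpa only [ClauseOk, h8, if_true] using h
  · obtain ⟨⟨hj, rfl⟩, rfl⟩ := h5
    obtain ⟨⟨⟨rfl, rfl⟩, rfl⟩, rfl⟩ := h7
    refine ⟨x1, x2, x3, fun hp hp' hj => ⟨(x4 hp hp' hj).1, fun q' hq hq' => ?_⟩⟩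
    rcases Nat.lt_succ_iff_lt_or_eq.1 hq with hq | rfl
    · exact (x4 hp hp' hj).2 q' hq hq'
    · simpa [ClauseOk, h8] using h
  · obtain ⟨⟨hj, rfl⟩, rfl⟩ := h5
    obtain ⟨rfl, rfl⟩ := h
    have h9 := x4 (by omega) h2 hj
    have himp : Implies w τ z z' := ⟨h9.1, j, hj, fun q hq => h9.2 q (by omega) hq⟩
    refine ⟨fun h => ⟨(x1 h).1, h9.1, (x1 h).2.2.tail himp⟩,
      fun h => ⟨(x2 h).1, h9.1, (x2 h).2.2.1, (x2 h).2.2.2.tail himp⟩, fun h => ?_,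
      fun _ _ h => ?_⟩
    all_goals
      dsimp only at h
      omega

theorem exists_toCycle {b : ℕ} (y : Cycle) (hp : y.ph < b) (hx : y.x < b) (hy : y.y < b)
    (hj : y.j < b) (hq : y.q < b) (hb : y.b < b) : ∃ z < b ^ 6, toCycle b z = y := by
  obtain ⟨z, hz, h⟩ := exists_digits (b := b) 6
    (fun j => [y.ph, y.x, y.y, y.j, y.q, y.b].getD j 0) (by
      intro j hj
      interval_cases j <;> assumption)
  refine ⟨z, hz, ?_⟩
  simp only [toCycle, h 0 (by omega), h 1 (by omega), h 2 (by omega), h 3 (by omega),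
    h 4 (by omega), h 5 (by omega)]
  rfl

/-- The configuration `y` is reached by the search. -/
def CycleGot (w : List ℕ) (τ : ℕ → Bool) (y : Cycle) : Prop :=
  ∃ z, ReflTransGen (LabEdge (cycleGraph.N w) (cycleGraph.lab w) τ) 0 z ∧
    z < cycleBase w ^ 6 ∧ toCycle (cycleBase w) z = y

theorem CycleGot.step {x : Cycle} (h : CycleGot w τ x) {ph x' y j q b : ℕ}
    (hlab : LabTrue τ (cycleLab w x ⟨ph, x', y, j, q, b⟩)) (hp : ph < 4)
    (hx : freeLit w x' = true) (hy : freeLit w y = true) (hj : j ≤ numClauses w)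
    (hq : q ≤ clauseLen w j) (hb : freeLit w b = true) :
    CycleGot w τ ⟨ph, x', y, j, q, b⟩ := by
  obtain ⟨z, hz, hz', rfl⟩ := h
  have h1 : numClauses w ≤ total w := cell_le_total w 1
  have h2 : clauseLen w j ≤ total w := cell_le_total w _
  obtain ⟨z', hz₁, hz₂⟩ := exists_toCycle (b := cycleBase w) ⟨ph, x', y, j, q, b⟩
    (by simp only [cycleBase]; omega) (freeLit_lt hx) (freeLit_lt hy)
    (by simp only [cycleBase]; omega) (by simp only [cycleBase]; omega) (freeLit_lt hb)
  refine ⟨z', hz.tail ⟨hz', hz₁, ?_⟩, hz₁, hz₂⟩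
  simpa only [cycleGraph, hz₂] using hlab

/-- Each implication is replayed by scanning the literals of a clause that witnesses it. A literal
over the encoded set gives an edge labelled with its negation, the remaining literals are compared
with `¬y` and `b`. -/
theorem CycleGot.walk {ph x y b : ℕ} (hp : 0 < ph) (hp' : ph < 3) (hx : freeLit w x = true)
    (hy : freeLit w y = true)
    (h : ∃ q b', CycleGot w τ ⟨ph, x, y, numClauses w, q, b'⟩)
    (hw : ReflTransGen (Implies w τ) y b) :
    freeLit w b = true ∧ ∃ q b', CycleGot w τ ⟨ph, x, b, numClauses w, q, b'⟩ := by
  induction hw with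
  | refl => exact ⟨hy, h⟩
  | @tail y b _ hyb ih =>
    obtain ⟨hyf, q₀, b₀, ih⟩ := ih
    obtain ⟨hb, j, hj, hclause⟩ := hyb
    have hp0 : ph ≠ 0 := by omega
    have hp3 : ph ≠ 3 := by omega
    have hscan : ∀ q ≤ clauseLen w j, CycleGot w τ ⟨ph, x, y, j, q, b⟩ := by
      intro q
      induction q with
      | zero =>
        intro _
        refine ih.step ?_ (by omega) hx hyf hj.le (Nat.zero_le _) hb
        simp [cycleLab, Bool.cond_eq_ite, hp0, hp3, hp', labTrue_toNat, hj, hb]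
      | succ q ih' =>
        intro hq
        refine (ih' (by omega)).step ?_ (by omega) hx hyf hj.le hq hb
        have := hclause q hq
        have hq' : q < clauseLen w j := hq
        unfold ClauseOk at this
        by_cases hin : inSet w (clauseLit w j q / 2) = true
        · rw [if_pos hin] at this
          simp [cycleLab, Bool.cond_eq_ite, hp0, hp', hj, hj.ne, hq', hin, labTrue_add_two,
            litTrue_flipLit, this]
        · rw [if_neg hin] at this
          simp [cycleLab, Bool.cond_eq_ite, hp0, hp', hj, hj.ne, hq', hin, labTrue_toNat, this]
    refine ⟨hb, 0, b, (hscan _ le_rfl).step ?_ (by omega) hx hb le_rfl (Nat.zero_le _) hb⟩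
    simp [cycleLab, Bool.cond_eq_ite, hp0, hp', hj, hj.ne, labTrue_toNat]

/-- The search succeeds if and only if there is a contradictory cycle. -/
theorem cycleGraph_reach_iff : cycleGraph.Reach w τ ↔ ∃ a, freeLit w a = true ∧
    ReflTransGen (Implies w τ) a (flipLit a) ∧ ReflTransGen (Implies w τ) (flipLit a) a := by
  have hbase : 3 < cycleBase w := by unfold cycleBase; omega
  have h0 : toCycle (cycleBase w) 0 = ⟨0, 0, 0, 0, 0, 0⟩ := by simp [toCycle, digit_zero_right]
  -- The base exceeds `3`, so the target number `3` has phase digit `3`; a transition into phase `3`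
  -- ignores the other components of its end.
  have h3 : (toCycle (cycleBase w) 3).ph = 3 := by simp [toCycle, digit, Nat.mod_eq_of_lt hbase]
  constructor
  · intro h
    have : ∀ z, ReflTransGen (LabEdge (cycleGraph.N w) (cycleGraph.lab w) τ) 0 z →
        CycleInv w τ (toCycle (cycleBase w) z) := by
      intro z hz
      induction hz with
      | refl =>
        rw [h0]
        refine ⟨fun h => ?_, fun h => ?_, fun h => ?_, fun h => ?_⟩
        all_goals
          dsimp only at h
          omega
      | tail _ h ih => exact ih.step h.2.2
    exact (this _ h).three h3
  · rintro ⟨a, ha, h1, h2⟩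
    have hstart : CycleGot w τ ⟨0, 0, 0, 0, 0, 0⟩ :=
      ⟨0, .refl, Nat.pow_pos (by omega), h0⟩
    have hone : CycleGot w τ ⟨1, a, a, numClauses w, 0, a⟩ := by
      refine hstart.step ?_ (by omega) ha ha le_rfl (Nat.zero_le _) ha
      simp [cycleLab, Bool.cond_eq_ite, labTrue_toNat, ha]
    obtain ⟨hf, q, b, hone'⟩ := CycleGot.walk (by omega) (by omega) ha ha ⟨_, _, hone⟩ h1
    have htwo : CycleGot w τ ⟨2, a, flipLit a, numClauses w, 0, a⟩ := by
      refine hone'.step ?_ (by omega) ha hf le_rfl (Nat.zero_le _) ha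
      simp [cycleLab, Bool.cond_eq_ite, labTrue_toNat]
    obtain ⟨-, q', b', z, hz, hz', hz''⟩ :=
      CycleGot.walk (by omega) (by omega) ha hf ⟨_, _, htwo⟩ h2
    refine hz.tail ⟨hz', cycleGraph.t_lt w, ?_⟩
    simp only [cycleGraph, hz'']
    simp [cycleLab, Bool.cond_eq_ite, labTrue_toNat, h3]

end Cycle

/-- Under an assignment to a strong 2-SAT backdoor, a clause all of whose backdoor literals are
false has at most two other literals. -/
theorem IsStrong2SatBackdoor.exists_pair {n : ℕ} {φ : CNF n} {B : Finset (Fin n)}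
    (hB : IsStrong2SatBackdoor φ B) {τ : Fin n → Bool} {C : Clause n} (hC : C ∈ φ)
    (hfalse : ∀ l ∈ C, l.1 ∈ B → ¬ Literal.Holds τ l) :
    (∀ l ∈ C, l.1 ∈ B) ∨ ∃ a ∈ C, ∃ b ∈ C, a.1 ∉ B ∧ b.1 ∉ B ∧
      ∀ l ∈ C, l.1 ∉ B → l = a ∨ l = b := by
  have h := hB τ (C.filter fun l => decide (l.1 ∉ B)) (by
    simp only [CNF.restrict, List.mem_map, List.mem_filter]
    refine ⟨C, ⟨hC, ?_⟩, rfl⟩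
    simp only [decide_eq_true_eq]
    exact fun l hl h => hfalse l hl h.1 h.2)
  set R := (C.filter fun l => decide (l.1 ∉ B)).toFinset with hR
  have hmem : ∀ l, l ∈ R ↔ l ∈ C ∧ l.1 ∉ B := by
    intro l
    simp [hR]
  rcases Finset.eq_empty_or_nonempty R with h0 | ⟨a, ha⟩
  · left
    intro l hl
    by_contra hlB
    have := (hmem l).2 ⟨hl, hlB⟩
    rw [h0] at this
    simp at this
  · right
    by_cases h1 : ∃ b ∈ R, b ≠ a
    · obtain ⟨b, hb, hba⟩ := h1
      refine ⟨a, ((hmem a).1 ha).1, b, ((hmem b).1 hb).1, ((hmem a).1 ha).2, ((hmem b).1 hb).2,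
        fun l hl hlB => ?_⟩
      by_contra! hne
      have h3 : ({l, a, b} : Finset _) ⊆ R := by
        intro x hx
        simp only [Finset.mem_insert, Finset.mem_singleton] at hx
        rcases hx with rfl | rfl | rfl
        exacts [(hmem _).2 ⟨hl, hlB⟩, ha, hb]
      have h4 := Finset.card_le_card h3
      rw [Finset.card_eq_three.2 ⟨l, a, b, hne.1, hne.2, hba.symm, rfl⟩] at h4
      omega
    · push Not at h1
      exact ⟨a, ((hmem a).1 ha).1, a, ((hmem a).1 ha).1, ((hmem a).1 ha).2, ((hmem a).1 ha).2,
        fun l hl hlB => Or.inl (h1 l ((hmem l).2 ⟨hl, hlB⟩))⟩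

/-- A formula with a strong 2-SAT backdoor is satisfiable if and only if some assignment admits no
contradictory cycle. -/
theorem satisfiable_iff_not_cycle {w : List ℕ} {n : ℕ} {φ : CNF n} {B : Finset (Fin n)}
    (hw : Encodes w φ B) (hB : IsStrong2SatBackdoor φ B) :
    φ.Satisfiable ↔ ∃ τ, ¬ cycleGraph.Reach w τ := by
  simp only [cycleGraph_reach_iff]
  constructor
  · rw [CNF.satisfiable_iff_nat]
    rintro ⟨τ, hτ⟩
    refine ⟨τ, ?_⟩
    rintro ⟨a, -, h1, h2⟩
    have himp : ∀ {y b}, Relation.ReflTransGen (Implies w τ) y b → LitTrue τ y → LitTrue τ b := by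
      intro y b h hy
      induction h with
      | refl => exact hy
      | @tail y b _ hyb ih =>
        obtain ⟨-, j, hj, hok⟩ := hyb
        rw [hw.nc] at hj
        obtain ⟨q, hq, htrue⟩ := (hw.exists_mem_iff hj).1 (hτ _ (List.getElem_mem hj))
        have := hok q hq
        unfold ClauseOk at this
        split_ifs at this
        · exact absurd htrue this
        · rcases this with h | h
          · rw [h, litTrue_flipLit] at htrue
            exact absurd ih htrue
          · rwa [h] at htrue
    by_cases ha : LitTrue τ a
    · exact litTrue_flipLit.1 (himp h1 ha) ha
    · exact ha (himp h2 (litTrue_flipLit.2 ha))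
  · rintro ⟨τ, hτ⟩
    push Not at hτ
    obtain ⟨S, hS, hclosed⟩ := exists_model_of_no_cycle (free := fun a => freeLit w a = true)
      (fun a => freeLit_lt) (fun a => freeLit_flipLit) (I := Implies w τ) (fun a b h => h.1)
      (fun a b ha h => h.skew ha) hτ
    classical
    -- The model follows `τ` on the backdoor and the consistent set `S` of literals elsewhere; `2 *
    -- v + 1` is the code of the positive literal.
    let σ : Fin n → Bool := fun v => if v ∈ B then τ v.val else decide (2 * v.val + 1 ∈ S)
    have hfreeB : ∀ l : Literal n, l.1 ∉ B → freeLit w (litCode l) = true := by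
      intro l hl
      have h1 := litCode_lt l
      simp only [freeLit, Bool.and_eq_true, ltb_iff, Bool.not_eq_true', hw.nv]
      refine ⟨by omega, ?_⟩
      rw [Bool.eq_false_iff, litCode_div, ne_eq, hw.inSet_val_iff]
      exact hl
    have hσS : ∀ l : Literal n, l.1 ∉ B → (Literal.Holds σ l ↔ litCode l ∈ S) := by
      intro l hl
      have h1 := hS _ (hfreeB l hl)
      obtain ⟨v, s⟩ := l
      simp only [Literal.Holds, σ, hl, if_false]
      cases s
      · have h2 : flipLit (litCode (v, false)) = 2 * v.val + 1 := by
          simp [litCode, flipLit_eq]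
        rw [h1, h2]
        simp
      · simp [litCode]
    refine ⟨σ, fun C hC => ?_⟩
    by_contra! hno
    obtain ⟨j, hj, rfl⟩ := List.mem_iff_getElem.1 hC
    have hj' : j < numClauses w := by rwa [hw.nc]
    have hfalse : ∀ l ∈ φ[j], l.1 ∈ B → ¬ LitTrue τ (litCode l) := by
      intro l hl hlB h
      refine hno l hl ?_
      rw [litTrue_litCode] at h
      simpa [Literal.Holds, σ, hlB] using h
    have himp : ∀ y b, freeLit w b = true →
        (∀ l ∈ φ[j], l.1 ∉ B → litCode l = flipLit y ∨ litCode l = b) → Implies w τ y b := by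
      intro y b hb h
      refine ⟨hb, j, hj', ?_⟩
      refine (hw.forall_mem_iff hj (p := fun a => if inSet w (a / 2) = true then ¬ LitTrue τ a
        else a = flipLit y ∨ a = b)).1 fun l hl => ?_
      simp only [litCode_div, hw.inSet_val_iff]
      split_ifs with hlB
      exacts [hfalse l hl hlB, h l hl hlB]
    rcases hB.exists_pair (τ := fun v => τ v.val) hC
      (fun l hl hlB => by rw [← litTrue_litCode]; exact hfalse l hl hlB) with
      hall | ⟨a, ha, b, hb, haB, hbB, hab⟩
    · have hd : freeLit w (2 * n) = true := by
        simp only [freeLit, Bool.and_eq_true, ltb_iff, Bool.not_eq_true', hw.nv]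
        refine ⟨by omega, ?_⟩
        rw [Bool.eq_false_iff, ne_eq, hw.inSet_iff]
        rintro ⟨x, -, hx⟩
        have := x.isLt
        omega
      have hd' := freeLit_flipLit hd
      have h1 := hS _ hd
      by_cases hmem : 2 * n ∈ S
      · exact h1.1 hmem (hclosed _ _ hmem (himp _ _ hd' fun l hl h => absurd (hall l hl) h))
      · have h2 : flipLit (2 * n) ∈ S := by
          by_contra h
          exact hmem (h1.2 h)
        exact hmem (hclosed _ _ h2 (himp _ _ hd fun l hl h => absurd (hall l hl) h))
    · have h1 : litCode a ∉ S := fun h => hno a ha ((hσS a haB).2 h)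
      have h2 : litCode b ∉ S := fun h => hno b hb ((hσS b hbB).2 h)
      have h3 : flipLit (litCode a) ∈ S := by
        by_contra h
        exact h1 ((hS _ (hfreeB a haB)).2 h)
      refine h2 (hclosed _ _ h3 (himp _ _ (hfreeB b hbB) fun l hl hlB => ?_))
      rw [flipLit_flipLit]
      rcases hab l hl hlB with rfl | rfl
      exacts [Or.inl rfl, Or.inr rfl]

/-! ## From path decompositions to branching programs -/

/-- The variable `v` belongs to bag `i`. -/
def inBag (w : List ℕ) (i v : ℕ) : Bool := exLt (bagLen w i) fun q => eqb (bagElem w i q) v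

/-- The number `s` without its last `q` binary digits. -/
def shiftBits (s q : ℕ) : ℕ := iterLt q s (fun y => y / 2) s

/-- The binary digit `q` of `s`. -/
def bitAt (s q : ℕ) : Bool := eqb (shiftBits s q % 2) 1

/-- The value of the variable `v` in the assignment to bag `i` that is described by the binary
digits of `s`. -/
def bagVal (w : List ℕ) (i s v : ℕ) : Bool :=
  exLt (bagLen w i) fun q => eqb (bagElem w i q) v && bitAt s q

/-- The assignments `s` and `s'` to the bags `i` and `i + 1` agree on the common variables. -/
def consistent (w : List ℕ) (i s s' : ℕ) : Bool :=
  allLt (bagLen w i) fun q => !(inBag w (i + 1) (bagElem w i q)) ||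
    eqb (bagVal w i s (bagElem w i q)).toNat (bagVal w (i + 1) s' (bagElem w i q)).toNat

/-- The variables of clause `j` belong to the encoded set or to bag `i`. -/
def contained (w : List ℕ) (i j : ℕ) : Bool :=
  allLt (clauseLen w j) fun q => inSet w (clauseLit w j q / 2) || inBag w i (clauseLit w j q / 2)

section

variable {α : Type} [Ctx α]

@[fun_prop] theorem PT.inBag {w : α → List ℕ} {i v : α → ℕ} (hw : PT w) (hi : PT i) (hv : PT v) :
    PT (fun a => inBag (w a) (i a) (v a)) := by
  unfold SatHyp.inBag; fun_prop

@[fun_prop] theorem PT.shiftBits {s q : α → ℕ} (hs : PT s) (hq : PT q) :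
    PT (fun a => shiftBits (s a) (q a)) := by
  unfold SatHyp.shiftBits; fun_prop

@[fun_prop] theorem PT.bitAt {s q : α → ℕ} (hs : PT s) (hq : PT q) :
    PT (fun a => bitAt (s a) (q a)) := by
  unfold SatHyp.bitAt; fun_prop

@[fun_prop] theorem PT.bagVal {w : α → List ℕ} {i s v : α → ℕ} (hw : PT w) (hi : PT i)
    (hs : PT s) (hv : PT v) : PT (fun a => bagVal (w a) (i a) (s a) (v a)) := by
  unfold SatHyp.bagVal; fun_prop

@[fun_prop] theorem PT.consistent {w : α → List ℕ} {i s s' : α → ℕ} (hw : PT w) (hi : PT i)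
    (hs : PT s) (hs' : PT s') : PT (fun a => consistent (w a) (i a) (s a) (s' a)) := by
  unfold SatHyp.consistent; fun_prop

@[fun_prop] theorem PT.contained {w : α → List ℕ} {i j : α → ℕ} (hw : PT w) (hi : PT i)
    (hj : PT j) : PT (fun a => contained (w a) (i a) (j a)) := by
  unfold SatHyp.contained; fun_prop

end

theorem shiftBits_eq (s q : ℕ) : shiftBits s q = s / 2 ^ q := by
  unfold shiftBits iterLt
  induction q with
  | zero => simp
  | succ q ih =>
    rw [Function.iterate_succ_apply', ih, pow_succ, ← Nat.div_div_eq_div_mul]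
    refine min_eq_right ?_
    exact (Nat.div_le_self _ _).trans (Nat.div_le_self _ _)

theorem bitAt_eq_testBit (s q : ℕ) : bitAt s q = s.testBit q := by
  rw [Nat.testBit_eq_decide_div_mod_eq, bitAt, shiftBits_eq, eqb]

theorem exists_bits (k : ℕ) (f : ℕ → Bool) : ∃ s < 2 ^ k, ∀ q < k, bitAt s q = f q := by
  refine ⟨Nat.ofBits (fun i : Fin k => f i), Nat.ofBits_lt_two_pow _, fun q hq => ?_⟩
  rw [bitAt_eq_testBit, Nat.testBit_ofBits_lt _ _ hq]

theorem inBag_iff {w : List ℕ} {i v : ℕ} :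
    inBag w i v = true ↔ ∃ q < bagLen w i, bagElem w i q = v := by
  simp [inBag]

theorem bagVal_eq {w : List ℕ} {i s v : ℕ} {σ : ℕ → Bool}
    (hs : ∀ q < bagLen w i, bitAt s q = σ (bagElem w i q)) (hv : inBag w i v = true) :
    bagVal w i s v = σ v := by
  obtain ⟨q, hq, rfl⟩ := inBag_iff.1 hv
  rw [Bool.eq_iff_iff]
  simp only [bagVal, exLt_iff, Bool.and_eq_true, eqb_iff]
  constructor
  · rintro ⟨q', hq', h, h'⟩
    rwa [hs q' hq', h] at h'
  · exact fun h => ⟨q, hq, rfl, by rwa [hs q hq]⟩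

theorem consistent_iff {w : List ℕ} {i s s' : ℕ} : consistent w i s s' = true ↔
    ∀ v, inBag w i v = true → inBag w (i + 1) v = true → bagVal w i s v = bagVal w (i + 1) s' v := by
  have : ∀ b c : Bool, b.toNat = c.toNat ↔ b = c := by decide
  simp only [consistent, allLt_iff, Bool.or_eq_true, Bool.not_eq_true', eqb_iff, this]
  constructor
  · intro h v hv hv'
    obtain ⟨q, hq, rfl⟩ := inBag_iff.1 hv
    exact (h q hq).resolve_left (by simp [hv'])
  · intro h q hq
    rw [or_iff_not_imp_left]
    exact fun h' => h _ (inBag_iff.2 ⟨q, hq, rfl⟩) (by simpa using h')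

/-- A configuration of the search for a satisfying assignment along a path decomposition: the
current bag `i` has the assignment `s`, the first `j` clauses have been checked in this bag, and
if `q > 0`, then clause `j` has been seen to be true, too. -/
structure Walker where
  ph : ℕ
  i : ℕ
  s : ℕ
  j : ℕ
  q : ℕ

/-- The configuration with the number `z`. -/
def toWalker (b z : ℕ) : Walker :=
  ⟨digit b 0 z, digit b 1 z, digit b 2 z, digit b 3 z, digit b 4 z⟩

/-- The label of a transition in the search for a satisfying assignment. -/
def walkLab (w : List ℕ) (x y : Walker) : ℕ :=
  bif eqb x.ph 0 then (eqb y.ph 1 && eqb y.i 0 && eqb y.j 0 && eqb y.q 0).toNat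
  else bif eqb x.ph 1 then
    bif eqb x.j (numClauses w) then
      bif ltb x.i (numBags w) then
        (eqb y.ph 1 && eqb y.i (x.i + 1) && eqb y.j 0 && eqb y.q 0 &&
          consistent w x.i x.s y.s).toNat
      else (eqb y.ph 2).toNat
    else bif ltb x.j (numClauses w) && eqb y.ph 1 && eqb y.i x.i && eqb y.s x.s then
      bif eqb x.q 0 && contained w x.i x.j then
        bif eqb y.j x.j && ltb 0 y.q && ltb (y.q - 1) (clauseLen w x.j) then
          bif inSet w (clauseLit w x.j (y.q - 1) / 2) then clauseLit w x.j (y.q - 1) + 2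
          else (eqb (bagVal w x.i x.s (clauseLit w x.j (y.q - 1) / 2)).toNat
            (clauseLit w x.j (y.q - 1) % 2)).toNat
        else 0
      else (eqb y.j (x.j + 1) && eqb y.q 0).toNat
    else 0
  else 0

/-- The base of the numbering of configurations. -/
def walkBase (c : ℕ) (w : List ℕ) : ℕ := 2 * (total w + 1) ^ c + (total w + 5)

/-- The branching program that searches for a satisfying assignment along a path decomposition. -/
def walkGraph (c : ℕ) : PGraph where
  N w := walkBase c w ^ 5
  s _ := 0
  t _ := 2
  lab w x y := walkLab w (toWalker (walkBase c w) x) (toWalker (walkBase c w) y)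
  ptN := by unfold walkBase; fun_prop
  pts := by fun_prop
  ptt := by fun_prop
  ptlab := by
    unfold walkLab toWalker walkBase
    dsimp only
    fun_prop
  s_lt w := Nat.pow_pos (by unfold walkBase; omega)
  t_lt w := lt_of_lt_of_le (show 2 < walkBase c w ^ 1 by rw [pow_one]; unfold walkBase; omega)
    (Nat.pow_le_pow_right (by unfold walkBase; omega) (by omega))
  lab_mem w x y h := by
    generalize toWalker (walkBase c w) x = x at *
    generalize toWalker (walkBase c w) y = y at *
    simp only [walkLab, Bool.cond_eq_ite] at h ⊢
    split_ifs at h ⊢ with h1 h2 h3 h4 h5 h6 h7 h8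
    all_goals first
      | exact absurd h (not_two_le_toNat _)
      | exact absurd h (by omega)
      | (rw [Nat.add_sub_cancel]; exact h8)

/-- Clause `j` is true. -/
def ClauseTrue (w : List ℕ) (σ : ℕ → Bool) (j : ℕ) : Prop :=
  ∃ q < clauseLen w j, LitTrue σ (clauseLit w j q)

/-- The properties of the bags that the search relies on. -/
structure GoodBags (c : ℕ) (w : List ℕ) : Prop where
  disjoint : ∀ i v, inBag w i v = true → inSet w v = false
  contiguous : ∀ i i' v, i ≤ i' → inBag w i v = true → inBag w (i' + 1) v = true →
    inBag w i' v = true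
  exists_contained : ∀ j < numClauses w, ∃ i ≤ numBags w, contained w i j = true
  small : ∀ i, 2 ^ bagLen w i ≤ walkBase c w

section Walk

open Relation

variable {c : ℕ} {w : List ℕ} {τ : ℕ → Bool}

/-- The invariant of the search for a satisfying assignment. -/
structure WalkInv (w : List ℕ) (τ : ℕ → Bool) (x : Walker) : Prop where
  one : x.ph = 1 → ∃ σ : ℕ → Bool, (∀ v, inSet w v = true → σ v = τ v) ∧
    (∀ v, inBag w x.i v = true → σ v = bagVal w x.i x.s v) ∧
    (∀ i < x.i, ∀ j < numClauses w, contained w i j = true → ClauseTrue w σ j) ∧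
    (∀ j < x.j, contained w x.i j = true → ClauseTrue w σ j) ∧
    (0 < x.q → ClauseTrue w σ x.j)
  two : x.ph = 2 → ∃ σ : ℕ → Bool,
    ∀ i ≤ numBags w, ∀ j < numClauses w, contained w i j = true → ClauseTrue w σ j
  scan : x.ph = 1 → x.i ≤ numBags w

theorem contained_iff {i j : ℕ} : contained w i j = true ↔ ∀ q < clauseLen w j,
    inSet w (clauseLit w j q / 2) = true ∨ inBag w i (clauseLit w j q / 2) = true := by
  simp [contained]

theorem ClauseTrue.congr {σ σ' : ℕ → Bool} {i j : ℕ} (h : ClauseTrue w σ j)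
    (hc : contained w i j = true)
    (heq : ∀ v, inSet w v = true ∨ inBag w i v = true → σ' v = σ v) : ClauseTrue w σ' j := by
  obtain ⟨q, hq, h⟩ := h
  refine ⟨q, hq, ?_⟩
  unfold LitTrue at h ⊢
  rwa [heq _ (contained_iff.1 hc q hq)]

/-- The search forgets earlier bags, but some global assignment `σ` accounts for everything checked
so far. On entering a bag, `σ` is overwritten there, and the truth of earlier clauses must survive
this. -/
theorem WalkInv.step (hg : GoodBags c w) {x y : Walker} (hx : WalkInv w τ x)
    (h : LabTrue τ (walkLab w x y)) : WalkInv w τ y := by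
  obtain ⟨ph, i, s, j, q⟩ := x
  obtain ⟨ph', i', s', j', q'⟩ := y
  obtain ⟨x1, x2, x3⟩ := hx
  simp only [walkLab, Bool.cond_eq_ite] at h x1 x2 x3
  split_ifs at h with h1 h2 h3 h4 h5 h6 h7 h8
  all_goals simp only [labTrue_toNat, not_labTrue_zero, Bool.and_eq_true, eqb_iff, ltb_iff] at *
  · obtain ⟨⟨⟨rfl, rfl⟩, rfl⟩, rfl⟩ := h
    refine ⟨fun _ => ⟨fun v => if inBag w 0 v = true then bagVal w 0 s' v else τ v, fun v hv => ?_,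
      fun v hv => ?_, fun i hi => ?_, fun i hi => ?_, fun h => ?_⟩, fun h => ?_,
      fun _ => Nat.zero_le _⟩
    all_goals dsimp only at *
    · rw [if_neg]
      intro h
      simp [hg.disjoint _ _ h] at hv
    · rw [if_pos hv]
    all_goals omega
  · obtain ⟨⟨⟨⟨rfl, rfl⟩, rfl⟩, rfl⟩, hcons⟩ := h
    obtain ⟨σ, s1, s2, s3, s4, s5⟩ := x1 h2
    rw [consistent_iff] at hcons
    -- The overwriting changes nothing on earlier bags: by contiguity, a variable that occurs in an
    -- earlier bag and in bag `i + 1` also occurs in bag `i`, where consistency fixes its value.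
    have hσ : ∀ i' ≤ i, ∀ v, inSet w v = true ∨ inBag w i' v = true →
        (if inBag w (i + 1) v = true then bagVal w (i + 1) s' v else σ v) = σ v := by
      intro i' hi' v hv
      split_ifs with h
      · have h' := hv.resolve_left (by simp [hg.disjoint _ _ h])
        have := hg.contiguous i' i v hi' h' h
        rw [s2 v this, hcons v this h]
      · rfl
    refine ⟨fun _ => ⟨fun v => if inBag w (i + 1) v = true then bagVal w (i + 1) s' v else σ v,
      fun v hv => ?_, fun v hv => ?_, fun i' hi j hj hc => ?_, fun j hj => ?_, fun h => ?_⟩,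
      fun h => ?_, fun _ => h4⟩
    all_goals dsimp only at *
    · rw [hσ i le_rfl v (Or.inl hv), s1 v hv]
    · rw [if_pos hv]
    · have hii : i' ≤ i := by omega
      refine ClauseTrue.congr (σ := σ) ?_ hc (hσ i' hii)
      rcases hii.lt_or_eq with h | rfl
      exacts [s3 i' h j hj hc, s4 j (h3 ▸ hj) hc]
    all_goals omega
  · obtain ⟨σ, s1, s2, s3, s4, s5⟩ := x1 h2
    have := x3 h2
    refine ⟨fun h' => ?_, fun _ => ⟨σ, fun i' hi' j' hj' hc => ?_⟩, fun h' => ?_⟩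
    all_goals dsimp only at *
    · omega
    · rcases hi'.lt_or_eq with h | rfl
      · exact s3 i' (by omega) j' hj' hc
      · exact s4 j' (h3 ▸ hj') (by rwa [show i = numBags w by omega])
    · omega
  · obtain ⟨⟨⟨hj, rfl⟩, rfl⟩, rfl⟩ := h5
    obtain ⟨⟨rfl, hq⟩, hq'⟩ := h7
    obtain ⟨σ, s1, s2, s3, s4, s5⟩ := x1 h2
    refine ⟨fun _ => ⟨σ, s1, s2, s3, s4, fun _ => ⟨q' - 1, hq', ?_⟩⟩, fun h => ?_, fun _ => x3 h2⟩
    · rw [labTrue_add_two] at h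
      unfold LitTrue at h ⊢
      rw [s1 _ h8, h]
    · dsimp only at *
      omega
  · obtain ⟨⟨⟨hj, rfl⟩, rfl⟩, rfl⟩ := h5
    obtain ⟨⟨rfl, hq⟩, hq'⟩ := h7
    obtain ⟨σ, s1, s2, s3, s4, s5⟩ := x1 h2
    refine ⟨fun _ => ⟨σ, s1, s2, s3, s4, fun _ => ⟨q' - 1, hq', ?_⟩⟩, fun h => ?_, fun _ => x3 h2⟩
    · have h9 := (contained_iff.1 h6.2 (q' - 1) hq').resolve_left h8
      unfold LitTrue
      rw [s2 _ h9, ← h]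
      cases bagVal w i' s' (clauseLit w j' (q' - 1) / 2) <;> simp
    · dsimp only at *
      omega
  · obtain ⟨⟨⟨hj, rfl⟩, rfl⟩, rfl⟩ := h5
    obtain ⟨rfl, rfl⟩ := h
    obtain ⟨σ, s1, s2, s3, s4, s5⟩ := x1 h2
    refine ⟨fun _ => ⟨σ, s1, s2, s3, fun j' hj' hc => ?_, fun h => ?_⟩, fun h => ?_, fun _ => x3 h2⟩
    all_goals dsimp only at *
    · rcases Nat.lt_succ_iff_lt_or_eq.1 hj' with hj' | rfl
      · exact s4 j' hj' hc
      · refine s5 ?_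
        by_contra hq
        exact h6 ⟨by omega, hc⟩
    all_goals omega

theorem exists_toWalker {b : ℕ} (y : Walker) (hp : y.ph < b) (hi : y.i < b) (hs : y.s < b)
    (hj : y.j < b) (hq : y.q < b) : ∃ z < b ^ 5, toWalker b z = y := by
  obtain ⟨z, hz, h⟩ := exists_digits (b := b) 5
    (fun j => [y.ph, y.i, y.s, y.j, y.q].getD j 0) (by
      intro j hj
      interval_cases j <;> assumption)
  refine ⟨z, hz, ?_⟩
  simp only [toWalker, h 0 (by omega), h 1 (by omega), h 2 (by omega), h 3 (by omega),
    h 4 (by omega)]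
  rfl

/-- The configuration `y` is reached by the search. -/
def WalkGot (c : ℕ) (w : List ℕ) (τ : ℕ → Bool) (y : Walker) : Prop :=
  ∃ z, ReflTransGen (LabEdge ((walkGraph c).N w) ((walkGraph c).lab w) τ) 0 z ∧
    z < walkBase c w ^ 5 ∧ toWalker (walkBase c w) z = y

theorem WalkGot.step {x : Walker} (h : WalkGot c w τ x) {ph i s j q : ℕ}
    (hlab : LabTrue τ (walkLab w x ⟨ph, i, s, j, q⟩)) (hp : ph < 3)
    (hi : i ≤ numBags w) (hs : s < walkBase c w) (hj : j ≤ numClauses w)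
    (hq : q ≤ clauseLen w j) : WalkGot c w τ ⟨ph, i, s, j, q⟩ := by
  obtain ⟨z, hz, hz', rfl⟩ := h
  have h1 : numClauses w ≤ total w := cell_le_total w 1
  have h2 : clauseLen w j ≤ total w := cell_le_total w _
  have h3 : numBags w ≤ total w := cell_le_total w _
  obtain ⟨z', hz₁, hz₂⟩ := exists_toWalker (b := walkBase c w) ⟨ph, i, s, j, q⟩
    (by simp only [walkBase]; omega) (by simp only [walkBase]; omega) hs
    (by simp only [walkBase]; omega) (by simp only [walkBase]; omega)
  refine ⟨z', hz.tail ⟨hz', hz₁, ?_⟩, hz₁, hz₂⟩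
  simpa only [walkGraph, hz₂] using hlab

/-- The search succeeds for some assignment if and only if the formula is satisfiable. -/
theorem exists_walkGraph_reach_iff (hg : GoodBags c w) :
    (∃ τ, (walkGraph c).Reach w τ) ↔ ∃ σ, ∀ j < numClauses w, ClauseTrue w σ j := by
  have hbase : 2 < walkBase c w := by unfold walkBase; omega
  have h0 : toWalker (walkBase c w) 0 = ⟨0, 0, 0, 0, 0⟩ := by simp [toWalker, digit_zero_right]
  have h2 : (toWalker (walkBase c w) 2).ph = 2 := by simp [toWalker, digit, Nat.mod_eq_of_lt hbase]
  constructor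
  · rintro ⟨τ, h⟩
    have : ∀ z, ReflTransGen (LabEdge ((walkGraph c).N w) ((walkGraph c).lab w) τ) 0 z →
        WalkInv w τ (toWalker (walkBase c w) z) := by
      intro z hz
      induction hz with
      | refl =>
        rw [h0]
        refine ⟨fun h => ?_, fun h => ?_, fun h => ?_⟩
        all_goals
          dsimp only at h
          omega
      | tail _ h ih => exact ih.step hg h.2.2
    obtain ⟨σ, hσ⟩ := (this _ h).two h2
    refine ⟨σ, fun j hj => ?_⟩
    obtain ⟨i, hi, hc⟩ := hg.exists_contained j hj
    exact hσ i hi j hj hc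
  · rintro ⟨σ, hσ⟩
    refine ⟨σ, ?_⟩
    -- The states are read off from one global assignment, so neighbouring ones are automatically
    -- consistent.
    have hstate : ∀ i, ∃ s < walkBase c w, ∀ v, inBag w i v = true → bagVal w i s v = σ v := by
      intro i
      obtain ⟨s, hs, hs'⟩ := exists_bits (bagLen w i) fun q => σ (bagElem w i q)
      exact ⟨s, hs.trans_le (hg.small i), fun v hv => bagVal_eq hs' hv⟩
    choose st hst hst' using hstate
    have hstart : WalkGot c w σ ⟨0, 0, 0, 0, 0⟩ := ⟨0, .refl, Nat.pow_pos (by omega), h0⟩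
    have hclauses : ∀ i ≤ numBags w, WalkGot c w σ ⟨1, i, st i, 0, 0⟩ → ∀ j ≤ numClauses w,
        WalkGot c w σ ⟨1, i, st i, j, 0⟩ := by
      intro i hi h j
      induction j with
      | zero => exact fun _ => h
      | succ j ih =>
        intro hj
        have hj' : j < numClauses w := hj
        have ih := ih hj'.le
        by_cases hc : contained w i j = true
        · obtain ⟨q, hq, hl⟩ := hσ j hj'
          have hmid : WalkGot c w σ ⟨1, i, st i, j, q + 1⟩ := by
            refine ih.step ?_ (by omega) hi (hst i) hj'.le hq
            by_cases hin : inSet w (clauseLit w j q / 2) = true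
            · simpa [walkLab, Bool.cond_eq_ite, hj', hj'.ne, hc, hq, hin, labTrue_add_two] using hl
            · have hb := (contained_iff.1 hc q hq).resolve_left hin
              unfold LitTrue at hl
              have hmod : (σ (clauseLit w j q / 2)).toNat = clauseLit w j q % 2 := by
                rw [hl]
                rcases Nat.mod_two_eq_zero_or_one (clauseLit w j q) with h | h <;> simp [h]
              simp [walkLab, Bool.cond_eq_ite, hj', hj'.ne, hc, hq, hin, labTrue_toNat,
                hst' i _ hb, hmod]
          refine hmid.step ?_ (by omega) hi (hst i) hj (Nat.zero_le _)
          simp [walkLab, Bool.cond_eq_ite, hj', hj'.ne, labTrue_toNat]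
        · refine ih.step ?_ (by omega) hi (hst i) hj (Nat.zero_le _)
          simp [walkLab, Bool.cond_eq_ite, hj', hj'.ne, hc, labTrue_toNat]
    have hbags : ∀ i ≤ numBags w, WalkGot c w σ ⟨1, i, st i, 0, 0⟩ := by
      intro i
      induction i with
      | zero =>
        intro _
        refine hstart.step ?_ (by omega) (Nat.zero_le _) (hst 0) (Nat.zero_le _) (Nat.zero_le _)
        simp [walkLab, Bool.cond_eq_ite, labTrue_toNat]
      | succ i ih =>
        intro hi
        have hi' : i < numBags w := hi
        refine (hclauses i hi'.le (ih hi'.le) _ le_rfl).step ?_ (by omega) hi (hst _)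
          (Nat.zero_le _) (Nat.zero_le _)
        have : consistent w i (st i) (st (i + 1)) = true :=
          consistent_iff.2 fun v h h' => by rw [hst' i v h, hst' (i + 1) v h']
        simp [walkLab, Bool.cond_eq_ite, hi', labTrue_toNat, this]
    obtain ⟨z, hz, hz', hz''⟩ := hclauses _ le_rfl (hbags _ le_rfl) _ le_rfl
    refine hz.tail ⟨hz', (walkGraph c).t_lt w, ?_⟩
    simp only [walkGraph, hz'']
    simp [walkLab, Bool.cond_eq_ite, labTrue_toNat, h2]

end Walk

/-- In a path decomposition, the vertices of a clique belong to a common bag. -/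
theorem IsPathDecomposition.exists_bag {V : Type*} {G : SimpleGraph V} {D : List (Finset V)}
    (h : IsPathDecomposition G D) {K : Finset V} (hK : K.Nonempty)
    (hclique : ∀ u ∈ K, ∀ v ∈ K, u ≠ v → G.Adj u v) : ∃ i : Fin D.length, ∀ u ∈ K, u ∈ D.get i := by
  classical
  have hshare : ∀ u ∈ K, ∀ v ∈ K, ∃ i : Fin D.length, u ∈ D.get i ∧ v ∈ D.get i := by
    intro u hu v hv
    obtain ⟨X, hX, hX'⟩ : ∃ X ∈ D, u ∈ X ∧ v ∈ X := by
      by_cases huv : u = v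
      · obtain ⟨X, hX, hX'⟩ := h.vertex_mem u
        exact ⟨X, hX, hX', huv ▸ hX'⟩
      · exact h.edge_mem u v (hclique u hu v hv huv)
    obtain ⟨i, rfl⟩ := List.mem_iff_get.1 hX
    exact ⟨i, hX'⟩
  have hfirst : ∀ u, ∃ i : Fin D.length, u ∈ D.get i ∧ ∀ k, u ∈ D.get k → i ≤ k := by
    intro u
    obtain ⟨X, hX, hX'⟩ := h.vertex_mem u
    obtain ⟨i, rfl⟩ := List.mem_iff_get.1 hX
    obtain ⟨i, hi, hmin⟩ := Finset.exists_min_image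
      (Finset.univ.filter fun i : Fin D.length => u ∈ D.get i) id ⟨i, by simpa using hX'⟩
    exact ⟨i, by simpa using hi, fun k hk => hmin k (by simpa using hk)⟩
  -- Helly property of intervals: let `v` be the vertex of the clique that appears last. Every other
  -- `u` has appeared by then and still has to meet `v`, so it belongs to the first bag of `v`.
  choose first hmem hmin using hfirst
  obtain ⟨v, hv, hmax⟩ := Finset.exists_max_image K first hK
  refine ⟨first v, fun u hu => ?_⟩
  obtain ⟨i, hi, hi'⟩ := hshare u hu v hv
  exact h.contiguous u (first u) (first v) i (hmax u hu) (hmin v i hi') (hmem u) hi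

theorem satisfiable_iff_clauseTrue {w : List ℕ} {n : ℕ} {φ : CNF n} {B : Finset (Fin n)}
    (hw : Encodes w φ B) :
    φ.Satisfiable ↔ ∃ σ, ∀ j < numClauses w, ClauseTrue w σ j := by
  rw [CNF.satisfiable_iff_nat]
  refine exists_congr fun σ => ?_
  rw [hw.nc]
  constructor
  · intro h j hj
    exact (hw.exists_mem_iff hj).1 (h _ (List.getElem_mem hj))
  · intro h C hC
    obtain ⟨j, hj, rfl⟩ := List.mem_iff_getElem.1 hC
    exact (hw.exists_mem_iff hj).2 (h j hj)

theorem length_encode_eq {n : ℕ} (φ : CNF n) (B : Finset (Fin n)) (post : List ℕ) :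
    setPos (φ.encode ++ encodeVarSet B ++ post) = φ.encode.length := by
  have hw : φ.encode ++ encodeVarSet B ++ post = [n, φ.length] ++
      (blocks (φ.map fun C => C.map litCode) ++ (encodeVarSet B ++ post)) := by
    rw [CNF.encode_eq]
    simp
  have hm : numClauses ([n, φ.length] ++
      (blocks (φ.map fun C => C.map litCode) ++ (encodeVarSet B ++ post))) = φ.length := rfl
  rw [hw, setPos, hm]
  refine (blockPos_eq [n, φ.length] _ _ (by simp)).trans ?_
  rw [List.take_of_length_le (by simp), CNF.encode_eq]
  simp
  omega

/-- The list `w` contains the encodings of the bags `D`. -/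
structure EncodesBags (w : List ℕ) (D : List (List ℕ)) : Prop where
  num : numBags w = D.length
  len : ∀ i (hi : i < D.length), bagLen w i = D[i].length
  elem : ∀ i (hi : i < D.length) q (hq : q < D[i].length), bagElem w i q = D[i][q]

theorem encodesBags_append {n : ℕ} (φ : CNF n) (B : Finset (Fin n)) (D : List (List ℕ)) :
    EncodesBags (φ.encode ++ encodeVarSet B ++ (D.length :: blocks D)) D := by
  have hE := encodes_append φ B (D.length :: blocks D)
  have hpos := length_encode_eq φ B (D.length :: blocks D)
  have hlen : (encodeVarSet B).length = 1 + B.card := by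
    rw [encodeVarSet_eq]
    simp [blocks]
    omega
  have hnum : numBags (φ.encode ++ encodeVarSet B ++ (D.length :: blocks D)) = D.length := by
    rw [numBags, hpos, hE.size, add_assoc, ← hlen, ← List.length_append, cell_append_length]
    rfl
  have hw : φ.encode ++ encodeVarSet B ++ (D.length :: blocks D) =
      (φ.encode ++ encodeVarSet B ++ [D.length]) ++ (blocks D ++ []) := by simp
  have hpre : setPos (φ.encode ++ encodeVarSet B ++ (D.length :: blocks D)) + 2 +
      setSize (φ.encode ++ encodeVarSet B ++ (D.length :: blocks D)) =
      (φ.encode ++ encodeVarSet B ++ [D.length]).length := by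
    rw [hpos, hE.size]
    simp only [List.length_append, hlen, List.length_singleton]
    omega
  refine ⟨hnum, fun i hi => ?_, fun i hi q hq => ?_⟩
  · have h1 : ltb i (numBags (φ.encode ++ encodeVarSet B ++ (D.length :: blocks D))) = true := by
      rwa [ltb_iff, hnum]
    rw [bagLen, h1, cond_true, hpre, hw]
    exact cell_blockPos _ _ _ hi
  · rw [bagElem, hpre, hw]
    exact cell_blockPos_add _ _ _ hi hq

/-! ### Reading the bags of an encoded path decomposition -/

section LogPw

variable {c : ℕ} (I : LogPwInstance c)

/-- The bags as lists of numbers. -/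
def LogPwInstance.bags : List (List ℕ) :=
  I.D.map fun X => ((X.map (Function.Embedding.subtype _)).sort (· ≤ ·)).map Fin.val

theorem LogPwInstance.encode_eq :
    I.encode = I.φ.encode ++ encodeVarSet I.M ++ (I.bags.length :: blocks I.bags) := by
  rw [LogPwInstance.encode]
  congr 1
  rw [bags, encodeList_blocks (fun X : Finset {v : Fin I.n // v ∉ I.M} =>
    ((X.map (Function.Embedding.subtype _)).sort (· ≤ ·)).map Fin.val), List.length_map]
  intro X
  rw [encodeVarSet_eq]
  simp [blocks]

theorem LogPwInstance.encodes : Encodes I.encode I.φ I.M := by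
  rw [I.encode_eq]
  exact encodes_append _ _ _

theorem LogPwInstance.encodesBags : EncodesBags I.encode I.bags := by
  rw [I.encode_eq]
  exact encodesBags_append _ _ _

theorem LogPwInstance.length_bags : I.bags.length = I.D.length := by simp [bags]

theorem LogPwInstance.bagLen_eq {i : ℕ} (hi : i < I.D.length) :
    bagLen I.encode i = I.D[i].card := by
  rw [I.encodesBags.len i (by rwa [I.length_bags])]
  simp [bags]

theorem LogPwInstance.bagLen_of_le {i : ℕ} (hi : I.D.length ≤ i) : bagLen I.encode i = 0 := by
  have : ltb i (numBags I.encode) = false := by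
    rw [ltb_false_iff, I.encodesBags.num, I.length_bags]
    exact hi
  rw [bagLen, this, cond_false]

theorem LogPwInstance.inBag_iff {i v : ℕ} : inBag I.encode i v = true ↔
    ∃ h : i < I.D.length, ∃ x ∈ I.D.get ⟨i, h⟩, x.val.val = v := by
  rw [SatHyp.inBag_iff]
  by_cases hi : i < I.D.length
  · have hi' : i < I.bags.length := by rwa [I.length_bags]
    rw [I.encodesBags.len i hi']
    have h1 : (∃ x ∈ I.D.get ⟨i, hi⟩, x.val.val = v) ↔ v ∈ I.bags[i] := by
      simp [bags]
    simp only [hi, exists_true_left]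
    rw [h1, List.mem_iff_getElem]
    constructor
    · rintro ⟨q, hq, h⟩
      exact ⟨q, hq, by rw [← h, I.encodesBags.elem i hi' q hq]⟩
    · rintro ⟨q, hq, h⟩
      exact ⟨q, hq, by rw [← h, I.encodesBags.elem i hi' q hq]⟩
  · rw [I.bagLen_of_le (by omega)]
    simp [hi]

theorem sum_lengths_le_sum_blocks (ls : List (List ℕ)) :
    (ls.map List.length).sum ≤ (blocks ls).sum := by
  induction ls with
  | nil => simp
  | cons l ls ih =>
    rw [blocks_cons]
    simp only [List.map_cons, List.sum_cons, List.cons_append, List.sum_append]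
    omega

theorem size_le_total {n : ℕ} (φ : CNF n) (post : List ℕ) :
    φ.size ≤ total (φ.encode ++ post) + 1 := by
  have h := sum_lengths_le_sum_blocks (φ.map fun C => C.map litCode)
  have h2 : ((φ.map fun C => C.map litCode).map List.length) = φ.map List.length := by
    simp
  rw [h2] at h
  rw [total_eq, CNF.encode_eq, CNF.size]
  simp only [List.cons_append, List.sum_cons, List.sum_append]
  omega

/-- A bag may have one vertex more than the width, which accounts for the factor `2`; the same
expression is the first summand of `walkBase`. -/
theorem two_pow_le_of_width {k c s : ℕ} (hs : 0 < s) (h : (k : ℝ) - 1 ≤ c * Real.logb 2 s) :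
    2 ^ k ≤ 2 * s ^ c := by
  have hs' : (0 : ℝ) < s := by exact_mod_cast hs
  have h1 : (2 : ℝ) ^ ((k : ℝ) - 1) ≤ (s : ℝ) ^ c := by
    refine (Real.rpow_le_rpow_of_exponent_le one_le_two h).trans ?_
    rw [mul_comm, Real.rpow_mul zero_le_two, Real.rpow_logb two_pos (by norm_num) hs',
      Real.rpow_natCast]
  rw [Real.rpow_sub two_pos, Real.rpow_natCast, Real.rpow_one, div_le_iff₀ two_pos] at h1
  have h2 : ((2 ^ k : ℕ) : ℝ) ≤ ((2 * s ^ c : ℕ) : ℝ) := by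
    push_cast
    linarith
  exact_mod_cast h2

/-- The variables of a clause outside the modulator form a clique of the remaining graph, hence lie
in a common bag; the width bound keeps the number of assignments to a bag below the base of the
numbering. -/
theorem LogPwInstance.goodBags : GoodBags c I.encode := by
  refine ⟨fun i v h => ?_, fun i i' v hi h h' => ?_, fun j hj => ?_, fun i => ?_⟩
  · obtain ⟨hi, x, hx, rfl⟩ := I.inBag_iff.1 h
    rw [Bool.eq_false_iff, ne_eq, I.encodes.inSet_val_iff]
    exact x.2
  · obtain ⟨hi₁, x, hx, hxv⟩ := I.inBag_iff.1 h
    obtain ⟨hi₂, y, hy, hyv⟩ := I.inBag_iff.1 h'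
    obtain rfl : x = y := Subtype.ext (Fin.ext (hxv.trans hyv.symm))
    exact I.inBag_iff.2 ⟨by omega, x, I.isDecomposition.contiguous x ⟨i, hi₁⟩ ⟨i', by omega⟩
      ⟨i' + 1, hi₂⟩ hi (Nat.le_succ i') hx hy, hxv⟩
  · rw [I.encodes.nc] at hj
    classical
    let K : Finset {v : Fin I.n // v ∉ I.M} :=
      Finset.univ.filter fun v => Clause.HasVar I.φ[j] v.val
    have hcont : ∀ i, (∀ u ∈ K, inBag I.encode i u.val.val = true) →
        contained I.encode i j = true := by
      intro i h
      rw [contained_iff]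
      refine (I.encodes.forall_mem_iff hj (p := fun a => inSet I.encode (a / 2) = true ∨
        inBag I.encode i (a / 2) = true)).1 fun l hl => ?_
      rw [litCode_div, I.encodes.inSet_val_iff, or_iff_not_imp_left]
      exact fun hM => h ⟨l.1, hM⟩ (by simpa [K] using ⟨l, hl, rfl⟩)
    rcases K.eq_empty_or_nonempty with hK | hK
    -- A clause over the modulator alone needs no bag. The index `0` is legitimate even if there are
    -- no bags at all, because the search also visits the empty bag with index `numBags`.
    · exact ⟨0, Nat.zero_le _, hcont 0 (by simp [hK])⟩
    · obtain ⟨i, hi⟩ := I.isDecomposition.exists_bag hK fun u hu v hv huv =>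
        ⟨fun h => huv (Subtype.ext h), I.φ[j], List.getElem_mem hj, (Finset.mem_filter.1 hu).2,
          (Finset.mem_filter.1 hv).2⟩
      refine ⟨i, ?_, hcont i fun u hu => I.inBag_iff.2 ⟨i.2, u, hi u hu, rfl⟩⟩
      rw [I.encodesBags.num, I.length_bags]
      exact i.2.le
  · by_cases hi : i < I.D.length
    · rw [I.bagLen_eq hi]
      have h1 := two_pow_le_of_width (k := I.D[i].card) (c := c) (s := I.φ.size)
        (by unfold CNF.size; omega) (I.width_le _ (List.getElem_mem hi))
      have h2 : I.φ.size ≤ total I.encode + 1 := by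
        rw [I.encode_eq, List.append_assoc]
        exact size_le_total _ _
      have h3 : I.φ.size ^ c ≤ (total I.encode + 1) ^ c := Nat.pow_le_pow_left h2 c
      unfold walkBase
      omega
    · rw [I.bagLen_of_le (by omega)]
      unfold walkBase
      omega

/-- A formula with a path decomposition is satisfiable if and only if the search along the
decomposition succeeds for some assignment to the modulator. -/
theorem LogPwInstance.satisfiable_iff :
    I.φ.Satisfiable ↔ ∃ τ, (walkGraph c).Reach I.encode τ := by
  rw [exists_walkGraph_reach_iff I.goodBags, satisfiable_iff_clauseTrue I.encodes]

end LogPw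

theorem PTL.flatMap {α : Type} [Ctx α] {n : α → ℕ} {g : α → ℕ → List ℕ} (hn : PT n)
    (hg : PTL fun p : α × ℕ => g p.1 p.2) : PTL (fun a => (List.range (n a)).flatMap (g a)) :=
  PTL.flat hn hg

theorem litTrue_two_mul {σ : ℕ → Bool} {v : ℕ} : LitTrue σ (2 * v) ↔ σ v = false := by
  simp [LitTrue]

theorem litTrue_two_mul_add_one {σ : ℕ → Bool} {v : ℕ} : LitTrue σ (2 * v + 1) ↔ σ v = true := by
  have h1 : (2 * v + 1) / 2 = v := by omega
  have h2 : (2 * v + 1) % 2 = 1 := by omega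
  simp [LitTrue, h1, h2]

/-- A strictly increasing list is determined by its elements. This is how a list produced by loops
is recognised as the encoding of a set. -/
theorem sort_map_val_eq {n : ℕ} (S : Finset (Fin n)) {l : List ℕ} (hl : l.Pairwise (· < ·))
    (hmem : ∀ v, v ∈ l ↔ ∃ x ∈ S, x.val = v) : (S.sort (· ≤ ·)).map Fin.val = l := by
  have h1 : ((S.sort (· ≤ ·)).map Fin.val).Pairwise (· < ·) := by
    rw [List.pairwise_map]
    exact (Finset.sortedLT_sort S).pairwise
  refine List.Perm.eq_of_pairwise (le := (· < ·)) (fun a b _ _ h h' => absurd h h'.asymm) h1 hl ?_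
  refine (List.perm_ext_iff_of_nodup (h1.imp fun h => h.ne) (hl.imp fun h => h.ne)).2 fun v => ?_
  rw [hmem]
  simp

/-- The part of the output that copies the encoded set of variables. -/
def copySet (w : List ℕ) : List ℕ :=
  setSize w :: (List.range (setSize w)).flatMap fun q => [setElem w q]

theorem PTL.copySet {α : Type} [Ctx α] {w : α → List ℕ} (hw : PT w) :
    PTL (fun a => copySet (w a)) :=
  .cons (by fun_prop) (.flatMap (by fun_prop) (.cons (by fun_prop) .nil))

/-- New variables are numbered after the old ones, so the embedding keeps values and order, and the
set can be copied verbatim to the output. -/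
theorem Encodes.encodeVarSet_map {w : List ℕ} {n n' : ℕ} {φ : CNF n} {B : Finset (Fin n)}
    (hw : Encodes w φ B) (h : n ≤ n') : encodeVarSet (B.map (Fin.castLEEmb h)) = copySet w := by
  have h1 : (List.range (setSize w)).flatMap (fun q => [setElem w q]) =
      (B.sort (· ≤ ·)).map Fin.val := by
    rw [← List.map_eq_flatMap, hw.size]
    refine List.ext_getElem (by simp) fun q h1 h2 => ?_
    have hq : q < B.card := by simpa using h2
    simpa using hw.elem q hq
  rw [encodeVarSet_eq, sort_map_val_eq (l := (B.sort (· ≤ ·)).map Fin.val), copySet, h1, hw.size]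
  · simp [blocks]
  · rw [List.pairwise_map]
    exact (Finset.sortedLT_sort B).pairwise
  · intro v
    simp

/-! ## From branching programs to 2-SAT backdoors -/

/-- The clause that says that the vertex `y` is reachable if `x` is and the edge is present. -/
def edgeClause (G : PGraph) (w : List ℕ) (x y : ℕ) : List ℕ :=
  [2 * (numVars w + x),
    bif eqb (G.lab w x y) 0 then 2 * (numVars w + x) + 1 else 2 * (numVars w + y) + 1,
    bif ltb (G.lab w x y) 2 then 2 * (numVars w + x) else flipLit (G.lab w x y - 2)]

/-- The clauses that say that the target is not reachable from the source. -/
def edgeClauses (G : PGraph) (w : List ℕ) : List (List ℕ) :=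
  ((List.range (G.N w)).flatMap fun x => (List.range (G.N w)).map fun y => edgeClause G w x y) ++
    [[2 * (numVars w + G.s w) + 1], [2 * (numVars w + G.t w)]]

/-- The encoding of the formula that says that the target is not reachable. -/
def backdoorOutput (G : PGraph) (w : List ℕ) : List ℕ :=
  (numVars w + G.N w) :: (G.N w * G.N w + 2) ::
    ((((List.range (G.N w)).flatMap fun x => (List.range (G.N w)).flatMap fun y =>
      3 :: edgeClause G w x y) ++ [1, 2 * (numVars w + G.s w) + 1, 1, 2 * (numVars w + G.t w)]) ++
      copySet w)

theorem ptl_backdoorOutput (G : PGraph) : PTL (backdoorOutput G) := by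
  refine .cons (by fun_prop) (.cons (by fun_prop) (.append (.append ?_ ?_) (.copySet (by fun_prop))))
  · refine .flatMap (by fun_prop) (.flatMap (by fun_prop) (.cons (by fun_prop) ?_))
    unfold edgeClause
    exact .cons (by fun_prop) (.cons (by fun_prop) (.cons (by fun_prop) .nil))
  · exact .cons (by fun_prop) (.cons (by fun_prop) (.cons (by fun_prop) (.cons (by fun_prop) .nil)))

section Backdoor

variable (G : PGraph) {w : List ℕ} {n : ℕ} {φ : CNF n} {B : Finset (Fin n)}

theorem length_edgeClauses : (edgeClauses G w).length = G.N w * G.N w + 2 := by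
  simp [edgeClauses, List.length_flatMap]

theorem blocks_edgeClauses : blocks (edgeClauses G w) =
    ((List.range (G.N w)).flatMap fun x => (List.range (G.N w)).flatMap fun y =>
      3 :: edgeClause G w x y) ++ [1, 2 * (numVars w + G.s w) + 1, 1, 2 * (numVars w + G.t w)] := by
  rw [edgeClauses, blocks_append]
  congr 1
  rw [blocks, List.flatMap_assoc]
  simp only [List.flatMap_map]
  rfl

theorem mem_edgeClauses {C : List ℕ} : C ∈ edgeClauses G w ↔
    (∃ x < G.N w, ∃ y < G.N w, C = edgeClause G w x y) ∨
      C = [2 * (numVars w + G.s w) + 1] ∨ C = [2 * (numVars w + G.t w)] := by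
  simp only [edgeClauses, List.mem_append, List.mem_flatMap, List.mem_range, List.mem_map,
    List.mem_cons, List.not_mem_nil, or_false]
  simp only [eq_comm]

variable (hw : Encodes w φ B)
include hw

theorem Encodes.lab_lt {x y : ℕ} (h : 2 ≤ G.lab w x y) : G.lab w x y - 2 < 2 * n := by
  obtain ⟨v, -, hv⟩ := hw.inSet_iff.1 (G.lab_mem w x y h)
  have := v.isLt
  omega

theorem edgeClauses_lt : ∀ C ∈ edgeClauses G w, ∀ a ∈ C, a < 2 * (n + G.N w) := by
  intro C hC a ha
  have hs := G.s_lt w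
  have ht := G.t_lt w
  rcases (mem_edgeClauses G).1 hC with ⟨x, hx, y, hy, rfl⟩ | rfl | rfl
  · simp only [edgeClause, hw.nv, Bool.cond_eq_ite, eqb_iff, ltb_iff, List.mem_cons,
      List.not_mem_nil, or_false] at ha
    rcases ha with rfl | rfl | rfl
    · omega
    · split_ifs <;> omega
    · split_ifs with h
      · omega
      · have := flipLit_lt (hw.lab_lt G (x := x) (y := y) (by omega))
        omega
  · simp only [hw.nv, List.mem_singleton] at ha
    omega
  · simp only [hw.nv, List.mem_singleton] at ha
    omega

/-- The new variables describe a set of vertices that contains the source, is closed under the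
available edges and avoids the target. If there is one, the target is unreachable; conversely, the
set of reachable vertices will do. All labels are literals over the old variables, so choosing the
new values does not affect them. -/
theorem exists_model_edgeClauses_iff :
    (∃ σ : ℕ → Bool, ∀ C ∈ edgeClauses G w, ∃ a ∈ C, LitTrue σ a) ↔ ∃ τ, ¬ G.Reach w τ := by
  constructor
  · rintro ⟨σ, hσ⟩
    refine ⟨σ, fun h => ?_⟩
    have hs := hσ _ ((mem_edgeClauses G).2 (Or.inr (Or.inl rfl)))
    have ht := hσ _ ((mem_edgeClauses G).2 (Or.inr (Or.inr rfl)))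
    simp only [List.mem_singleton, exists_eq_left, litTrue_two_mul, litTrue_two_mul_add_one] at hs ht
    have key : ∀ z, Relation.ReflTransGen (LabEdge (G.N w) (G.lab w) σ) (G.s w) z →
        σ (numVars w + z) = true := by
      intro z hz
      induction hz with
      | refl => exact hs
      | @tail x y _ hxy ih =>
        obtain ⟨hx, hy, hl⟩ := hxy
        obtain ⟨a, ha, h⟩ := hσ _ ((mem_edgeClauses G).2 (Or.inl ⟨x, hx, y, hy, rfl⟩))
        have h0 : G.lab w x y ≠ 0 := by
          intro h0
          rw [h0] at hl
          exact not_labTrue_zero hl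
        simp only [edgeClause, Bool.cond_eq_ite, eqb_iff, h0, if_false, ltb_iff, List.mem_cons,
          List.not_mem_nil, or_false] at ha
        rcases ha with rfl | rfl | rfl
        · rw [litTrue_two_mul] at h
          simp [h] at ih
        · rwa [litTrue_two_mul_add_one] at h
        · split_ifs at h with h1
          · rw [litTrue_two_mul] at h
            simp [h] at ih
          · rw [litTrue_flipLit] at h
            rcases hl with hl | hl
            · omega
            · exact absurd hl.2 h
    simp [key _ h] at ht
  · rintro ⟨τ, hτ⟩
    classical
    let R : ℕ → Prop := Relation.ReflTransGen (LabEdge (G.N w) (G.lab w) τ) (G.s w)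
    refine ⟨fun v => if v < n then τ v else decide (R (v - n)), fun C hC => ?_⟩
    have hnew : ∀ x, (if n + x < n then τ (n + x) else decide (R (n + x - n))) = decide (R x) := by
      intro x
      rw [if_neg (by omega), Nat.add_sub_cancel_left]
    rcases (mem_edgeClauses G).1 hC with ⟨x, hx, y, hy, rfl⟩ | rfl | rfl
    · simp only [edgeClause, hw.nv, Bool.cond_eq_ite, eqb_iff, ltb_iff, List.mem_cons,
        List.not_mem_nil, or_false, exists_eq_or_imp, exists_eq_left]
      by_cases hR : R x
      · by_cases h0 : G.lab w x y = 0
        · right; left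
          rw [if_pos h0, litTrue_two_mul_add_one, hnew]
          simpa using hR
        · by_cases hl : LabTrue τ (G.lab w x y)
          · right; left
            rw [if_neg h0, litTrue_two_mul_add_one, hnew]
            simpa using Relation.ReflTransGen.tail hR ⟨hx, hy, hl⟩
          · right; right
            have h2 : 2 ≤ G.lab w x y := by
              by_contra h
              exact hl (Or.inl (by omega))
            have h3 := hw.lab_lt G h2
            rw [if_neg (by omega), litTrue_flipLit]
            intro h
            refine hl (Or.inr ⟨h2, ?_⟩)
            unfold LitTrue at h ⊢
            dsimp only at h
            rwa [if_pos (by omega)] at h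
      · left
        rw [litTrue_two_mul, hnew]
        simpa using hR
    · refine ⟨_, List.mem_singleton_self _, ?_⟩
      rw [hw.nv, litTrue_two_mul_add_one, hnew]
      exact decide_eq_true Relation.ReflTransGen.refl
    · refine ⟨_, List.mem_singleton_self _, ?_⟩
      rw [hw.nv, litTrue_two_mul, hnew]
      exact decide_eq_false hτ

/-- All edge clauses are padded to three literals for a uniform encoding. The third is a literal
over the backdoor or repeats the first, so at most two distinct literals remain. -/
theorem isBackdoor_edgeClauses [NeZero (n + G.N w)] :
    IsStrong2SatBackdoor (ofCodes (n + G.N w) (edgeClauses G w))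
      (B.map (Fin.castLEEmb (Nat.le_add_right n (G.N w)))) := by
  intro τ C hC
  simp only [CNF.restrict, List.mem_map, List.mem_filter] at hC
  obtain ⟨C', ⟨hC', -⟩, rfl⟩ := hC
  obtain ⟨C, hC, rfl⟩ := List.mem_map.1 hC'
  have hshort : ∀ a : ℕ, ((List.map (ofCode (n + G.N w)) [a]).filter fun l => decide
      (l.1 ∉ B.map (Fin.castLEEmb (Nat.le_add_right n (G.N w))))).toFinset.card ≤ 2 := by
    intro a
    refine (List.toFinset_card_le _).trans ((List.length_filter_le _ _).trans ?_)
    simp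
  rcases (mem_edgeClauses G).1 hC with ⟨x, hx, y, hy, rfl⟩ | rfl | rfl
  · obtain ⟨a, b, c, habc, hc⟩ : ∃ a b c, edgeClause G w x y = [a, b, c] ∧
        (c = a ∨ (ofCode (n + G.N w) c).1 ∈
          B.map (Fin.castLEEmb (Nat.le_add_right n (G.N w)))) := by
      refine ⟨_, _, _, rfl, ?_⟩
      simp only [Bool.cond_eq_ite, ltb_iff]
      split_ifs with h
      · exact Or.inl rfl
      · right
        obtain ⟨v, hv, hv'⟩ := hw.inSet_iff.1 (G.lab_mem w x y (by omega))
        refine Finset.mem_map.2 ⟨v, hv, Fin.ext ?_⟩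
        have := v.isLt
        simp only [ofCode, flipLit_div, ← hv', Fin.val_ofNat, Fin.castLEEmb_apply, Fin.val_castLE]
        exact (Nat.mod_eq_of_lt (by omega)).symm
    rw [habc]
    refine (Finset.card_le_card (t := {ofCode (n + G.N w) a, ofCode (n + G.N w) b}) ?_).trans
      Finset.card_le_two
    intro l hl
    simp only [List.mem_toFinset, List.mem_filter, List.map_cons, List.map_nil, List.mem_cons,
      List.not_mem_nil, or_false, decide_eq_true_eq] at hl
    rw [Finset.mem_insert, Finset.mem_singleton]
    obtain ⟨rfl | rfl | rfl, hl⟩ := hl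
    · exact Or.inl rfl
    · exact Or.inr rfl
    · rcases hc with rfl | hc
      · exact Or.inl rfl
      · exact absurd hc hl
  · exact hshort _
  · exact hshort _

omit hw in
theorem neZero_add_graph (n : ℕ) (w : List ℕ) : NeZero (n + G.N w) :=
  ⟨by have := G.s_lt w; omega⟩

/-- The formula that says that the target is not reachable, with the given backdoor. -/
def backdoorInstance : BackdoorInstance :=
  haveI := neZero_add_graph G n w
  { n := n + G.N w
    φ := ofCodes (n + G.N w) (edgeClauses G w)
    B := B.map (Fin.castLEEmb (Nat.le_add_right n (G.N w)))
    isBackdoor := isBackdoor_edgeClauses G hw }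

theorem encode_backdoorInstance : (backdoorInstance G hw).encode = backdoorOutput G w := by
  have := neZero_add_graph G n w
  have h1 : (backdoorInstance G hw).encode = (ofCodes (n + G.N w) (edgeClauses G w)).encode ++
    encodeVarSet (B.map (Fin.castLEEmb (Nat.le_add_right n (G.N w)))) := rfl
  rw [h1, encode_ofCodes (edgeClauses_lt G hw), hw.encodeVarSet_map, length_edgeClauses,
    blocks_edgeClauses, backdoorOutput, hw.nv]
  rfl

theorem satisfiable_backdoorInstance :
    (backdoorInstance G hw).φ.Satisfiable ↔ ∃ τ, ¬ G.Reach w τ := by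
  have := neZero_add_graph G n w
  have h1 : (backdoorInstance G hw).φ = ofCodes (n + G.N w) (edgeClauses G w) := rfl
  rw [h1]
  exact (satisfiable_ofCodes (edgeClauses_lt G hw)).trans (exists_model_edgeClauses_iff G hw)

theorem card_backdoorInstance : (backdoorInstance G hw).B.card = B.card := Finset.card_map _

end Backdoor

theorem PTL.map {α : Type} [Ctx α] {n : α → ℕ} {g : α → ℕ → ℕ} (hn : PT n)
    (hg : PT fun p : α × ℕ => g p.1 p.2) : PTL (fun a => (List.range (n a)).map (g a)) := by
  simp only [List.map_eq_flatMap]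
  exact .flatMap hn (.cons hg .nil)

/-- The binary length counts the positions `j` with `n / 2 ^ j > 0`, all of which are below `n`; as
a bounded sum it becomes a `PT` function. -/
theorem natSize_eq_sumLt (n : ℕ) : n.size = sumLt n fun j => (ltb 0 (shiftBits n j)).toNat := by
  have h : ∀ j, (ltb 0 (shiftBits n j)).toNat = if j < n.size then 1 else 0 := by
    intro j
    rw [shiftBits_eq]
    simp only [Nat.lt_size]
    by_cases hj : 2 ^ j ≤ n
    · rw [if_pos hj, ltb_iff.2 (Nat.div_pos hj (by positivity))]
      rfl
    · rw [if_neg hj, ltb_false_iff.2 (Nat.div_eq_of_lt (not_le.1 hj)).le]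
      rfl
  simp only [sumLt, h]
  rw [Finset.sum_boole]
  have h2 : (Finset.range n).filter (fun j => j < n.size) = Finset.range n.size := by
    ext j
    have := size_le_self n
    simp only [Finset.mem_filter, Finset.mem_range]
    omega
  simp [h2]

@[fun_prop] theorem PT.natSize {α : Type} [Ctx α] {f : α → ℕ} (hf : PT f) :
    PT (fun a => (f a).size) := by
  simp only [natSize_eq_sumLt]; fun_prop

theorem two_pow_natSize_le (n : ℕ) : 2 ^ n.size ≤ 2 * n + 1 := by
  rcases Nat.eq_zero_or_pos n with rfl | hn
  · simp
  · have h : 2 ^ (n.size - 1) ≤ n := Nat.lt_size.1 (by have := Nat.size_pos.2 hn; omega)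
    have h2 : n.size = n.size - 1 + 1 := by have := Nat.size_pos.2 hn; omega
    rw [h2, pow_succ]
    omega

/-- A power with variable exponent is not available in `PT`. This one is, because it counts the
numbers that vanish after `n.size` halvings, and none of these exceeds `2 * n`. -/
theorem two_pow_natSize_eq_sumLt (n : ℕ) :
    2 ^ n.size = sumLt (2 * n + 1) fun x => (eqb (shiftBits x n.size) 0).toNat := by
  have h : ∀ x, (eqb (shiftBits x n.size) 0).toNat = if x < 2 ^ n.size then 1 else 0 := by
    intro x
    rw [shiftBits_eq]
    by_cases hx : x < 2 ^ n.size
    · rw [if_pos hx, eqb_iff.2 (Nat.div_eq_of_lt hx)]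
      rfl
    · rw [if_neg hx, eqb_false_iff.2 (Nat.div_pos (not_lt.1 hx) (by positivity)).ne']
      rfl
  simp only [sumLt, h]
  rw [Finset.sum_boole]
  have h2 : (Finset.range (2 * n + 1)).filter (fun x => x < 2 ^ n.size) =
      Finset.range (2 ^ n.size) := by
    ext x
    have := two_pow_natSize_le n
    simp only [Finset.mem_filter, Finset.mem_range]
    omega
  simp [h2]

@[fun_prop] theorem PT.two_pow_natSize {α : Type} [Ctx α] {f : α → ℕ} (hf : PT f) :
    PT (fun a => 2 ^ (f a).size) := by
  simp only [two_pow_natSize_eq_sumLt]; fun_prop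

theorem eq_of_bitAt {k x y : ℕ} (hx : x < 2 ^ k) (hy : y < 2 ^ k)
    (h : ∀ q < k, bitAt x q = bitAt y q) : x = y := by
  refine Nat.eq_of_testBit_eq fun q => ?_
  by_cases hq : q < k
  · simpa only [bitAt_eq_testBit] using h q hq
  · have hk : 2 ^ k ≤ 2 ^ q := Nat.pow_le_pow_right two_pos (not_lt.1 hq)
    rw [Nat.testBit_lt_two_pow (hx.trans_le hk), Nat.testBit_lt_two_pow (hy.trans_le hk)]

theorem litTrue_two_mul_add_toNat {σ : ℕ → Bool} {v : ℕ} {b : Bool} :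
    LitTrue σ (2 * v + b.toNat) ↔ σ v = b := by
  cases b
  · simpa using litTrue_two_mul
  · exact litTrue_two_mul_add_one

/-- Idle steps turn a short path into a sequence of exactly the prescribed length, so that a fixed
number of layers can hold it. -/
theorem reachIn_iff_exists_seq {E : ℕ → ℕ → Prop} {s k v : ℕ} : ReachIn E s k v ↔
    ∃ x : ℕ → ℕ, x 0 = s ∧ x k = v ∧ ∀ i < k, x i = x (i + 1) ∨ E (x i) (x (i + 1)) := by
  constructor
  · intro h
    induction k generalizing v with
    | zero => exact ⟨fun _ => s, rfl, Eq.symm h, fun i hi => absurd hi (Nat.not_lt_zero i)⟩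
    | succ k ih =>
      obtain ⟨u, hu, huv⟩ := h
      obtain ⟨x, h0, hk, hx⟩ := ih hu
      refine ⟨Function.update x (k + 1) v, ?_, by simp, fun i hi => ?_⟩
      · rwa [Function.update_of_ne (by omega)]
      · rw [Function.update_of_ne (by omega)]
        rcases Nat.lt_succ_iff_lt_or_eq.1 hi with hi | rfl
        · rw [Function.update_of_ne (by omega)]
          exact hx i hi
        · rw [Function.update_self, hk]
          exact huv
  · rintro ⟨x, rfl, rfl, hx⟩
    induction k with
    | zero => rfl
    | succ k ih => exact ⟨x k, ih fun i hi => hx i (by omega), hx k (by omega)⟩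

/-! ## From branching programs to modulators to logarithmic pathwidth -/

/-- The literal that says that bit `p` of the vertex in layer `i` is `b`. -/
def bitLit (G : PGraph) (w : List ℕ) (i p : ℕ) (b : Bool) : ℕ :=
  2 * (numVars w + (i * (G.N w).size + p)) + b.toNat

/-- The label of the step from `x` to `y`, where staying is always possible. -/
def stepLab (G : PGraph) (w : List ℕ) (x y : ℕ) : ℕ :=
  bif eqb x y then 1 else bif ltb x (G.N w) && ltb y (G.N w) then G.lab w x y else 0

/-- The clause that forbids that the vertex in layer `i` is `x` and that the next one is `y`,
unless that step is possible. -/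
def stepClause (G : PGraph) (w : List ℕ) (i x y : ℕ) : List ℕ :=
  (bif ltb (stepLab G w x y) 2 then bitLit G w i 0 (xor (!(bitAt x 0)) (eqb (stepLab G w x y) 1))
    else stepLab G w x y - 2) ::
  ((List.range (G.N w).size).map (fun p => bitLit G w i p (!(bitAt x p))) ++
    (List.range (G.N w).size).map (fun p => bitLit G w (i + 1) p (!(bitAt y p))))

/-- The clauses that say that the layers contain a walk from the source to the target. -/
def layerClauses (G : PGraph) (w : List ℕ) : List (List ℕ) :=
  ((List.range (G.N w)).flatMap fun i => (List.range (2 ^ (G.N w).size)).flatMap fun x =>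
      (List.range (2 ^ (G.N w).size)).map fun y => stepClause G w i x y) ++
    ((List.range (G.N w).size).map fun p => [bitLit G w 0 p (bitAt (G.s w) p)]) ++
    (List.range (G.N w).size).map fun p => [bitLit G w (G.N w) p (bitAt (G.t w) p)]

/-- The first variable of bag `j`. -/
def layerBagStart (G : PGraph) (w : List ℕ) (j : ℕ) : ℕ :=
  bif ltb j (numVars w) then j else numVars w + (j - numVars w) * (G.N w).size

/-- The number of variables of bag `j`. -/
def layerBagLen (G : PGraph) (w : List ℕ) (j : ℕ) : ℕ :=
  bif ltb j (numVars w) then bif inSet w j then 0 else 1 else 2 * (G.N w).size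

/-- The variables of bag `j`. -/
def layerBag (G : PGraph) (w : List ℕ) (j : ℕ) : List ℕ :=
  (List.range (layerBagLen G w j)).map fun q => layerBagStart G w j + q

/-- The encoding of the formula that says that the target can be reached, and of its path
decomposition. -/
def logPwOutput (G : PGraph) (w : List ℕ) : List ℕ :=
  (numVars w + (G.N w + 1) * (G.N w).size) ::
    (G.N w * (2 ^ (G.N w).size * 2 ^ (G.N w).size) + (G.N w).size + (G.N w).size) ::
    (((List.range (G.N w)).flatMap fun i => (List.range (2 ^ (G.N w).size)).flatMap fun x =>
      (List.range (2 ^ (G.N w).size)).flatMap fun y =>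
        ((G.N w).size + (G.N w).size + 1) :: stepClause G w i x y) ++
    ((List.range (G.N w).size).flatMap fun p => [1, bitLit G w 0 p (bitAt (G.s w) p)]) ++
    ((List.range (G.N w).size).flatMap fun p => [1, bitLit G w (G.N w) p (bitAt (G.t w) p)])) ++
  (copySet w ++ ((numVars w + G.N w) ::
    (List.range (numVars w + G.N w)).flatMap fun j => layerBagLen G w j :: layerBag G w j))

@[fun_prop] theorem PT.xor {α : Type} [Ctx α] {f g : α → Bool} (hf : PT f) (hg : PT g) :
    PT (fun a => Bool.xor (f a) (g a)) := by
  have : (fun a => Bool.xor (f a) (g a)) = fun a => (f a && !(g a)) || (!(f a) && g a) := by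
    funext a
    cases f a <;> cases g a <;> rfl
  rw [this]
  fun_prop

@[fun_prop] theorem PT.bitLit {α : Type} [Ctx α] (G : PGraph) {w : α → List ℕ} {i p : α → ℕ}
    {b : α → Bool} (hw : PT w) (hi : PT i) (hp : PT p) (hb : PT b) :
    PT (fun a => bitLit G (w a) (i a) (p a) (b a)) := by
  unfold SatHyp.bitLit; fun_prop

@[fun_prop] theorem PT.stepLab {α : Type} [Ctx α] (G : PGraph) {w : α → List ℕ} {x y : α → ℕ}
    (hw : PT w) (hx : PT x) (hy : PT y) : PT (fun a => stepLab G (w a) (x a) (y a)) := by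
  unfold SatHyp.stepLab; fun_prop

@[fun_prop] theorem PT.layerBagStart {α : Type} [Ctx α] (G : PGraph) {w : α → List ℕ} {j : α → ℕ}
    (hw : PT w) (hj : PT j) : PT (fun a => layerBagStart G (w a) (j a)) := by
  unfold SatHyp.layerBagStart; fun_prop

@[fun_prop] theorem PT.layerBagLen {α : Type} [Ctx α] (G : PGraph) {w : α → List ℕ} {j : α → ℕ}
    (hw : PT w) (hj : PT j) : PT (fun a => layerBagLen G (w a) (j a)) := by
  unfold SatHyp.layerBagLen; fun_prop

theorem ptl_logPwOutput (G : PGraph) : PTL (logPwOutput G) := by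
  refine .cons (by fun_prop) (.cons (by fun_prop) (.append (.append (.append ?_ ?_) ?_)
    (.append (.copySet (by fun_prop)) (.cons (by fun_prop) ?_))))
  · refine .flatMap (by fun_prop) (.flatMap (by fun_prop) (.flatMap (by fun_prop)
      (.cons (by fun_prop) (.cons (by fun_prop) (.append ?_ ?_)))))
    · exact .map (by fun_prop) (by fun_prop)
    · exact .map (by fun_prop) (by fun_prop)
  · exact .flatMap (by fun_prop) (.cons (by fun_prop) (.cons (by fun_prop) .nil))
  · exact .flatMap (by fun_prop) (.cons (by fun_prop) (.cons (by fun_prop) .nil))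
  · exact .flatMap (by fun_prop) (.cons (by fun_prop) (.map (by fun_prop) (by fun_prop)))

section LogPw

variable (G : PGraph) {w : List ℕ} {n : ℕ} {φ : CNF n} {B : Finset (Fin n)}

theorem PGraph.N_pos : 0 < G.N w := (Nat.zero_le _).trans_lt (G.s_lt w)

theorem PGraph.size_pos : 0 < (G.N w).size := Nat.size_pos.2 G.N_pos

theorem length_stepClause {i x y : ℕ} :
    (stepClause G w i x y).length = (G.N w).size + (G.N w).size + 1 := by
  simp [stepClause]

theorem length_layerClauses : (layerClauses G w).length =
    G.N w * (2 ^ (G.N w).size * 2 ^ (G.N w).size) + (G.N w).size + (G.N w).size := by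
  simp [layerClauses, List.length_flatMap, add_assoc]

theorem blocks_flatMap {k : ℕ} {f : ℕ → List (List ℕ)} :
    blocks ((List.range k).flatMap f) = (List.range k).flatMap fun i => blocks (f i) :=
  List.flatMap_assoc

theorem blocks_map {k : ℕ} {f : ℕ → List ℕ} :
    blocks ((List.range k).map f) = (List.range k).flatMap fun i => (f i).length :: f i :=
  List.flatMap_map _ _ _

theorem blocks_layerClauses : blocks (layerClauses G w) =
    ((List.range (G.N w)).flatMap fun i => (List.range (2 ^ (G.N w).size)).flatMap fun x =>
      (List.range (2 ^ (G.N w).size)).flatMap fun y =>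
        ((G.N w).size + (G.N w).size + 1) :: stepClause G w i x y) ++
    ((List.range (G.N w).size).flatMap fun p => [1, bitLit G w 0 p (bitAt (G.s w) p)]) ++
    ((List.range (G.N w).size).flatMap fun p => [1, bitLit G w (G.N w) p (bitAt (G.t w) p)]) := by
  simp only [layerClauses, blocks_append, blocks_flatMap, blocks_map, length_stepClause]
  rfl

theorem mem_layerClauses {C : List ℕ} : C ∈ layerClauses G w ↔
    (∃ i < G.N w, ∃ x < 2 ^ (G.N w).size, ∃ y < 2 ^ (G.N w).size, C = stepClause G w i x y) ∨
      (∃ p < (G.N w).size, C = [bitLit G w 0 p (bitAt (G.s w) p)]) ∨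
      ∃ p < (G.N w).size, C = [bitLit G w (G.N w) p (bitAt (G.t w) p)] := by
  simp only [layerClauses, List.mem_append, List.mem_flatMap, List.mem_range, List.mem_map, or_assoc]
  simp only [eq_comm]

theorem mem_stepClause {i x y a : ℕ} : a ∈ stepClause G w i x y →
    (2 ≤ G.lab w x y ∧ a = G.lab w x y - 2) ∨
      ∃ j p b, (j = i ∨ j = i + 1) ∧ p < (G.N w).size ∧ a = bitLit G w j p b := by
  intro h
  simp only [stepClause, List.mem_cons, List.mem_append, List.mem_map, List.mem_range] at h
  rcases h with h | ⟨p, hp, rfl⟩ | ⟨p, hp, rfl⟩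
  · by_cases h2 : stepLab G w x y < 2
    · rw [ltb_iff.2 h2, cond_true] at h
      exact Or.inr ⟨i, 0, _, Or.inl rfl, G.size_pos, h⟩
    · rw [ltb_false_iff.2 (not_lt.1 h2), cond_false] at h
      have h3 : stepLab G w x y = G.lab w x y := by
        unfold stepLab at h2 ⊢
        simp only [Bool.cond_eq_ite] at h2 ⊢
        split_ifs at h2 ⊢ <;> first | rfl | omega
      rw [h3] at h h2
      exact Or.inl ⟨not_lt.1 h2, h⟩
  · exact Or.inr ⟨i, p, _, Or.inl rfl, hp, rfl⟩
  · exact Or.inr ⟨i + 1, p, _, Or.inr rfl, hp, rfl⟩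

theorem labTrue_stepLab {τ : ℕ → Bool} {x y : ℕ} :
    LabTrue τ (stepLab G w x y) ↔ x = y ∨ LabEdge (G.N w) (G.lab w) τ x y := by
  unfold stepLab LabEdge
  by_cases h1 : x = y
  · rw [eqb_iff.2 h1, cond_true]
    simp [h1, labTrue_one]
  · rw [eqb_false_iff.2 h1, cond_false]
    by_cases h2 : x < G.N w ∧ y < G.N w
    · rw [ltb_iff.2 h2.1, ltb_iff.2 h2.2, Bool.and_self, cond_true]
      simp [h1, h2]
    · have h3 : (ltb x (G.N w) && ltb y (G.N w)) = false := by
        rw [Bool.eq_false_iff, ne_eq, Bool.and_eq_true, ltb_iff, ltb_iff]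
        exact h2
      rw [h3, cond_false]
      simp only [not_labTrue_zero, h1, false_or, false_iff]
      exact fun h => h2 ⟨h.1, h.2.1⟩

theorem litTrue_bitLit {σ : ℕ → Bool} {i p : ℕ} {b : Bool} :
    LitTrue σ (bitLit G w i p b) ↔ σ (numVars w + (i * (G.N w).size + p)) = b :=
  litTrue_two_mul_add_toNat

/-- The vertex in layer `i` is `x`. -/
def AtLayer (G : PGraph) (w : List ℕ) (σ : ℕ → Bool) (i x : ℕ) : Prop :=
  ∀ p < (G.N w).size, σ (numVars w + (i * (G.N w).size + p)) = bitAt x p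

theorem exists_atLayer (σ : ℕ → Bool) (i : ℕ) : ∃ x < 2 ^ (G.N w).size, AtLayer G w σ i x := by
  obtain ⟨x, hx, h⟩ := exists_bits (G.N w).size fun p => σ (numVars w + (i * (G.N w).size + p))
  exact ⟨x, hx, fun p hp => (h p hp).symm⟩

theorem AtLayer.unique {σ : ℕ → Bool} {i x y : ℕ} (hx : AtLayer G w σ i x)
    (hy : AtLayer G w σ i y) (hx' : x < 2 ^ (G.N w).size) (hy' : y < 2 ^ (G.N w).size) : x = y :=
  eq_of_bitAt hx' hy' fun q hq => (hx q hq).symm.trans (hy q hq)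

/-- The bit literals fail exactly if the two layers spell `x` and `y`, and then the first literal
decides. For a constant label that literal is a filler on bit `0` of layer `i`: for label `1` it
agrees with `x` and makes the clause a tautology, for label `0` it repeats a bit literal. Bit `0`
exists because the graph has a vertex. -/
theorem stepClause_true_iff {σ : ℕ → Bool} {i x y : ℕ} :
    (∃ a ∈ stepClause G w i x y, LitTrue σ a) ↔
      (AtLayer G w σ i x → AtLayer G w σ (i + 1) y → LabTrue σ (stepLab G w x y)) := by
  have hpos := G.size_pos (w := w)
  have hnot : ∀ a b : Bool, a = !b ↔ a ≠ b := by decide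
  by_cases hx : AtLayer G w σ i x
  · by_cases hy : AtLayer G w σ (i + 1) y
    · simp only [hx, hy, forall_true_left]
      simp only [stepClause, List.mem_cons, List.mem_append, List.mem_map, List.mem_range,
        exists_eq_or_imp]
      rw [or_iff_left]
      · match hl : stepLab G w x y with
        | 0 =>
          refine iff_of_false (fun h => ?_) not_labTrue_zero
          rw [ltb_iff.2 (by omega), cond_true, litTrue_bitLit, hx 0 hpos,
            eqb_false_iff.2 (by omega)] at h
          simp at h
        | 1 =>
          refine iff_of_true ?_ labTrue_one
          rw [ltb_iff.2 (by omega), cond_true, litTrue_bitLit, hx 0 hpos, eqb_iff.2 rfl]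
          simp
        | a + 2 =>
          rw [ltb_false_iff.2 (by omega), cond_false, labTrue_add_two]
          rfl
      · rintro ⟨a, ⟨p, hp, rfl⟩ | ⟨p, hp, rfl⟩, h⟩
        · rw [litTrue_bitLit, hnot] at h
          exact h (hx p hp)
        · rw [litTrue_bitLit, hnot] at h
          exact h (hy p hp)
    · refine iff_of_true ?_ fun _ h => absurd h hy
      simp only [AtLayer, not_forall] at hy
      obtain ⟨p, hp, h⟩ := hy
      refine ⟨bitLit G w (i + 1) p (!(bitAt y p)), ?_, (litTrue_bitLit G).2 ((hnot _ _).2 h)⟩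
      exact List.mem_cons_of_mem _ (List.mem_append_right _
        (List.mem_map.2 ⟨p, List.mem_range.2 hp, rfl⟩))
  · refine iff_of_true ?_ fun h => absurd h hx
    simp only [AtLayer, not_forall] at hx
    obtain ⟨p, hp, h⟩ := hx
    refine ⟨bitLit G w i p (!(bitAt x p)), ?_, (litTrue_bitLit G).2 ((hnot _ _).2 h)⟩
    exact List.mem_cons_of_mem _ (List.mem_append_left _
      (List.mem_map.2 ⟨p, List.mem_range.2 hp, rfl⟩))

theorem model_layerClauses_iff {σ : ℕ → Bool} :
    (∀ C ∈ layerClauses G w, ∃ a ∈ C, LitTrue σ a) ↔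
      (∀ i < G.N w, ∀ x < 2 ^ (G.N w).size, ∀ y < 2 ^ (G.N w).size,
        AtLayer G w σ i x → AtLayer G w σ (i + 1) y → LabTrue σ (stepLab G w x y)) ∧
      AtLayer G w σ 0 (G.s w) ∧ AtLayer G w σ (G.N w) (G.t w) := by
  constructor
  · intro h
    refine ⟨fun i hi x hx y hy => ?_, fun p hp => ?_, fun p hp => ?_⟩
    · exact (stepClause_true_iff G).1
        (h _ ((mem_layerClauses G).2 (Or.inl ⟨i, hi, x, hx, y, hy, rfl⟩)))
    · simpa [litTrue_bitLit] using h _ ((mem_layerClauses G).2 (Or.inr (Or.inl ⟨p, hp, rfl⟩)))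
    · simpa [litTrue_bitLit] using h _ ((mem_layerClauses G).2 (Or.inr (Or.inr ⟨p, hp, rfl⟩)))
  · rintro ⟨h1, h2, h3⟩ C hC
    rcases (mem_layerClauses G).1 hC with ⟨i, hi, x, hx, y, hy, rfl⟩ | ⟨p, hp, rfl⟩ | ⟨p, hp, rfl⟩
    · exact (stepClause_true_iff G).2 (h1 i hi x hx y hy)
    · exact ⟨_, List.mem_singleton_self _, (litTrue_bitLit G).2 (h2 p hp)⟩
    · exact ⟨_, List.mem_singleton_self _, (litTrue_bitLit G).2 (h3 p hp)⟩

theorem reach_iff_exists_seq {τ : ℕ → Bool} : G.Reach w τ ↔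
    ∃ x : ℕ → ℕ, x 0 = G.s w ∧ x (G.N w) = G.t w ∧
      ∀ i < G.N w, LabTrue τ (stepLab G w (x i) (x (i + 1))) := by
  simp only [labTrue_stepLab]
  rw [← reachIn_iff_exists_seq]
  exact reflTransGen_iff_reachIn (G.s_lt w) fun u v h => h.2.1

theorem stepLab_congr (hw : Encodes w φ B) {τ σ : ℕ → Bool} (h : ∀ v < n, τ v = σ v) {x y : ℕ} :
    LabTrue τ (stepLab G w x y) ↔ LabTrue σ (stepLab G w x y) := by
  rw [labTrue_stepLab, labTrue_stepLab]
  refine or_congr_right ?_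
  unfold LabEdge LabTrue
  refine and_congr_right fun _ => and_congr_right fun _ => or_congr_right (and_congr_right fun h2 => ?_)
  have := hw.lab_lt G h2
  unfold LitTrue
  rw [h _ (by omega)]

/-- A model spells one number per layer, and the step clauses make the sequence a walk, with idling
allowed. Conversely, the bits of a walk extend `τ` to a model, and `τ` stays in force on the
variables below `n`, the only ones that labels mention. -/
theorem exists_model_layerClauses_iff (hw : Encodes w φ B) :
    (∃ σ : ℕ → Bool, ∀ C ∈ layerClauses G w, ∃ a ∈ C, LitTrue σ a) ↔ ∃ τ, G.Reach w τ := by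
  have hN : G.N w < 2 ^ (G.N w).size := Nat.lt_size_self _
  have hs := G.s_lt w
  have ht := G.t_lt w
  simp only [model_layerClauses_iff, reach_iff_exists_seq]
  constructor
  · rintro ⟨σ, h1, h2, h3⟩
    choose x hx hx' using exists_atLayer G (w := w) σ
    refine ⟨σ, x, ?_, ?_, fun i hi => h1 i hi _ (hx i) _ (hx _) (hx' i) (hx' _)⟩
    · exact (hx' 0).unique G h2 (hx 0) (by omega)
    · exact (hx' _).unique G h3 (hx _) (by omega)
  · rintro ⟨τ, x, h0, hT, hx⟩
    -- The walk starts at a vertex, and each step stays put or leads to a vertex, so all its entries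
    -- fit into the available bits.
    have hlt : ∀ i ≤ G.N w, x i < 2 ^ (G.N w).size := by
      intro i
      induction i with
      | zero => omega
      | succ i ih =>
        intro hi
        rcases (labTrue_stepLab G).1 (hx i (by omega)) with h | h
        · exact h ▸ ih (by omega)
        · exact h.2.1.trans hN
    let σ : ℕ → Bool := fun v => if v < n then τ v else
      bitAt (x ((v - n) / (G.N w).size)) ((v - n) % (G.N w).size)
    have hσ : ∀ v < n, τ v = σ v := fun v hv => (if_pos hv).symm
    have hat : ∀ i, AtLayer G w σ i (x i) := by
      intro i p hp
      simp only [σ]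
      rw [hw.nv, if_neg (by omega), Nat.add_sub_cancel_left, add_comm, Nat.add_mul_div_right _ _
        G.size_pos, Nat.add_mul_mod_self_right, Nat.div_eq_of_lt hp, Nat.mod_eq_of_lt hp, zero_add]
    refine ⟨σ, fun i hi y hy z hz hy' hz' => ?_, h0 ▸ hat 0, hT ▸ hat _⟩
    rw [hy'.unique G (hat i) hy (hlt i (by omega)), hz'.unique G (hat _) hz (hlt _ (by omega)),
      ← stepLab_congr G hw hσ]
    exact hx i hi

end LogPw

/-! ### The path decomposition whose bags are pairs of consecutive layers -/

section LogPw

variable (G : PGraph) {w : List ℕ} {n : ℕ} {φ : CNF n} {B : Finset (Fin n)}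

theorem mem_layerBag {j v : ℕ} : v ∈ layerBag G w j ↔
    layerBagStart G w j ≤ v ∧ v < layerBagStart G w j + layerBagLen G w j := by
  simp only [layerBag, List.mem_map, List.mem_range]
  constructor
  · rintro ⟨q, hq, rfl⟩
    omega
  · rintro ⟨h1, h2⟩
    exact ⟨v - layerBagStart G w j, by omega, by omega⟩

theorem mem_layerBag_of_lt {j v : ℕ} (hj : j < numVars w) :
    v ∈ layerBag G w j ↔ v = j ∧ inSet w j = false := by
  rw [mem_layerBag, layerBagStart, layerBagLen, ltb_iff.2 hj, cond_true, cond_true]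
  cases inSet w j
  · simp
    omega
  · simp

theorem mem_layerBag_add {i v : ℕ} : v ∈ layerBag G w (numVars w + i) ↔
    ∃ u < 2 * (G.N w).size, v = numVars w + (i * (G.N w).size + u) := by
  rw [mem_layerBag, layerBagStart, layerBagLen, ltb_false_iff.2 (Nat.le_add_right _ _), cond_false,
    cond_false, Nat.add_sub_cancel_left]
  constructor
  · rintro ⟨h1, h2⟩
    exact ⟨v - (numVars w + i * (G.N w).size), by omega, by omega⟩
  · rintro ⟨u, hu, rfl⟩
    omega

variable (w) in
/-- The number of variables of the formula that says that the target can be reached. -/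
abbrev numLayerVars (n : ℕ) : ℕ := n + (G.N w + 1) * (G.N w).size

theorem le_numLayerVars : n ≤ numLayerVars G w n := Nat.le_add_right _ _

variable (w) in
theorem neZero_numLayerVars (n : ℕ) : NeZero (numLayerVars G w n) :=
  ⟨(Nat.add_pos_right n (Nat.mul_pos (Nat.succ_pos (G.N w)) G.size_pos)).ne'⟩

theorem bitVar_lt {i p : ℕ} (hi : i ≤ G.N w) (hp : p < (G.N w).size) :
    i * (G.N w).size + p < (G.N w + 1) * (G.N w).size := by
  have := Nat.mul_le_mul_right (G.N w).size hi
  rw [Nat.succ_mul]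
  omega

theorem bitLit_div {i p : ℕ} {b : Bool} :
    bitLit G w i p b / 2 = numVars w + (i * (G.N w).size + p) := by
  unfold bitLit
  cases b
  · simp
  · simp only [Bool.toNat_true]
    omega

theorem layerClauses_lt (hw : Encodes w φ B) :
    ∀ C ∈ layerClauses G w, ∀ a ∈ C, a < 2 * numLayerVars G w n := by
  have hbit : ∀ i ≤ G.N w, ∀ p < (G.N w).size, ∀ b,
      bitLit G w i p b < 2 * numLayerVars G w n := by
    intro i hi p hp b
    have := bitVar_lt G hi hp
    have h2 := bitLit_div G (w := w) (i := i) (p := p) (b := b)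
    rw [hw.nv] at h2
    unfold numLayerVars
    omega
  intro C hC a ha
  rcases (mem_layerClauses G).1 hC with ⟨i, hi, x, hx, y, hy, rfl⟩ | ⟨p, hp, rfl⟩ | ⟨p, hp, rfl⟩
  · rcases mem_stepClause G ha with ⟨h, rfl⟩ | ⟨j, p, b, hj, hp, rfl⟩
    · have := hw.lab_lt G h
      unfold numLayerVars
      omega
    · exact hbit _ (by omega) _ hp _
  · rw [List.mem_singleton.1 ha]
    exact hbit _ (by omega) _ hp _
  · rw [List.mem_singleton.1 ha]
    exact hbit _ le_rfl _ hp _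

variable (w B) in
/-- The modulator consists of the variables of the given set. -/
abbrev layerModulator : Finset (Fin (numLayerVars G w n)) :=
  B.map (Fin.castLEEmb (le_numLayerVars G))

variable (w B) in
/-- The vertices of bag `j`. -/
def layerBagSet (j : ℕ) : Finset {v : Fin (numLayerVars G w n) // v ∉ layerModulator G w B} :=
  Finset.univ.filter fun v => v.1.val ∈ layerBag G w j

variable (w B) in
/-- The path decomposition. -/
def layerDecomposition :
    List (Finset {v : Fin (numLayerVars G w n) // v ∉ layerModulator G w B}) :=
  (List.range (n + G.N w)).map (layerBagSet G w B)

theorem mem_layerBagSet {j : ℕ} {v : {v : Fin (numLayerVars G w n) // v ∉ layerModulator G w B}} :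
    v ∈ layerBagSet G w B j ↔ v.1.val ∈ layerBag G w j := by
  simp [layerBagSet]

theorem mem_layerModulator {v : Fin (numLayerVars G w n)} (hw : Encodes w φ B) :
    v ∈ layerModulator G w B ↔ inSet w v.val = true := by
  rw [hw.inSet_iff, Finset.mem_map]
  exact exists_congr fun x => and_congr_right fun _ => Fin.ext_iff

theorem not_mem_layerBag {j v : ℕ} (hw : Encodes w φ B) (h : inSet w v = true) :
    v ∉ layerBag G w j := by
  intro hv
  rcases lt_or_ge j (numVars w) with hj | hj
  · obtain ⟨rfl, h2⟩ := (mem_layerBag_of_lt G hj).1 hv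
    rw [h] at h2
    cases h2
  · obtain ⟨i, rfl⟩ := Nat.exists_eq_add_of_le hj
    obtain ⟨u, -, h2⟩ := (mem_layerBag_add G).1 hv
    obtain ⟨x, -, hx⟩ := hw.inSet_iff.1 h
    have := x.isLt
    rw [hw.nv] at h2
    omega

theorem layerBag_lt {j v : ℕ} (hw : Encodes w φ B) (hj : j < n + G.N w) (h : v ∈ layerBag G w j) :
    v < numLayerVars G w n := by
  rcases lt_or_ge j (numVars w) with hj' | hj'
  · obtain ⟨rfl, -⟩ := (mem_layerBag_of_lt G hj').1 h
    rw [hw.nv] at hj'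
    unfold numLayerVars
    omega
  · obtain ⟨i, rfl⟩ := Nat.exists_eq_add_of_le hj'
    obtain ⟨u, hu, rfl⟩ := (mem_layerBag_add G).1 h
    rw [hw.nv] at hj ⊢
    have := Nat.mul_le_mul_right (G.N w).size (show i + 2 ≤ G.N w + 1 by omega)
    rw [Nat.add_mul] at this
    unfold numLayerVars
    omega

theorem sort_layerBagSet (hw : Encodes w φ B) {j : ℕ} (hj : j < n + G.N w) :
    (((layerBagSet G w B j).map (Function.Embedding.subtype _)).sort (· ≤ ·)).map Fin.val =
      layerBag G w j := by
  refine sort_map_val_eq _ ?_ fun v => ?_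
  · rw [layerBag, List.pairwise_map]
    exact List.pairwise_lt_range.imp fun h => Nat.add_lt_add_left h _
  · constructor
    · intro hv
      refine ⟨⟨v, layerBag_lt G hw hj hv⟩, Finset.mem_map.2 ⟨⟨⟨v, _⟩, fun h => ?_⟩,
        (mem_layerBagSet G).2 hv, rfl⟩, rfl⟩
      exact not_mem_layerBag G hw ((mem_layerModulator G hw).1 h) hv
    · rintro ⟨x, hx, rfl⟩
      obtain ⟨y, hy, rfl⟩ := Finset.mem_map.1 hx
      exact (mem_layerBagSet G).1 hy

theorem card_layerBagSet_le (hw : Encodes w φ B) {j : ℕ} (hj : j < n + G.N w) :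
    (layerBagSet G w B j).card ≤ 2 * (G.N w).size := by
  have h := congrArg List.length (sort_layerBagSet G hw hj)
  have hpos := G.size_pos (w := w)
  simp only [List.length_map, Finset.length_sort, Finset.card_map, layerBag,
    List.length_range] at h
  rw [h, layerBagLen]
  cases ltb j (numVars w) <;> cases inSet w j <;> simp
  omega

theorem exists_layerBag (hw : Encodes w φ B) {v : ℕ} (hv : v < numLayerVars G w n)
    (h : inSet w v = false) : ∃ j < n + G.N w, v ∈ layerBag G w j := by
  have hpos := G.size_pos (w := w)
  have hN := G.N_pos (w := w)
  rcases lt_or_ge v n with hvn | hvn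
  · exact ⟨v, by omega, (mem_layerBag_of_lt G (by rw [hw.nv]; exact hvn)).2 ⟨rfl, h⟩⟩
  · obtain ⟨u, rfl⟩ := Nat.exists_eq_add_of_le hvn
    have hu : u / (G.N w).size < G.N w + 1 := (Nat.div_lt_iff_lt_mul hpos).2
      (Nat.lt_of_add_lt_add_left hv)
    have hmod := Nat.mod_lt u hpos
    have hdiv := Nat.div_add_mod' u (G.N w).size
    rcases Nat.lt_succ_iff_lt_or_eq.1 hu with h1 | h1
    · refine ⟨n + u / (G.N w).size, by omega, ?_⟩
      rw [← hw.nv, mem_layerBag_add]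
      exact ⟨u % (G.N w).size, by omega, by omega⟩
    -- The last layer `N` does not begin a bag of its own; it is the second half of the bag of layer
    -- `N - 1`.
    · refine ⟨n + (G.N w - 1), by omega, ?_⟩
      rw [← hw.nv, mem_layerBag_add]
      refine ⟨(G.N w).size + u % (G.N w).size, by omega, ?_⟩
      obtain ⟨k, hk⟩ := Nat.exists_eq_succ_of_ne_zero hN.ne'
      have h2 : G.N w * (G.N w).size = k * (G.N w).size + (G.N w).size := by
        rw [← Nat.succ_mul, ← hk]
      rw [h1] at hdiv
      rw [show G.N w - 1 = k by omega]
      omega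

/-- From index `numVars w` on, the bags are intervals of equal length whose starting points increase
with the index, so a point in two of them lies in all between. Below that index a bag contains at
most its own index, which no other bag contains. -/
theorem layerBag_contiguous {v i j k : ℕ} (hij : i ≤ j) (hjk : j ≤ k)
    (hi : v ∈ layerBag G w i) (hk : v ∈ layerBag G w k) : v ∈ layerBag G w j := by
  rcases lt_or_ge i (numVars w) with hin | hin
  · obtain ⟨rfl, h⟩ := (mem_layerBag_of_lt G hin).1 hi
    rcases lt_or_ge k (numVars w) with hkn | hkn
    · obtain ⟨rfl, -⟩ := (mem_layerBag_of_lt G hkn).1 hk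
      rwa [← le_antisymm hij hjk]
    · obtain ⟨k, rfl⟩ := Nat.exists_eq_add_of_le hkn
      obtain ⟨u, -, h2⟩ := (mem_layerBag_add G).1 hk
      omega
  · obtain ⟨i, rfl⟩ := Nat.exists_eq_add_of_le hin
    obtain ⟨j, rfl⟩ := Nat.exists_eq_add_of_le (hin.trans hij)
    obtain ⟨k, rfl⟩ := Nat.exists_eq_add_of_le ((hin.trans hij).trans hjk)
    obtain ⟨u, hu, h1⟩ := (mem_layerBag_add G).1 hi
    obtain ⟨u', hu', h2⟩ := (mem_layerBag_add G).1 hk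
    have h3 := Nat.mul_le_mul_right (G.N w).size (Nat.add_le_add_iff_left.1 hij)
    have h4 := Nat.mul_le_mul_right (G.N w).size (Nat.add_le_add_iff_left.1 hjk)
    exact (mem_layerBag_add G).2 ⟨v - (numVars w + j * (G.N w).size), by omega, by omega⟩

/-- Unit clauses create no edges of the primal graph; a step clause involves two consecutive layers
and at most one label, whose variable belongs to the modulator. -/
theorem exists_layerBag_of_clause (hw : Encodes w φ B) {C : List ℕ} (hC : C ∈ layerClauses G w) :
    (∃ a, C = [a]) ∨
      ∃ j < n + G.N w, ∀ a ∈ C, inSet w (a / 2) = true ∨ a / 2 ∈ layerBag G w j := by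
  rcases (mem_layerClauses G).1 hC with ⟨i, hi, x, hx, y, hy, rfl⟩ | ⟨p, hp, rfl⟩ | ⟨p, hp, rfl⟩
  · refine Or.inr ⟨n + i, by omega, fun a ha => ?_⟩
    rcases mem_stepClause G ha with ⟨h, rfl⟩ | ⟨j, p, b, rfl | rfl, hp, rfl⟩
    · exact Or.inl (G.lab_mem w x y h)
    · rw [bitLit_div, ← hw.nv, mem_layerBag_add]
      exact Or.inr ⟨p, by omega, rfl⟩
    · rw [bitLit_div, ← hw.nv, mem_layerBag_add, Nat.succ_mul]
      exact Or.inr ⟨(G.N w).size + p, by omega, by omega⟩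
  · exact Or.inl ⟨_, rfl⟩
  · exact Or.inl ⟨_, rfl⟩

theorem isPathDecomposition_layers (hw : Encodes w φ B) [NeZero (numLayerVars G w n)] :
    IsPathDecomposition
      ((ofCodes (numLayerVars G w n) (layerClauses G w)).primalGraphMinus (layerModulator G w B))
      (layerDecomposition G w B) where
  vertex_mem := by
    rintro ⟨v, hv⟩
    rw [mem_layerModulator G hw, Bool.not_eq_true] at hv
    obtain ⟨j, hj, hvj⟩ := exists_layerBag G hw v.isLt hv
    exact ⟨_, List.mem_map.2 ⟨j, List.mem_range.2 hj, rfl⟩, (mem_layerBagSet G).2 hvj⟩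
  edge_mem := by
    rintro ⟨u, hu⟩ ⟨v, hv⟩ ⟨huv, C, hC, ⟨l, hl, hlu⟩, ⟨l', hl', hlv⟩⟩
    obtain ⟨C, hC', rfl⟩ := List.mem_map.1 hC
    obtain ⟨a, ha, rfl⟩ := List.mem_map.1 hl
    obtain ⟨b, hb, rfl⟩ := List.mem_map.1 hl'
    have hval : ∀ a ∈ C, (ofCode (numLayerVars G w n) a).1.val = a / 2 := by
      intro a ha
      have := layerClauses_lt G hw C hC' a ha
      exact Nat.mod_eq_of_lt (by omega)
    have hua : u.val = a / 2 := by rw [← hval a ha, hlu]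
    have hvb : v.val = b / 2 := by rw [← hval b hb, hlv]
    rw [mem_layerModulator G hw, hua] at hu
    rw [mem_layerModulator G hw, hvb] at hv
    rcases exists_layerBag_of_clause G hw hC' with ⟨c, rfl⟩ | ⟨j, hj, h⟩
    · rw [List.mem_singleton] at ha hb
      exact absurd (Fin.ext (by rw [hua, hvb, ha, hb])) huv
    · refine ⟨_, List.mem_map.2 ⟨j, List.mem_range.2 hj, rfl⟩, (mem_layerBagSet G).2 ?_,
        (mem_layerBagSet G).2 ?_⟩
      · exact hua ▸ (h a ha).resolve_left hu
      · exact hvb ▸ (h b hb).resolve_left hv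
  contiguous := by
    intro v i j k hij hjk hi hk
    have h : ∀ i : Fin (layerDecomposition G w B).length,
        v ∈ (layerDecomposition G w B).get i ↔ v.1.val ∈ layerBag G w i := by
      intro i
      have h1 : (layerDecomposition G w B).get i = layerBagSet G w B i :=
        (List.getElem_map _).trans (congrArg _ (List.getElem_range _))
      rw [h1, mem_layerBagSet]
    rw [h] at hi hk ⊢
    exact layerBag_contiguous G hij hjk hi hk

/-- There is a clause for each pair of codes in consecutive layers, so the formula has at least `2 ^
(2 * (G.N w).size)` clauses. The `2 * (G.N w).size` variables of a bag are thus at most the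
logarithm of its size, and the constant `c = 1` suffices. -/
theorem widthAtMost_layers (hw : Encodes w φ B) [NeZero (numLayerVars G w n)] :
    WidthAtMost (layerDecomposition G w B) ((1 : ℕ) *
      Real.logb 2 (ofCodes (numLayerVars G w n) (layerClauses G w)).size) := by
  intro X hX
  obtain ⟨j, hj, rfl⟩ := List.mem_map.1 hX
  have h1 : ((layerBagSet G w B j).card : ℝ) ≤ (2 * (G.N w).size : ℕ) :=
    Nat.cast_le.2 (card_layerBagSet_le G hw (List.mem_range.1 hj))
  have h2 : 2 ^ (2 * (G.N w).size) ≤ (ofCodes (numLayerVars G w n) (layerClauses G w)).size := by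
    have h3 : (ofCodes (numLayerVars G w n) (layerClauses G w)).length =
        (layerClauses G w).length := List.length_map _
    rw [CNF.size, h3, length_layerClauses, two_mul, pow_add]
    have := Nat.mul_le_mul_right (2 ^ (G.N w).size * 2 ^ (G.N w).size) (G.N_pos (w := w))
    omega
  have h3 : ((2 * (G.N w).size : ℕ) : ℝ) ≤
      Real.logb 2 (ofCodes (numLayerVars G w n) (layerClauses G w)).size := by
    have h4 : (2 : ℝ) ^ (2 * (G.N w).size) ≤
        (ofCodes (numLayerVars G w n) (layerClauses G w)).size := by exact_mod_cast h2
    rw [Real.le_logb_iff_rpow_le one_lt_two ((by positivity : (0 : ℝ) < 2 ^ _).trans_le h4),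
      Real.rpow_natCast]
    exact h4
  rw [Nat.cast_one, one_mul]
  linarith

variable (hw : Encodes w φ B)
include hw

/-- The formula that says that the target can be reached, with its path decomposition. -/
def logPwInstance : LogPwInstance 1 :=
  have := neZero_numLayerVars G w n
  { n := numLayerVars G w n
    φ := ofCodes (numLayerVars G w n) (layerClauses G w)
    M := layerModulator G w B
    D := layerDecomposition G w B
    isDecomposition := isPathDecomposition_layers G hw
    width_le := widthAtMost_layers G hw }

theorem encode_logPwInstance : (logPwInstance G hw).encode = logPwOutput G w := by
  have := neZero_numLayerVars G w n
  have h1 : (logPwInstance G hw).encode = (ofCodes (numLayerVars G w n) (layerClauses G w)).encode ++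
    encodeVarSet (layerModulator G w B) ++ ((logPwInstance G hw).bags.length ::
      blocks (logPwInstance G hw).bags) := LogPwInstance.encode_eq _
  have h2 : (logPwInstance G hw).bags = (List.range (n + G.N w)).map (layerBag G w) := by
    have h3 : (logPwInstance G hw).bags = (layerDecomposition G w B).map fun X =>
      ((X.map (Function.Embedding.subtype _)).sort (· ≤ ·)).map Fin.val := rfl
    rw [h3, layerDecomposition, List.map_map]
    exact List.map_congr_left fun j hj => sort_layerBagSet G hw (List.mem_range.1 hj)
  have h4 : ∀ j, (layerBag G w j).length = layerBagLen G w j := by simp [layerBag]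
  rw [h1, encode_ofCodes (layerClauses_lt G hw), hw.encodeVarSet_map, length_layerClauses,
    blocks_layerClauses, h2, logPwOutput, hw.nv, blocks_map, List.length_map, List.length_range]
  simp only [h4, List.cons_append, List.append_assoc]

theorem satisfiable_logPwInstance : (logPwInstance G hw).φ.Satisfiable ↔ ∃ τ, G.Reach w τ := by
  have := neZero_numLayerVars G w n
  have h1 : (logPwInstance G hw).φ = ofCodes (numLayerVars G w n) (layerClauses G w) := rfl
  rw [h1]
  exact (satisfiable_ofCodes (layerClauses_lt G hw)).trans (exists_model_layerClauses_iff G hw)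

theorem card_logPwInstance : (logPwInstance G hw).M.card = B.card := Finset.card_map _

end LogPw

/-! ## Sizes of the inputs and outputs -/

theorem mag_le_of_forall_le {w : List ℕ} {b : ℕ} (h : ∀ a ∈ w, a ≤ b) :
    Ctx.mag w ≤ w.length * (b + 1) := by
  have := List.sum_le_card_nsmul w b h
  rw [mag_list_def]
  rw [smul_eq_mul] at this
  rw [mul_add_one]
  omega

theorem length_encode_le {n : ℕ} (φ : CNF n) : φ.encode.length ≤ φ.size + 1 := by
  have h : (φ.map fun C => (C.map litCode).length + 1).sum = φ.length + (φ.map List.length).sum := by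
    induction φ with
    | nil => rfl
    | cons C φ ih =>
      simp only [List.map_cons, List.sum_cons, List.length_cons, List.length_map] at ih ⊢
      omega
  rw [CNF.encode_eq, blocks, CNF.size]
  simp only [List.length_cons, List.length_flatMap, List.map_map, Function.comp_def]
  rw [h]
  omega

theorem le_of_mem_encode {n : ℕ} {φ : CNF n} {a : ℕ} (h : a ∈ φ.encode) : a ≤ 2 * φ.size := by
  rw [CNF.encode_eq] at h
  simp only [blocks, List.mem_cons, List.mem_flatMap, List.mem_map] at h
  rcases h with rfl | rfl | ⟨l, ⟨C, hC, rfl⟩, h⟩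
  · unfold CNF.size
    omega
  · unfold CNF.size
    omega
  · rcases h with rfl | h
    · have : C.length ≤ (φ.map List.length).sum :=
        List.single_le_sum (fun _ _ => Nat.zero_le _) _ (List.mem_map.2 ⟨C, hC, rfl⟩)
      rw [List.length_map]
      unfold CNF.size
      omega
    · obtain ⟨l, -, rfl⟩ := List.mem_map.1 h
      have := litCode_lt l
      unfold CNF.size
      omega

theorem length_encodeVarSet_le {n : ℕ} (S : Finset (Fin n)) : (encodeVarSet S).length ≤ n + 1 := by
  have := S.card_le_univ
  rw [Fintype.card_fin] at this
  simpa [encodeVarSet_eq, blocks] using this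

theorem le_of_mem_encodeVarSet {n : ℕ} {S : Finset (Fin n)} {a : ℕ} (h : a ∈ encodeVarSet S) :
    a ≤ n := by
  have := S.card_le_univ
  rw [Fintype.card_fin] at this
  simp only [encodeVarSet_eq, blocks, List.flatMap_cons, List.flatMap_nil, List.append_nil,
    List.mem_cons, List.length_map, Finset.length_sort, List.mem_map] at h
  rcases h with rfl | ⟨x, -, rfl⟩
  · exact this
  · exact x.isLt.le

/-- The length is at most `5 * s ^ 2`, and each entry increased by one is at most `3 * s`, so `15 *
s ^ 3 + 2 ≤ 17 * s ^ 3`. The number `17` also serves as exponent because a single constant is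
expected for both roles. -/
theorem mag_le_of_length_le {w : List ℕ} {s : ℕ} (hs : 1 ≤ s) (h1 : w.length ≤ 2 * s + 2 + s * s)
    (h2 : ∀ a ∈ w, a ≤ 2 * s) : Ctx.mag w + 2 ≤ 17 * s ^ 17 := by
  have h3 := mag_le_of_forall_le h2
  have h4 : w.length * (2 * s + 1) ≤ (5 * (s * s)) * (3 * s) := by
    refine Nat.mul_le_mul ?_ (by omega)
    have := Nat.mul_le_mul_left s hs
    omega
  have h5 : s ^ 3 ≤ s ^ 17 := Nat.pow_le_pow_right hs (by omega)
  have h6 : 1 ≤ s ^ 3 := Nat.one_le_pow _ _ hs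
  have h7 : (5 * (s * s)) * (3 * s) = 15 * s ^ 3 := by ring
  omega

theorem CNF.lt_size {n : ℕ} (φ : CNF n) : n < φ.size := by
  unfold CNF.size
  omega

theorem BackdoorInstance.mag_encode_le (I : BackdoorInstance) :
    Ctx.mag I.encode + 2 ≤ 17 * I.φ.size ^ 17 := by
  have hn := I.φ.lt_size
  refine mag_le_of_length_le (by omega) ?_ fun a ha => ?_
  · have h1 := length_encode_le I.φ
    have h2 := length_encodeVarSet_le I.B
    rw [BackdoorInstance.encode, List.length_append]
    omega
  · rcases List.mem_append.1 ha with ha | ha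
    · exact le_of_mem_encode ha
    · have := le_of_mem_encodeVarSet ha
      omega

theorem LogPwInstance.mag_encode_le {c : ℕ} (I : LogPwInstance c) :
    Ctx.mag I.encode + 2 ≤ 17 * (I.φ.size + I.D.length) ^ 17 := by
  have hn := I.φ.lt_size
  refine mag_le_of_length_le (by omega) ?_ fun a ha => ?_
  · have h1 := length_encode_le I.φ
    have h2 := length_encodeVarSet_le I.M
    have h3 : (I.D.flatMap fun X => encodeVarSet
        (X.map (Function.Embedding.subtype _))).length ≤ I.D.length * (I.n + 1) := by
      rw [List.length_flatMap]
      refine (List.sum_le_card_nsmul _ (I.n + 1) fun a ha => ?_).trans_eq (by simp)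
      obtain ⟨X, -, rfl⟩ := List.mem_map.1 ha
      exact length_encodeVarSet_le _
    have h4 : I.D.length * (I.n + 1) ≤
        (I.φ.size + I.D.length) * (I.φ.size + I.D.length) :=
      Nat.mul_le_mul (by omega) (by omega)
    rw [LogPwInstance.encode, encodeList]
    simp only [List.length_append, List.length_cons]
    omega
  · rw [LogPwInstance.encode, encodeList] at ha
    simp only [List.mem_append, List.mem_cons, List.mem_flatMap] at ha
    rcases ha with (ha | ha) | rfl | ⟨X, -, ha⟩
    · have := le_of_mem_encode ha
      omega
    · have := le_of_mem_encodeVarSet ha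
      omega
    · omega
    · have := le_of_mem_encodeVarSet ha
      omega

theorem BackdoorInstance.size_le_mag (I : BackdoorInstance) : I.φ.size ≤ Ctx.mag I.encode + 1 := by
  refine (size_le_total I.φ (encodeVarSet I.B)).trans ?_
  rw [total_eq, mag_list_def]
  exact Nat.add_le_add_right (Nat.le_add_left _ _) 1

theorem LogPwInstance.size_le_mag {c : ℕ} (I : LogPwInstance c) :
    I.φ.size + I.D.length ≤ 2 * (Ctx.mag I.encode + 1) := by
  have h1 := size_le_total I.φ (encodeVarSet I.M ++ (I.bags.length :: blocks I.bags))
  have h2 : I.bags.length ≤ I.encode.sum := by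
    refine List.single_le_sum (fun _ _ => Nat.zero_le _) _ ?_
    rw [I.encode_eq]
    exact List.mem_append_right _ List.mem_cons_self
  rw [← List.append_assoc, ← I.encode_eq, total_eq] at h1
  rw [I.length_bags] at h2
  rw [mag_list_def]
  omega

/-- The cost of the reduction is absorbed by the main term because `p ≥ 1`. One constant has to
dominate all coefficients and exponents, so `K` is taken as their sum. -/
theorem exists_time_bound (A K₀ K₁ k : ℕ) : ∃ K : ℕ, ∀ (p : ℝ) (m s s' : ℕ), 1 ≤ p → 1 ≤ s →
    m + 2 ≤ A * s ^ A → s' ≤ 2 * ((m + 2) ^ k + 1) →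
    (((m + 2) ^ K₀ : ℕ) : ℝ) + K₁ * p * (s' : ℝ) ^ K₁ ≤ K * p * (s : ℝ) ^ K := by
  refine ⟨A ^ K₀ + K₁ * (2 * (A ^ k + 1)) ^ K₁ + A * K₀ + A * k * K₁,
    fun p m s s' hp hs hm hs' => ?_⟩
  set K := A ^ K₀ + K₁ * (2 * (A ^ k + 1)) ^ K₁ + A * K₀ + A * k * K₁ with hK
  have h1 : (m + 2) ^ K₀ ≤ A ^ K₀ * s ^ K :=
    calc (m + 2) ^ K₀ ≤ (A * s ^ A) ^ K₀ := Nat.pow_le_pow_left hm _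
      _ = A ^ K₀ * s ^ (A * K₀) := by rw [mul_pow, ← pow_mul]
      _ ≤ A ^ K₀ * s ^ K := Nat.mul_le_mul_left _ (Nat.pow_le_pow_right hs (by omega))
  have h2 : s' ≤ 2 * (A ^ k + 1) * s ^ (A * k) := by
    have h3 : (m + 2) ^ k ≤ A ^ k * s ^ (A * k) := by
      rw [pow_mul, ← mul_pow]
      exact Nat.pow_le_pow_left hm _
    have h4 : 1 ≤ s ^ (A * k) := Nat.one_le_pow _ _ hs
    calc s' ≤ 2 * ((m + 2) ^ k + 1) := hs'
      _ ≤ 2 * (A ^ k * s ^ (A * k) + s ^ (A * k)) := by omega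
      _ = _ := by ring
  have h3 : s' ^ K₁ ≤ (2 * (A ^ k + 1)) ^ K₁ * s ^ K :=
    calc s' ^ K₁ ≤ (2 * (A ^ k + 1) * s ^ (A * k)) ^ K₁ := Nat.pow_le_pow_left h2 _
      _ = (2 * (A ^ k + 1)) ^ K₁ * s ^ (A * k * K₁) := by rw [mul_pow, ← pow_mul]
      _ ≤ _ := Nat.mul_le_mul_left _ (Nat.pow_le_pow_right hs (by omega))
  have h1' : (((m + 2) ^ K₀ : ℕ) : ℝ) ≤ (A ^ K₀ : ℕ) * p * (s : ℝ) ^ K := by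
    calc (((m + 2) ^ K₀ : ℕ) : ℝ) ≤ ((A ^ K₀ * s ^ K : ℕ) : ℝ) := Nat.cast_le.2 h1
      _ = (A ^ K₀ : ℕ) * 1 * (s : ℝ) ^ K := by push_cast; ring
      _ ≤ _ := by gcongr
  have h3' : (s' : ℝ) ^ K₁ ≤ ((2 * (A ^ k + 1)) ^ K₁ : ℕ) * (s : ℝ) ^ K := by exact_mod_cast h3
  calc (((m + 2) ^ K₀ : ℕ) : ℝ) + K₁ * p * (s' : ℝ) ^ K₁
      ≤ (A ^ K₀ : ℕ) * p * (s : ℝ) ^ K +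
        K₁ * p * (((2 * (A ^ k + 1)) ^ K₁ : ℕ) * (s : ℝ) ^ K) := by gcongr
    _ = ((A ^ K₀ + K₁ * (2 * (A ^ k + 1)) ^ K₁ : ℕ) : ℝ) * p * (s : ℝ) ^ K := by push_cast; ring
    _ ≤ K * p * (s : ℝ) ^ K := by
      gcongr
      omega

/-! ## The two reductions -/

theorem BackdoorInstance.encodes (I : BackdoorInstance) : Encodes I.encode I.φ I.B := by
  have := encodes_append I.φ I.B []
  rwa [List.append_nil] at this

theorem BackdoorInstance.satisfiable_iff (I : BackdoorInstance) :
    I.φ.Satisfiable ↔ ∃ τ, cycleGraph.compl.Reach I.encode τ := by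
  rw [satisfiable_iff_not_cycle I.encodes I.isBackdoor]
  exact exists_congr fun τ => (PGraph.reach_compl _ _ _).symm

/-- A time bound of the form `K * x ^ parameter * size ^ K` is inherited along a polynomial time
reduction that does not change the parameter. -/
theorem DecidesInTime.reduce_sized {ι κ : Type} {encι : ι → List ℕ} {encκ : κ → List ℕ}
    {yesι : ι → Prop} {yesκ : κ → Prop} {parι : ι → ℕ} {parκ : κ → ℕ} {sizeι : ι → ℕ}
    {sizeκ : κ → ℕ} {x : ℝ} (hx : 1 ≤ x) {A : ℕ} (hι : ∀ I, 1 ≤ sizeι I)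
    (hmagι : ∀ I, Ctx.mag (encι I) + 2 ≤ A * sizeι I ^ A)
    (hsizeκ : ∀ J, sizeκ J ≤ 2 * (Ctx.mag (encκ J) + 1)) {L : List ℕ → List ℕ} (hL : PTL L)
    (f : ι → κ) (henc : ∀ I, encκ (f I) = L (encι I)) (hyes : ∀ I, yesκ (f I) ↔ yesι I)
    (hpar : ∀ I, parκ (f I) = parι I)
    (h : ∃ (P : Prog) (K : ℕ), DecidesInTime P encκ yesκ
      fun J => K * x ^ parκ J * (sizeκ J : ℝ) ^ K) :
    ∃ (P : Prog) (K : ℕ), DecidesInTime P encι yesι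
      fun I => K * x ^ parι I * (sizeι I : ℝ) ^ K := by
  obtain ⟨P, K₁, hP⟩ := h
  obtain ⟨Q, K₀, hQ⟩ := hP.reduce hL f henc hyes
  obtain ⟨k, hk⟩ := hL.polyBounded
  obtain ⟨K, hK⟩ := exists_time_bound A K₀ K₁ k
  refine ⟨Q, K, fun I => ?_⟩
  obtain ⟨t, σ, h1, h2, h3⟩ := hQ I
  refine ⟨t, σ, h1, h2, h3.trans ?_⟩
  simp only [hpar]
  refine hK _ _ _ _ (one_le_pow₀ hx) (hι I) (hmagι I) ((hsizeκ _).trans ?_)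
  rw [henc]
  have : Ctx.mag (L (encι I)) ≤ (Ctx.mag (encι I) + 2) ^ k := hk (encι I)
  omega

end SatHyp

theorem mainTheorem2 :
    (∃ ε : ℝ, 0 < ε ∧ ε < 1 ∧ ∃ (P : SatHyp.Prog) (K : ℕ),
      SatHyp.DecidesInTime P SatHyp.BackdoorInstance.encode
        (fun I => I.φ.Satisfiable)
        (fun I => K * (2 - ε) ^ I.B.card * (I.φ.size : ℝ) ^ K)) ↔
    (∃ ε : ℝ, 0 < ε ∧ ε < 1 ∧ ∀ c : ℕ, ∃ (P : SatHyp.Prog) (K : ℕ),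
      SatHyp.DecidesInTime P (SatHyp.LogPwInstance.encode (c := c))
        (fun I => I.φ.Satisfiable)
        (fun I => K * (2 - ε) ^ I.M.card * ((I.φ.size + I.D.length : ℕ) : ℝ) ^ K)) := by
  -- The reductions preserve the parameter exactly, so the same `ε` works in both directions; `ε <
  -- 1` makes the base at least `1`.
  refine exists_congr fun ε => and_congr_right fun _ => and_congr_right fun hε => ?_
  have hx : 1 ≤ 2 - ε := by linarith
  constructor
  · intro h c
    refine SatHyp.DecidesInTime.reduce_sized hx (A := 17)
      (fun I => (Nat.zero_lt_of_lt I.φ.lt_size).trans_le (Nat.le_add_right _ _))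
      (fun I => I.mag_encode_le) (fun J => J.size_le_mag.trans (by omega))
      -- The backdoor formula expresses non-reachability, whereas satisfiability is reachability in
      -- `walkGraph c`; hence the complement.
      (SatHyp.ptl_backdoorOutput (SatHyp.walkGraph c).compl)
      (fun I => SatHyp.backdoorInstance (SatHyp.walkGraph c).compl I.encodes)
      (fun I => SatHyp.encode_backdoorInstance _ _) (fun I => ?_)
      (fun I => SatHyp.card_backdoorInstance _ _) h
    rw [SatHyp.satisfiable_backdoorInstance, I.satisfiable_iff]
    exact exists_congr fun τ => by rw [SatHyp.PGraph.reach_compl, not_not]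
  · intro h
    refine SatHyp.DecidesInTime.reduce_sized hx (A := 17)
      (fun I => Nat.zero_lt_of_lt I.φ.lt_size)
      (fun I => I.mag_encode_le) (fun J => J.size_le_mag)
      -- The layered formula expresses reachability, whereas satisfiability is the absence of a
      -- contradictory cycle; hence again the complement. Of the second hypothesis only the case `c
      -- = 1` is needed.
      (SatHyp.ptl_logPwOutput SatHyp.cycleGraph.compl)
      (fun I => SatHyp.logPwInstance SatHyp.cycleGraph.compl I.encodes)
      (fun I => SatHyp.encode_logPwInstance _ _) (fun I => ?_)
      (fun I => SatHyp.card_logPwInstance _ _) (h 1)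
    rw [SatHyp.satisfiable_logPwInstance, I.satisfiable_iff]
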